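/- Let $d\ge 0$, $\mathcal X=[0,1]^d$, and let $f\sim\mathcal{GP}(0,\kappa)$ be a centred Gaussian process on $\mathcal X$ with continuous sample paths, where $\kappa:\mathcal X^2\to\mathbb R$ satisfies $\kappa(x,x')\le 1$. Assume that almost all sample paths have partial derivatives everywhere and that there are $a,b>0$ with $$\mathbb P\Big(\sup_{x\in\mathcal X}\Big|\frac{\partial f(x)}{\partial x_i}\Big|>J\Big)\le a\,e^{-(J/b)^2}\qquad\text{for all } J>0,\ 1\le i\le d .$$ Evaluating $f$ at $x$ returns $y=f(x)+\epsilon$ with fresh independent noise $\epsilon\sim\mathcal N(0,\eta^2)$, $\eta>0$. Parallel Thompson sampling with $M\ge1$ workers: evaluations are numbered $j=1,2,\dots$ in the order of dispatch. Let $F_j$ be the set of pairs $(x_k,y_k)$ of the evaluations completed when evaluation $j$ is dispatched. In the synchronous version, $F_j$ consists of all evaluations of the batches of $M$ preceding that of $j$, i.e. of the first $M\lfloor (j-1)/M\rfloor$ evaluations. In the asynchronous version, a new evaluation is dispatched whenever one finishes, so $F_j=\emptyset$ for $j\le M$ and $F_j$ consists of the first $j-M$ evaluations to finish for $j>M$.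 At step $j$ a function $g_j$ is drawn, with fresh randomness, from the posterior Gaussian process given $F_j$, whose mean and covariance are $$\mu_{F_j}(x)=k(x)^\top(K+\eta^2I)^{-1}y,\qquad \kappa_{F_j}(x,x')=\kappa(x,x')-k(x)^\top(K+\eta^2I)^{-1}k(x'),$$ where $y$ is the vector of observations in $F_j$, $K$ is the matrix of values of $\kappa$ at the query points in $F_j$, and $k(x)$ is the vector of values of $\kappa(x,\cdot)$ at those points. The query point $x_j$ is a maximiser of $g_j$ over $\mathcal X$, chosen by a fixed measurable rule. The order in which evaluations finish is otherwise arbitrary and may be random, but carries no information about $f$, the noise and the posterior sampling. For $n\ge1$ let $\mathrm{BSR}(n)=\mathbb E\big[\max_{x\in\mathcal X}f(x)-\max_{j\in N_n}f(x_j)\big]$, where $N_n$ is the set of the first $n$ evaluations to be completed. With $I$ denoting Shannon mutual information and $y_A$ the noisy observations of $f$ at a finite family $A$ of points (independent noise for each member), let $$\gamma_n=\sup_{A\in\mathcal X^n}I(f;y_A),$$ and let $\xi_M>0$ be any number such that $I(f;y_B\mid y_D)\le\frac12\log\xi_M$ for all finite (possibly empty) families $D,B$ of points of $\mathcal X$ with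 $|B|<M$. Put $$\beta_n=4(d+1)\log n+2d\log(dab\sqrt\pi),\quad C_1=\frac{\pi^2}{6}+\frac{\sqrt{2\pi}}{12},\quad C_2=\frac{2}{\log(1+\eta^{-2})},$$ with the convention $2d\log(dab\sqrt\pi)=0$ for $d=0$. Then, for synchronous as well as for asynchronous parallel Thompson sampling, for every $n\ge1$ the simple regret is integrable and $$\mathrm{BSR}(n)\le\frac{C_1}{n}+\sqrt{\frac{C_2\,\xi_M\,\max(\beta_n,0)\,\gamma_n}{n}} .$$ -/

import Mathlib

open MeasureTheory ProbabilityTheory InformationTheory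
open scoped ENNReal unitInterval Matrix

/-- The domain `[0,1]^d`. -/
abbrev Cube (d : ℕ) : Type := Fin d → unitInterval

/-- Continuous real functions on the cube, the space of sample paths, with its Borel
σ-algebra for the topology of uniform convergence. -/
abbrev SamplePath (d : ℕ) : Type := C(Cube d, ℝ)

instance instMeasurableSpacePath (d : ℕ) : MeasurableSpace (SamplePath d) := borel (SamplePath d)

instance instBorelSpacePath (d : ℕ) : BorelSpace (SamplePath d) := ⟨rfl⟩

instance instStandardBorelSpacePath (d : ℕ) : StandardBorelSpace (SamplePath d) := by
  infer_instance

noncomputable section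

/-! ### Gaussian processes and their sample-path derivatives -/

/-- `ν` is the law `GP(m, k)` of a Gaussian process with continuous paths, mean function `m` and
covariance function `k`. -/
structure IsGPLaw {d : ℕ} (ν : Measure (SamplePath d)) (m : Cube d → ℝ) (k : Cube d → Cube d → ℝ) :
    Prop where
  gaussian : IsGaussianProcess (fun (x : Cube d) (h : SamplePath d) => h x) ν
  mean : ∀ x, ∫ h : SamplePath d, h x ∂ν = m x
  covariance : ∀ x x', cov[fun h : SamplePath d => h x, fun h : SamplePath d => h x'; ν] = k x x'

/-- The function of the `i`-th coordinate obtained from `h` by freezing the other coordinates of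
`x`; it is only looked at on `[0,1]`. -/
def coordSlice {d : ℕ} (h : SamplePath d) (i : Fin d) (x : Cube d) : ℝ → ℝ :=
  fun t => h (Function.update x i (Set.projIcc 0 1 zero_le_one t))

/-- The partial derivative `∂h/∂x_i` at `x` (one-sided on the boundary of the cube). -/
def partialDeriv {d : ℕ} (h : SamplePath d) (i : Fin d) (x : Cube d) : ℝ :=
  derivWithin (coordSlice h i x) (Set.Icc 0 1) (x i)

/-- Sub-Gaussian sample-path derivatives: almost every path has partial derivatives everywhere, and
`P(sup_x |∂f(x)/∂x_i| > J) ≤ a exp(-(J/b)²)` for all `J > 0` and all `i`. -/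
structure SubGaussianDerivatives {Ω : Type*} [MeasurableSpace Ω] (P : Measure Ω) {d : ℕ}
    (f : Ω → SamplePath d) (a b : ℝ) : Prop where
  a_pos : 0 < a
  b_pos : 0 < b
  differentiable : ∀ᵐ ω ∂P, ∀ (i : Fin d) (x : Cube d),
    DifferentiableWithinAt ℝ (coordSlice (f ω) i x) (Set.Icc 0 1) (x i)
  tail : ∀ (i : Fin d) (J : ℝ), 0 < J →
    P {ω | ∃ x : Cube d, J < |partialDeriv (f ω) i x|} ≤
      ENNReal.ofReal (a * Real.exp (-(J / b) ^ 2))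

/-! ### The posterior given noisy observations -/

/-- The regularised Gram matrix `K + η² I` of the points `A`. -/
def gramMatrix {d m : ℕ} (κ : Cube d → Cube d → ℝ) (η : ℝ) (A : Fin m → Cube d) :
    Matrix (Fin m) (Fin m) ℝ :=
  Matrix.of (fun i l => κ (A i) (A l)) + η ^ 2 • (1 : Matrix (Fin m) (Fin m) ℝ)

/-- The posterior mean `k(x)ᵀ (K + η² I)⁻¹ y` given the observations `(A i, y i)`. -/
def posteriorMean {d m : ℕ} (κ : Cube d → Cube d → ℝ) (η : ℝ) (A : Fin m → Cube d)
    (y : Fin m → ℝ) (x : Cube d) : ℝ :=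
  (fun i => κ x (A i)) ⬝ᵥ ((gramMatrix κ η A)⁻¹ *ᵥ y)

/-- The posterior covariance `κ(x,x') - k(x)ᵀ (K + η² I)⁻¹ k(x')` given observations at `A`. -/
def posteriorCov {d m : ℕ} (κ : Cube d → Cube d → ℝ) (η : ℝ) (A : Fin m → Cube d)
    (x x' : Cube d) : ℝ :=
  κ x x' - (fun i => κ x (A i)) ⬝ᵥ ((gramMatrix κ η A)⁻¹ *ᵥ (fun i => κ x' (A i)))

/-! ### Shannon mutual information and the information-gain quantities -/

/-- Shannon mutual information `I(X; Y)`. -/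
def mutualInfo {Ω α β : Type*} [MeasurableSpace Ω] [MeasurableSpace α] [MeasurableSpace β]
    (X : Ω → α) (Y : Ω → β) (P : Measure Ω) : ℝ≥0∞ :=
  klDiv (P.map (fun ω => (X ω, Y ω))) ((P.map X).prod (P.map Y))

/-- Conditional Shannon mutual information `I(X; Y | Z)`: the divergence of the joint law of
`((X, Z), Y)` from the law under which `Y` is, given `Z`, independent of `X`. -/
def condMutualInfo {Ω α β γ : Type*} [MeasurableSpace Ω] [MeasurableSpace α] [MeasurableSpace β]
    [StandardBorelSpace β] [Nonempty β] [MeasurableSpace γ]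
    (X : Ω → α) (Y : Ω → β) (Z : Ω → γ) (P : Measure Ω) [IsFiniteMeasure P] : ℝ≥0∞ :=
  klDiv (P.map (fun ω => ((X ω, Z ω), Y ω)))
    ((P.map (fun ω => (X ω, Z ω))) ⊗ₘ ((condDistrib Y Z P).comap Prod.snd measurable_snd))

/-- The law `N(0, η²)` of one observation noise. -/
def noiseLaw (η : ℝ) : Measure ℝ := gaussianReal 0 (η ^ 2).toNNReal

instance instIsProbabilityMeasureNoiseLaw (η : ℝ) : IsProbabilityMeasure (noiseLaw η) := by
  unfold noiseLaw; infer_instance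

/-- A random function with law `ν` together with `n` independent noise variables. -/
def obsMeasure {d : ℕ} (ν : Measure (SamplePath d)) (η : ℝ) (n : ℕ) :
    Measure (SamplePath d × (Fin n → ℝ)) :=
  ν.prod (Measure.pi (fun _ => noiseLaw η))

instance instIsFiniteMeasureObsMeasure {d : ℕ} (ν : Measure (SamplePath d)) [IsFiniteMeasure ν]
    (η : ℝ) (n : ℕ) : IsFiniteMeasure (obsMeasure ν η n) := by
  unfold obsMeasure; infer_instance

/-- The information gain `I(f; y_A)`, with `y_A` the noisy observations of `f` at `A`. -/
def infoGain {d n : ℕ} (ν : Measure (SamplePath d)) (η : ℝ) (A : Fin n → Cube d) : ℝ≥0∞ :=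
  mutualInfo (fun w : SamplePath d × (Fin n → ℝ) => w.1)
    (fun w i => w.1 (A i) + w.2 i) (obsMeasure ν η n)

/-- The maximum information gain `γ_n`, the supremum of `I(f; y_A)` over `n` points. -/
def maxInfoGain {d : ℕ} (ν : Measure (SamplePath d)) (η : ℝ) (n : ℕ) : ℝ :=
  (⨆ A : Fin n → Cube d, infoGain ν η A).toReal

/-- The conditional information gain `I(f; y_B | y_D)`, all observations having independent
noises. -/
def condInfoGain {d m k : ℕ} (ν : Measure (SamplePath d)) [IsFiniteMeasure ν] (η : ℝ)
    (D : Fin m → Cube d) (B : Fin k → Cube d) : ℝ≥0∞ :=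
  condMutualInfo (fun w : SamplePath d × (Fin (m + k) → ℝ) => w.1)
    (fun w (i : Fin k) => w.1 (B i) + w.2 (Fin.natAdd m i))
    (fun w (i : Fin m) => w.1 (D i) + w.2 (Fin.castAdd k i)) (obsMeasure ν η (m + k))

/-- `ξ` is an admissible value of `ξ_M`: fewer than `M` further observations never carry more than
`(1/2) log ξ` of information about `f`, whatever has been observed before. -/
def IsInflationBound {d : ℕ} (ν : Measure (SamplePath d)) [IsFiniteMeasure ν] (η : ℝ) (M : ℕ)
    (ξ : ℝ) : Prop :=
  0 < ξ ∧ ∀ (m k : ℕ) (D : Fin m → Cube d) (B : Fin k → Cube d), k < M →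
    (condInfoGain ν η D B : EReal) ≤ ((Real.log ξ / 2 : ℝ) : EReal)

/-! ### Parallel Thompson sampling

Evaluations ("jobs") are numbered `0, 1, 2, …` in the order in which they are dispatched to the `M`
workers.  The order in which they finish is recorded by `c`: the `i`-th job to finish (from `i = 0`)
is job `c i`. -/

/-- Synchronous (batch) or asynchronous operation of the workers. -/
inductive ParallelMode
  | sync
  | async

/-- How many jobs have been completed when job `j` is dispatched.  Synchronous: all full batches of
`M` jobs before the batch of `j`.  Asynchronous: none for `j < M`; afterwards each completion
triggers exactly one dispatch. -/
def numCompleted : ParallelMode → ℕ → ℕ → ℕ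
  | .sync, M, j => M * (j / M)
  | .async, M, j => j + 1 - M

/-- `c` is a possible order of completion: no job finishes twice, and every job has been dispatched
by the time it finishes. -/
def IsCompletionOrder (mode : ParallelMode) (M : ℕ) (c : ℕ → ℕ) : Prop :=
  Function.Injective c ∧ ∀ i, numCompleted mode M (c i) ≤ i

/-- What is determined before job `j` is dispatched: the function, the completion order, the noises
of the earlier jobs (whether or not they are finished) and the earlier posterior samples. -/
def history {Ω : Type*} {d : ℕ} (f : Ω → SamplePath d) (c : Ω → ℕ → ℕ) (ε : ℕ → Ω → ℝ)
    (g : ℕ → Ω → SamplePath d) (j : ℕ) (ω : Ω) :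
    (SamplePath d × (ℕ → ℕ)) × ((Fin j → ℝ) × (Fin j → SamplePath d)) :=
  ((f ω, c ω), (fun k => ε k ω, fun k => g k ω))

/-- A run of parallel Thompson sampling with `M` workers on the random function `f`.  For job `j` a
function `g j` is sampled from the posterior Gaussian process given the evaluations that are
completed at that time, the query point is `x_j = argmax g_j`, where `sel` is the (measurable)
maximiser in use, and the observation of job `j` is `y_j = f(x_j) + ε_j`.  The sampling uses fresh
randomness, the noises are independent `N(0, η²)`, and the completion order may be random but
carries no information about `f`, the noises and the sampling. -/
structure IsParallelTS {Ω : Type*} [MeasurableSpace Ω] (P : Measure Ω) [IsFiniteMeasure P]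
    (mode : ParallelMode) (M : ℕ) {d : ℕ} (κ : Cube d → Cube d → ℝ) (η : ℝ)
    (sel : SamplePath d → Cube d) (f : Ω → SamplePath d) (c : Ω → ℕ → ℕ) (ε : ℕ → Ω → ℝ)
    (g : ℕ → Ω → SamplePath d) : Prop where
  measurable_sel : Measurable sel
  sel_isMax : ∀ (h : SamplePath d) (x : Cube d), h x ≤ h (sel h)
  measurable_f : Measurable f
  measurable_c : Measurable c
  measurable_noise : ∀ j, Measurable (ε j)
  measurable_sample : ∀ j, Measurable (g j)
  completionOrder : ∀ ω, IsCompletionOrder mode M (c ω)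
  indep_order : IndepFun f c P
  /-- Posterior sampling: given the past, `g j` has the law of the posterior process. -/
  sample_law : ∀ j, ∀ᵐ ω ∂P,
    IsGPLaw (condDistrib (g j) (history f c ε g j) P (history f c ε g j ω))
      (posteriorMean κ η
        (fun i : Fin (numCompleted mode M j) => sel (g (c ω i) ω))
        (fun i => f ω (sel (g (c ω i) ω)) + ε (c ω i) ω))
      (posteriorCov κ η
        (fun i : Fin (numCompleted mode M j) => sel (g (c ω i) ω)))
  noise_law : ∀ j, P.map (ε j) = noiseLaw η
  noise_indep : ∀ j, IndepFun (ε j) (fun ω => (history f c ε g j ω, g j ω)) P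

/-- The simple regret `f(x⋆) - max f(x_j)`, the maximum being over the first `n` completed
evaluations. -/
def simpleRegret {Ω : Type*} {d : ℕ} (sel : SamplePath d → Cube d) (f : Ω → SamplePath d) (c : Ω → ℕ → ℕ)
    (g : ℕ → Ω → SamplePath d) (n : ℕ) (ω : Ω) : ℝ :=
  (⨆ x : Cube d, f ω x) - ⨆ i : Fin n, f ω (sel (g (c ω i) ω))

/-- `β_n = 4(d+1) log n + 2d log(d a b √π)`. -/
def betaSeq (d : ℕ) (a b : ℝ) (n : ℕ) : ℝ :=
  4 * (d + 1) * Real.log n + 2 * d * Real.log (d * a * b * √Real.pi)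

end

/-! Given the evaluations available to a job, the unknown function f and the posterior sample g are
independent with the same law. Let that law have mean μ and standard deviation σ. Then max f and max
g have the same conditional mean, while f at the query averages to μ there. The expected regret of
the job is therefore the mean of h(x) - μ(x), where h is a posterior draw and x its maximiser
(`IsGPLaw.lintegral_lintegral_regret_le`).

This is at most s times the mean of σ at the query, plus the mean excess of h over the upper
confidence bound μ + sσ. The excess is controlled on a grid of K^d cells. Each cell is represented
by the point where σ is smallest, so only the paths and μ, not σ, need a Lipschitz bound. A grid
point costs exp(-1 - s²/2), and the passage to the grid costs 2/K times the expected Lipschitz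
constant. With s² = β_n and K = ⌊n² d a b √π⌋ both costs are of order 1/n²; when n² d a b √π < 3 the
expected Lipschitz constant alone bounds the regret.

It remains to sum σ² over the first n finishers (`IsPosteriorKernel.sum_posteriorCov_le`).
Conditioning in addition on the finishers dispatched earlier adds fewer than M evaluations to the
data of a job. Extra observations shrink a posterior variance by at most the exponential of twice
their information, here at most ξ. Listed in dispatch order, the new variances are the successive
predictive variances of a single n-point design, so the chain rule bounds the sum of their
logarithms by 2γ_n. Cauchy–Schwarz finishes.

The delicate point is the conditional law of f, because queries are adaptive, results are delayed
and the order is random. The first n entries of the order take countably many values and are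
independent of f, so they can be fixed. Along a list of jobs closed under "used the result of", one
argues by induction in dispatch order: a new query is drawn from data already listed with fresh
randomness, hence says nothing more about f, and its observation updates the posterior by Gaussian
conditioning (`IsParallelTS.setLIntegral_jobData`). The posteriors are explicit kernels built one
observation at a time, and they are matched with the sampling laws through uniqueness of a Gaussian
law with given mean and covariance (`IsGPLaw.unique`). -/

/-! ### Linear algebra of the posterior formulas. -/

/-- Symmetric positive semidefinite kernels on the cube. -/
structure IsPSDKernel {d : ℕ} (κ : Cube d → Cube d → ℝ) : Prop where
  symm : ∀ x x', κ x x' = κ x' x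
  nonneg : ∀ {m : ℕ} (A : Fin m → Cube d) (u : Fin m → ℝ),
    0 ≤ u ⬝ᵥ (Matrix.of (fun i l => κ (A i) (A l)) *ᵥ u)

theorem IsPSDKernel.posDef_gramMatrix {d m : ℕ} {κ : Cube d → Cube d → ℝ} (hκ : IsPSDKernel κ)
    {η : ℝ} (hη : 0 < η) (A : Fin m → Cube d) : (gramMatrix κ η A).PosDef := by
  unfold gramMatrix
  refine Matrix.PosDef.posSemidef_add ?_ ?_
  · refine Matrix.PosSemidef.of_dotProduct_mulVec_nonneg ?_ ?_
    · ext i l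
      simp [hκ.symm (A i) (A l)]
    · intro u
      simpa using hκ.nonneg A u
  · exact Matrix.PosDef.one.smul (by positivity)

theorem IsPSDKernel.isUnit_det_gramMatrix {d m : ℕ} {κ : Cube d → Cube d → ℝ}
    (hκ : IsPSDKernel κ) {η : ℝ} (hη : 0 < η) (A : Fin m → Cube d) :
    IsUnit (gramMatrix κ η A).det :=
  (hκ.posDef_gramMatrix hη A).det_pos.ne'.isUnit

/-- Block elimination of the last row and column of the regularised Gram matrix. -/
theorem dotProduct_gramMatrix_inv_succ {d m : ℕ} {κ : Cube d → Cube d → ℝ} (hκ : IsPSDKernel κ)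
    {η : ℝ} (hη : 0 < η) (A : Fin (m + 1) → Cube d)
    (hv : posteriorCov κ η (fun i : Fin m => A i.castSucc) (A (Fin.last m)) (A (Fin.last m))
      + η ^ 2 ≠ 0) (t u : Fin (m + 1) → ℝ) :
    t ⬝ᵥ ((gramMatrix κ η A)⁻¹ *ᵥ u) =
      (fun i : Fin m => t i.castSucc) ⬝ᵥ
          ((gramMatrix κ η (fun i : Fin m => A i.castSucc))⁻¹ *ᵥ fun i => u i.castSucc) +
        (u (Fin.last m) - posteriorMean κ η (fun i : Fin m => A i.castSucc)
            (fun i => u i.castSucc) (A (Fin.last m))) *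
          (t (Fin.last m) - posteriorMean κ η (fun i : Fin m => A i.castSucc)
            (fun i => t i.castSucc) (A (Fin.last m))) /
          (posteriorCov κ η (fun i : Fin m => A i.castSucc) (A (Fin.last m)) (A (Fin.last m))
            + η ^ 2) := by
  set A' : Fin m → Cube d := fun i => A i.castSucc with hA'
  set b := A (Fin.last m) with hb
  set G' := gramMatrix κ η A' with hG'
  set kb : Fin m → ℝ := fun i => κ b (A' i) with hkb
  set v := posteriorCov κ η A' b b + η ^ 2 with hvdef
  set u' : Fin m → ℝ := fun i => u i.castSucc with hu'
  set t' : Fin m → ℝ := fun i => t i.castSucc with ht'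
  set r := (u (Fin.last m) - posteriorMean κ η A' u' b) / v with hr
  have hU := hκ.isUnit_det_gramMatrix hη A
  have hU' := hκ.isUnit_det_gramMatrix hη A'
  have hGT : G'ᵀ = G' := by
    have := (hκ.posDef_gramMatrix hη A').isHermitian
    simpa [Matrix.IsHermitian, Matrix.conjTranspose_eq_transpose_of_trivial] using this
  -- Candidate solution of the full system by Schur complement: `v` is the complement of the last
  -- pivot, `r` the last coordinate, and `w'` the old solution corrected for it.
  set w' : Fin m → ℝ := G'⁻¹ *ᵥ u' - r • (G'⁻¹ *ᵥ kb) with hw'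
  set w : Fin (m + 1) → ℝ := Fin.snoc w' r with hw
  have hGw' : G' *ᵥ w' = u' - r • kb := by
    rw [hw', Matrix.mulVec_sub, Matrix.mulVec_smul, Matrix.mulVec_mulVec, Matrix.mulVec_mulVec,
      Matrix.mul_nonsing_inv _ hU', Matrix.one_mulVec, Matrix.one_mulVec]
  have hGw : gramMatrix κ η A *ᵥ w = u := by
    ext i
    refine Fin.lastCases ?_ (fun i => ?_) i
    · have h1 : (gramMatrix κ η A *ᵥ w) (Fin.last m) = kb ⬝ᵥ w' + (κ b b + η ^ 2) * r := by
        simp [Matrix.mulVec, dotProduct, Fin.sum_univ_castSucc, gramMatrix, hw, Matrix.one_apply,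
          hkb, hA', hb, (Fin.castSucc_lt_last _).ne']
      rw [h1, hw', dotProduct_sub, dotProduct_smul]
      have h2 : kb ⬝ᵥ G'⁻¹ *ᵥ u' = posteriorMean κ η A' u' b := rfl
      have h3 : kb ⬝ᵥ G'⁻¹ *ᵥ kb = κ b b - (v - η ^ 2) := by
        simp [hvdef, posteriorCov, hkb, hG']
      rw [h2, h3, smul_eq_mul]
      have : r * v = u (Fin.last m) - posteriorMean κ η A' u' b := by
        rw [hr]; field_simp
      linarith
    · have h1 : (gramMatrix κ η A *ᵥ w) i.castSucc = (G' *ᵥ w') i + kb i * r := by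
        simp [Matrix.mulVec, dotProduct, Fin.sum_univ_castSucc, gramMatrix, hw, Matrix.one_apply,
          hkb, hA', hb, hG', (Fin.castSucc_lt_last _).ne, hκ.symm (A (Fin.last m))]
      rw [h1, hGw']
      simp [hu']
      ring
  have hinv : (gramMatrix κ η A)⁻¹ *ᵥ u = w := by
    rw [← hGw, Matrix.mulVec_mulVec, Matrix.nonsing_inv_mul _ hU, Matrix.one_mulVec]
  have hsplit : t ⬝ᵥ w = t' ⬝ᵥ w' + t (Fin.last m) * r := by
    simp [dotProduct, Fin.sum_univ_castSucc, hw, ht']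
  have hsym : t' ⬝ᵥ G'⁻¹ *ᵥ kb = posteriorMean κ η A' t' b := by
    change _ = kb ⬝ᵥ G'⁻¹ *ᵥ t'
    rw [Matrix.dotProduct_mulVec, ← Matrix.mulVec_transpose, Matrix.transpose_nonsing_inv, hGT,
      dotProduct_comm]
  rw [hinv, hsplit, hw', dotProduct_sub, dotProduct_smul, hsym, smul_eq_mul, hr]
  ring

theorem posteriorCov_eq_sub_posteriorMean {d m : ℕ} (κ : Cube d → Cube d → ℝ) (η : ℝ)
    (A : Fin m → Cube d) (x x' : Cube d) :
    posteriorCov κ η A x x' = κ x x' - posteriorMean κ η A (fun i => κ x' (A i)) x := rfl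

theorem IsPSDKernel.posteriorCov_symm {d m : ℕ} {κ : Cube d → Cube d → ℝ} (hκ : IsPSDKernel κ)
    {η : ℝ} (hη : 0 < η) (A : Fin m → Cube d) (x x' : Cube d) :
    posteriorCov κ η A x x' = posteriorCov κ η A x' x := by
  have hGT : (gramMatrix κ η A)ᵀ = gramMatrix κ η A := by
    have := (hκ.posDef_gramMatrix hη A).isHermitian
    simpa [Matrix.IsHermitian, Matrix.conjTranspose_eq_transpose_of_trivial] using this
  unfold posteriorCov
  rw [hκ.symm x x', Matrix.dotProduct_mulVec, ← Matrix.mulVec_transpose,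
    Matrix.transpose_nonsing_inv, hGT, dotProduct_comm]

/-- Kalman form: the new mean is the old one plus gain times innovation. This recursion and the one
for the covariance let posteriors be built one observation at a time. -/
theorem IsPSDKernel.posteriorMean_succ {d m : ℕ} {κ : Cube d → Cube d → ℝ} (hκ : IsPSDKernel κ)
    {η : ℝ} (hη : 0 < η) (A : Fin (m + 1) → Cube d)
    (hv : posteriorCov κ η (fun i : Fin m => A i.castSucc) (A (Fin.last m)) (A (Fin.last m))
      + η ^ 2 ≠ 0) (y : Fin (m + 1) → ℝ) (x : Cube d) :
    posteriorMean κ η A y x =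
      posteriorMean κ η (fun i : Fin m => A i.castSucc) (fun i => y i.castSucc) x +
        posteriorCov κ η (fun i : Fin m => A i.castSucc) x (A (Fin.last m)) /
          (posteriorCov κ η (fun i : Fin m => A i.castSucc) (A (Fin.last m)) (A (Fin.last m))
            + η ^ 2) *
        (y (Fin.last m) - posteriorMean κ η (fun i : Fin m => A i.castSucc)
          (fun i => y i.castSucc) (A (Fin.last m))) := by
  have h := dotProduct_gramMatrix_inv_succ hκ hη A hv (fun i => κ x (A i)) y
  rw [hκ.posteriorCov_symm hη _ x (A (Fin.last m)), posteriorCov_eq_sub_posteriorMean _ _ _ _ x,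
    hκ.symm _ x]
  unfold posteriorMean at h ⊢
  rw [h]
  ring

theorem IsPSDKernel.posteriorCov_succ {d m : ℕ} {κ : Cube d → Cube d → ℝ} (hκ : IsPSDKernel κ)
    {η : ℝ} (hη : 0 < η) (A : Fin (m + 1) → Cube d)
    (hv : posteriorCov κ η (fun i : Fin m => A i.castSucc) (A (Fin.last m)) (A (Fin.last m))
      + η ^ 2 ≠ 0) (x x' : Cube d) :
    posteriorCov κ η A x x' =
      posteriorCov κ η (fun i : Fin m => A i.castSucc) x x' -
        posteriorCov κ η (fun i : Fin m => A i.castSucc) x (A (Fin.last m)) *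
          posteriorCov κ η (fun i : Fin m => A i.castSucc) x' (A (Fin.last m)) /
          (posteriorCov κ η (fun i : Fin m => A i.castSucc) (A (Fin.last m)) (A (Fin.last m))
            + η ^ 2) := by
  have h := dotProduct_gramMatrix_inv_succ hκ hη A hv (fun i => κ x (A i)) (fun i => κ x' (A i))
  have hz (z : Cube d) : posteriorCov κ η (fun i : Fin m => A i.castSucc) z (A (Fin.last m)) =
      κ z (A (Fin.last m)) - posteriorMean κ η (fun i : Fin m => A i.castSucc)
        (fun i => κ z (A i.castSucc)) (A (Fin.last m)) := by
    rw [hκ.posteriorCov_symm hη, posteriorCov_eq_sub_posteriorMean, hκ.symm z]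
  change posteriorMean κ η A _ x = posteriorMean κ η _ _ x + _ at h
  rw [hz x, hz x', posteriorCov_eq_sub_posteriorMean _ _ A,
    posteriorCov_eq_sub_posteriorMean _ _ _ x x', h]
  ring

theorem gramMatrix_comp_equiv {d m m' : ℕ} (κ : Cube d → Cube d → ℝ) (η : ℝ)
    (A : Fin m → Cube d) (e : Fin m' ≃ Fin m) :
    gramMatrix κ η (A ∘ e) = (gramMatrix κ η A).submatrix e e := by
  ext i l
  simp [gramMatrix, Matrix.one_apply]

/-- Relabelling conjugates the Gram matrix by a permutation. The algorithm lists its data by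
completion, the arguments below list them by dispatch. -/
theorem posteriorMean_comp_equiv {d m m' : ℕ} (κ : Cube d → Cube d → ℝ) (η : ℝ)
    (A : Fin m → Cube d) (y : Fin m → ℝ) (e : Fin m' ≃ Fin m) (x : Cube d) :
    posteriorMean κ η (A ∘ e) (y ∘ e) x = posteriorMean κ η A y x := by
  unfold posteriorMean
  rw [gramMatrix_comp_equiv, Matrix.inv_submatrix_equiv, Matrix.submatrix_mulVec_equiv]
  have : ((y ∘ e) ∘ e.symm) = y := by ext i; simp
  rw [this]
  exact (Equiv.sum_comp e (fun i => κ x (A i) * ((gramMatrix κ η A)⁻¹ *ᵥ y) i))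

theorem posteriorCov_comp_equiv {d m m' : ℕ} (κ : Cube d → Cube d → ℝ) (η : ℝ)
    (A : Fin m → Cube d) (e : Fin m' ≃ Fin m) (x x' : Cube d) :
    posteriorCov κ η (A ∘ e) x x' = posteriorCov κ η A x x' := by
  rw [posteriorCov_eq_sub_posteriorMean, posteriorCov_eq_sub_posteriorMean]
  congr 1
  exact posteriorMean_comp_equiv κ η A (fun i => κ x' (A i)) e x

/-! ### Gaussian laws on path space are determined by mean and covariance. -/

section GPLaw

variable {d : ℕ} {ν ν' : Measure (SamplePath d)} {m m' : Cube d → ℝ} {k k' : Cube d → Cube d → ℝ}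

theorem measurable_eval_path (x : Cube d) : Measurable fun h : SamplePath d => h x :=
  (continuous_eval_const x).measurable

/-- The values on a countable dense set determine the path in a measurable way. -/
theorem exists_measurableEmbedding_eval (d : ℕ) : ∃ D : Set (Cube d),
    MeasurableEmbedding fun (h : SamplePath d) (x : D) => h x := by
  let D : Set (Cube d) := Set.range (TopologicalSpace.denseSeq (Cube d))
  have hD : Dense D := TopologicalSpace.denseRange_denseSeq _
  have : Countable D := (Set.countable_range _).to_subtype
  have hr : Measurable fun (h : SamplePath d) (x : D) => h x :=
    measurable_pi_lambda _ fun x => measurable_eval_path _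
  refine ⟨D, hr.measurableEmbedding fun h h' hh => ?_⟩
  have : (h : Cube d → ℝ) = h' :=
    Continuous.ext_on hD h.continuous h'.continuous fun x hx => congrFun hh ⟨x, hx⟩
  exact DFunLike.coe_injective this

theorem IsGPLaw.isProbabilityMeasure (hν : IsGPLaw ν m k) : IsProbabilityMeasure ν :=
  hν.gaussian.isProbabilityMeasure

theorem IsGPLaw.memLp_eval (hν : IsGPLaw ν m k) (x : Cube d) :
    MemLp (fun h : SamplePath d => h x) 2 ν :=
  (hν.gaussian.hasGaussianLaw_eval x).memLp_two

theorem IsGPLaw.cov_symm (hν : IsGPLaw ν m k) (x x' : Cube d) : k x x' = k x' x := by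
  rw [← hν.covariance, ← hν.covariance, covariance_comm]

theorem IsGPLaw.isPSDKernel (hν : IsGPLaw ν m k) : IsPSDKernel k where
  symm := hν.cov_symm
  nonneg A u := by
    have := hν.isProbabilityMeasure
    have h := variance_nonneg (fun h : SamplePath d => ∑ i, u i * h (A i)) ν
    rw [← covariance_self (by
      exact (Finset.measurable_sum _ fun i _ =>
        (measurable_eval_path (A i)).const_mul (u i)).aemeasurable)] at h
    rw [covariance_fun_sum_fun_sum (fun i => (hν.memLp_eval _).const_mul _)
      (fun i => (hν.memLp_eval _).const_mul _)] at h
    simp_rw [covariance_const_mul_left, covariance_const_mul_right, hν.covariance] at h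
    refine h.trans_eq ?_
    simp only [dotProduct, Matrix.mulVec, Matrix.of_apply, Finset.mul_sum]
    refine Finset.sum_congr rfl fun i _ => Finset.sum_congr rfl fun l _ => by ring

/-- The characteristic functional of a Gaussian vector involves only means and variances of linear
combinations, and `m` and `k` give these. -/
theorem IsGPLaw.map_restrict_eq (hν : IsGPLaw ν m k) (hν' : IsGPLaw ν' m k)
    (T : Finset (Cube d)) :
    ν.map (fun h => T.restrict (fun x => h x)) = ν'.map (fun h => T.restrict (fun x => h x)) := by
  have := hν.isProbabilityMeasure
  have := hν'.isProbabilityMeasure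
  apply Measure.ext_of_charFunDual
  ext L
  have h1 := hν.gaussian.hasGaussianLaw T
  have h2 := hν'.gaussian.hasGaussianLaw T
  have hL : ∀ h : SamplePath d, L (T.restrict fun x => h x) =
      ∑ i : T, L (Pi.single i 1) * h i := by
    intro h
    conv_lhs => rw [← Finset.univ_sum_single (T.restrict fun x => h x)]
    rw [map_sum]
    refine Finset.sum_congr rfl fun i _ => ?_
    have : (Pi.single i (T.restrict (fun x => h x) i) : T → ℝ) = (h i) • Pi.single i 1 := by
      ext j; by_cases hj : j = i
      · subst hj; simp
      · simp [hj]
    rw [this, map_smul, smul_eq_mul, mul_comm]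
  rw [h1.charFunDual_map_eq_fun L, h2.charFunDual_map_eq_fun L]
  simp_rw [hL]
  have key : ∀ ρ : Measure (SamplePath d), IsGPLaw ρ m k →
      (∫ h, ∑ i : T, L (Pi.single i 1) * h i ∂ρ = ∑ i : T, L (Pi.single i 1) * m i) ∧
      Var[fun h : SamplePath d => ∑ i : T, L (Pi.single i 1) * h i; ρ] =
        ∑ i : T, ∑ j : T, L (Pi.single i 1) * (L (Pi.single j 1) * k i j) := by
    intro ρ hρ
    have := hρ.isProbabilityMeasure
    constructor
    · rw [integral_finsetSum _ fun i _ => ((hρ.memLp_eval _).integrable (by norm_num)).const_mul _]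
      simp_rw [integral_const_mul, hρ.mean]
    · have hm : Measurable fun h : SamplePath d => ∑ i : T, L (Pi.single i 1) * h i :=
        Finset.measurable_sum _ fun i _ => (measurable_eval_path (i : Cube d)).const_mul _
      rw [← covariance_self hm.aemeasurable]
      rw [covariance_fun_sum_fun_sum (fun i => (hρ.memLp_eval _).const_mul _)
        (fun i => (hρ.memLp_eval _).const_mul _)]
      simp_rw [covariance_const_mul_left, covariance_const_mul_right, hρ.covariance]
  rw [(key ν hν).1, (key ν hν).2, (key ν' hν').1, (key ν' hν').2]

/-- A Gaussian law on the space of continuous paths is determined by its mean and covariance. -/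
theorem IsGPLaw.unique (hν : IsGPLaw ν m k) (hν' : IsGPLaw ν' m k) : ν = ν' := by
  have := hν.isProbabilityMeasure
  have := hν'.isProbabilityMeasure
  obtain ⟨D, hemb⟩ := exists_measurableEmbedding_eval d
  set r : SamplePath d → D → ℝ := fun h x => h x
  have hr : Measurable r := hemb.measurable
  -- Finite-dimensional marginals determine the law on `D → ℝ`; the measurable embedding by values
  -- on the countable dense set `D` carries the equality back to paths.
  have hmap : ν.map r = ν'.map r := by
    refine IsProjectiveLimit.unique (P := fun T => (ν.map r).map T.restrict) (fun T => rfl) ?_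
    intro T
    change (ν'.map r).map T.restrict = (ν.map r).map T.restrict
    rw [Measure.map_map (by fun_prop) hr, Measure.map_map (by fun_prop) hr]
    classical
    let J : Finset (Cube d) := T.map (Function.Embedding.subtype _)
    let φ : (J → ℝ) → (T → ℝ) := fun z i => z ⟨i.1.1, by
      simp only [J, Finset.mem_map]; exact ⟨i.1, i.2, rfl⟩⟩
    have hφ : Measurable φ := measurable_pi_lambda _ fun i => measurable_pi_apply _
    have hJ : Measurable (fun h : SamplePath d => J.restrict (fun x => h x)) :=
      measurable_pi_lambda _ fun x => measurable_eval_path _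
    have e : (T.restrict ∘ r) = φ ∘ (fun h : SamplePath d => J.restrict (fun x => h x)) := by
      ext h i; rfl
    rw [e, ← Measure.map_map hφ hJ, ← Measure.map_map hφ hJ, hν.map_restrict_eq hν']
  rw [← hemb.comap_map ν, ← hemb.comap_map ν', hmap]

end GPLaw

/-! ### Conditioning a Gaussian path on one noisy value. -/

section Update

variable {d : ℕ} {ν : Measure (SamplePath d)} {m : Cube d → ℝ} {k : Cube d → Cube d → ℝ}

theorem isGaussian_noiseLaw (η : ℝ) : IsGaussian (noiseLaw η) := by
  unfold noiseLaw; infer_instance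

theorem memLp_id_noiseLaw (η : ℝ) : MemLp (fun e : ℝ => e) 2 (noiseLaw η) := by
  unfold noiseLaw; exact memLp_id_gaussianReal' 2 (by norm_num)

theorem variance_noiseLaw (η : ℝ) : Var[fun e : ℝ => e; noiseLaw η] = η ^ 2 := by
  unfold noiseLaw
  rw [variance_fun_id_gaussianReal]; simp [sq_nonneg]

theorem integral_noiseLaw (η : ℝ) : ∫ e, e ∂noiseLaw η = 0 := by
  unfold noiseLaw
  rw [integral_id_gaussianReal]

/-- The values of the path together with an independent noise form a Gaussian process. -/
theorem IsGPLaw.isGaussianProcess_sumElim (hν : IsGPLaw ν m k) (η : ℝ) :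
    IsGaussianProcess (Sum.elim (fun (x : Cube d) (p : SamplePath d × ℝ) => p.1 x)
      (fun (_ : Unit) p => p.2)) (ν.prod (noiseLaw η)) where
  hasGaussianLaw T := by
    classical
    have := hν.isProbabilityMeasure
    have := isGaussian_noiseLaw η
    let J : Finset (Cube d) := T.toLeft
    have h1 : HasGaussianLaw (fun p : SamplePath d × ℝ => J.restrict (fun x => p.1 x))
        (ν.prod (noiseLaw η)) := by
      constructor
      have e : (fun p : SamplePath d × ℝ => J.restrict (fun x => p.1 x)) =
        (fun h : SamplePath d => J.restrict (fun x => h x)) ∘ Prod.fst := rfl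
      have hJ : Measurable fun h : SamplePath d => J.restrict (fun x => h x) :=
        measurable_pi_lambda _ fun x => measurable_eval_path _
      rw [e, ← Measure.map_map hJ measurable_fst, Measure.map_fst_prod]
      simpa using (hν.gaussian.hasGaussianLaw J).isGaussian_map
    have h2 : HasGaussianLaw (fun p : SamplePath d × ℝ => p.2) (ν.prod (noiseLaw η)) := by
      constructor
      change IsGaussian (Measure.map Prod.snd _)
      rw [Measure.map_snd_prod]
      simpa using isGaussian_noiseLaw η
    have hind : IndepFun (fun p : SamplePath d × ℝ => J.restrict (fun x => p.1 x))
        (fun p : SamplePath d × ℝ => p.2) (ν.prod (noiseLaw η)) :=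
      indepFun_prod (X := fun h : SamplePath d => J.restrict (fun x => h x)) (Y := fun e : ℝ => e)
        (measurable_pi_lambda _ fun x => measurable_eval_path _) measurable_id
    have h3 := hind.hasGaussianLaw h1 h2
    let L : ((J → ℝ) × ℝ) →L[ℝ] (T → ℝ) := ContinuousLinearMap.pi fun t =>
      match t with
      | ⟨Sum.inl x, hx⟩ => (ContinuousLinearMap.proj (⟨x, by simpa [J] using hx⟩ : J)).comp
          (ContinuousLinearMap.fst ℝ (J → ℝ) ℝ)
      | ⟨Sum.inr _, _⟩ => ContinuousLinearMap.snd ℝ (J → ℝ) ℝ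
    have h4 := h3.map_fun L
    refine h4.congr (Filter.Eventually.of_forall fun p => ?_)
    ext ⟨t, ht⟩
    cases t <;> rfl

/-- The part of the path that is not explained by the observation `h b + e`, together with the
observation, forms a Gaussian process. -/
theorem IsGPLaw.isGaussianProcess_residual (hν : IsGPLaw ν m k) (η : ℝ) (b : Cube d)
    (W : SamplePath d) :
    IsGaussianProcess (Sum.elim
      (fun (x : Cube d) (p : SamplePath d × ℝ) => p.1 x - W x * (p.1 b + p.2))
      (fun (_ : Unit) p => p.1 b + p.2)) (ν.prod (noiseLaw η)) := by
  classical
  refine IsGaussianProcess.of_isGaussianProcess (hν.isGaussianProcess_sumElim η) fun s => ?_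
  cases s with
  | inl x =>
    let T : Finset (Cube d ⊕ Unit) := {Sum.inl x, Sum.inl b, Sum.inr ()}
    let px : (T → ℝ) →L[ℝ] ℝ := ContinuousLinearMap.proj ⟨Sum.inl x, by simp [T]⟩
    let pb : (T → ℝ) →L[ℝ] ℝ := ContinuousLinearMap.proj ⟨Sum.inl b, by simp [T]⟩
    let pe : (T → ℝ) →L[ℝ] ℝ := ContinuousLinearMap.proj ⟨Sum.inr (), by simp [T]⟩
    exact ⟨T, px - W x • (pb + pe), fun p => by simp [px, pb, pe]; ring⟩
  | inr u =>
    let T : Finset (Cube d ⊕ Unit) := {Sum.inl b, Sum.inr ()}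
    let pb : (T → ℝ) →L[ℝ] ℝ := ContinuousLinearMap.proj ⟨Sum.inl b, by simp [T]⟩
    let pe : (T → ℝ) →L[ℝ] ℝ := ContinuousLinearMap.proj ⟨Sum.inr (), by simp [T]⟩
    exact ⟨T, pb + pe, fun p => by simp [pb, pe]⟩

theorem IsGPLaw.memLp_fst (hν : IsGPLaw ν m k) (η : ℝ) (x : Cube d) :
    MemLp (fun p : SamplePath d × ℝ => p.1 x) 2 (ν.prod (noiseLaw η)) :=
  ((hν.isGaussianProcess_sumElim η).hasGaussianLaw_eval (Sum.inl x)).memLp_two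

theorem IsGPLaw.memLp_snd (hν : IsGPLaw ν m k) (η : ℝ) :
    MemLp (fun p : SamplePath d × ℝ => p.2) 2 (ν.prod (noiseLaw η)) :=
  ((hν.isGaussianProcess_sumElim η).hasGaussianLaw_eval (Sum.inr ())).memLp_two

theorem IsGPLaw.memLp_obs (hν : IsGPLaw ν m k) (η : ℝ) (b : Cube d) :
    MemLp (fun p : SamplePath d × ℝ => p.1 b + p.2) 2 (ν.prod (noiseLaw η)) :=
  (hν.memLp_fst η b).add (hν.memLp_snd η)

theorem IsGPLaw.cov_fst_fst (hν : IsGPLaw ν m k) (η : ℝ) (x x' : Cube d) :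
    cov[fun p : SamplePath d × ℝ => p.1 x, fun p => p.1 x'; ν.prod (noiseLaw η)] = k x x' := by
  have := hν.isProbabilityMeasure
  rw [← hν.covariance x x']
  have h := covariance_map_fun (μ := ν.prod (noiseLaw η)) (Z := Prod.fst)
    (X := fun h : SamplePath d => h x) (Y := fun h : SamplePath d => h x')
    (measurable_eval_path x).aestronglyMeasurable (measurable_eval_path x').aestronglyMeasurable
    measurable_fst.aemeasurable
  rw [← h, Measure.map_fst_prod]
  simp

theorem IsGPLaw.cov_snd_snd (hν : IsGPLaw ν m k) (η : ℝ) :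
    cov[fun p : SamplePath d × ℝ => p.2, fun p => p.2; ν.prod (noiseLaw η)] = η ^ 2 := by
  have := hν.isProbabilityMeasure
  have h := covariance_map_fun (μ := ν.prod (noiseLaw η)) (Z := Prod.snd)
    (X := fun e : ℝ => e) (Y := fun e : ℝ => e)
    measurable_id.aestronglyMeasurable measurable_id.aestronglyMeasurable
    measurable_snd.aemeasurable
  rw [← h, Measure.map_snd_prod, measure_univ, one_smul, covariance_self (by fun_prop),
    variance_noiseLaw]

theorem IsGPLaw.cov_fst_snd (hν : IsGPLaw ν m k) (η : ℝ) (x : Cube d) :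
    cov[fun p : SamplePath d × ℝ => p.1 x, fun p => p.2; ν.prod (noiseLaw η)] = 0 := by
  have := hν.isProbabilityMeasure
  exact covariance_fst_snd_prod (hν.memLp_eval x) (memLp_id_noiseLaw η)

theorem IsGPLaw.cov_fst_obs (hν : IsGPLaw ν m k) (η : ℝ) (x b : Cube d) :
    cov[fun p : SamplePath d × ℝ => p.1 x, fun p => p.1 b + p.2; ν.prod (noiseLaw η)] = k x b := by
  have := hν.isProbabilityMeasure
  have h := covariance_add_right (hν.memLp_fst η x) (hν.memLp_fst η b) (hν.memLp_snd η)
  rw [hν.cov_fst_fst, hν.cov_fst_snd, add_zero] at h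
  exact h

theorem IsGPLaw.cov_obs_obs (hν : IsGPLaw ν m k) (η : ℝ) (b : Cube d) :
    cov[fun p : SamplePath d × ℝ => p.1 b + p.2, fun p => p.1 b + p.2; ν.prod (noiseLaw η)] =
      k b b + η ^ 2 := by
  have := hν.isProbabilityMeasure
  have h := covariance_add_left (hν.memLp_fst η b) (hν.memLp_snd η) (hν.memLp_obs η b)
  have h2 := covariance_add_right (hν.memLp_snd η) (hν.memLp_fst η b) (hν.memLp_snd η)
  have h3 := covariance_comm (μ := ν.prod (noiseLaw η)) (fun p : SamplePath d × ℝ => p.2)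
    (fun p => p.1 b)
  rw [h3, hν.cov_fst_snd, hν.cov_snd_snd, zero_add] at h2
  refine h.trans ?_
  rw [hν.cov_fst_obs]
  congr 1

theorem IsGPLaw.integral_fst (hν : IsGPLaw ν m k) (η : ℝ) (x : Cube d) :
    ∫ p : SamplePath d × ℝ, p.1 x ∂(ν.prod (noiseLaw η)) = m x := by
  have := hν.isProbabilityMeasure
  rw [← hν.mean x, integral_fun_fst (fun h : SamplePath d => h x)]
  simp

theorem IsGPLaw.integral_obs (hν : IsGPLaw ν m k) (η : ℝ) (b : Cube d) :
    ∫ p : SamplePath d × ℝ, (p.1 b + p.2) ∂(ν.prod (noiseLaw η)) = m b := by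
  have := hν.isProbabilityMeasure
  rw [integral_add ((hν.memLp_fst η b).integrable (by norm_num))
    ((hν.memLp_snd η).integrable (by norm_num)), hν.integral_fst,
    integral_fun_snd (fun e : ℝ => e), integral_noiseLaw]
  simp

theorem IsGPLaw.map_obs (hν : IsGPLaw ν m k) (η : ℝ) (b : Cube d) :
    (ν.prod (noiseLaw η)).map (fun p => p.1 b + p.2) =
      gaussianReal (m b) (k b b + η ^ 2).toNNReal := by
  have h := (hν.isGaussianProcess_residual η b 0).hasGaussianLaw_eval (Sum.inr ())
  have h2 := h.map_eq_gaussianReal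
  simp only [Sum.elim_inr] at h2
  rw [h2, hν.integral_obs, ← covariance_self (hν.memLp_obs η b).aemeasurable, hν.cov_obs_obs]

/-- The path shifted towards an observed value `y` of `h b + e`, with gain `W`. -/
def shiftPath {d : ℕ} (b : Cube d) (W : SamplePath d) (y : ℝ) (p : SamplePath d × ℝ) :
    SamplePath d :=
  p.1 + (y - (p.1 b + p.2)) • W

theorem shiftPath_apply (b : Cube d) (W : SamplePath d) (y : ℝ) (p : SamplePath d × ℝ)
    (x : Cube d) : shiftPath b W y p x = p.1 x + (y - (p.1 b + p.2)) * W x := rfl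

theorem continuous_shiftPath :
    Continuous fun q : (Cube d × SamplePath d × ℝ) × SamplePath d × ℝ =>
      shiftPath q.1.1 q.1.2.1 q.1.2.2 q.2 := by
  unfold shiftPath
  fun_prop

theorem measurable_shiftPath (b : Cube d) (W : SamplePath d) (y : ℝ) :
    Measurable (shiftPath b W y) :=
  (continuous_shiftPath.comp (by fun_prop : Continuous fun p : SamplePath d × ℝ =>
    ((b, W, y), p))).measurable

theorem IsGPLaw.pos_obs (hν : IsGPLaw ν m k) {η : ℝ} (hη : 0 < η) (b : Cube d) :
    0 < k b b + η ^ 2 := by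
  have h := hν.isPSDKernel.nonneg (fun _ : Fin 1 => b) (fun _ => 1)
  simp [Matrix.mulVec, dotProduct] at h
  positivity

/-- The law of the path conditioned on one noisy observation is again a Gaussian process. -/
theorem IsGPLaw.map_shiftPath (hν : IsGPLaw ν m k) {η : ℝ} (hη : 0 < η) (b : Cube d)
    (W : SamplePath d) (hW : ∀ x, W x = k x b / (k b b + η ^ 2)) (y : ℝ) :
    IsGPLaw ((ν.prod (noiseLaw η)).map (shiftPath b W y)) (fun x => m x + W x * (y - m b))
      (fun x x' => k x x' - k x b * k x' b / (k b b + η ^ 2)) := by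
  have := hν.isProbabilityMeasure
  have hmeas := measurable_shiftPath b W y
  have hv := (hν.pos_obs hη b).ne'
  -- The shifted path is the residual plus a deterministic multiple of `W`, so Gaussianity, mean and
  -- covariance are all read off from the residual.
  have hap : ∀ x, (fun p => shiftPath b W y p x) =
      fun p : SamplePath d × ℝ => (p.1 x - W x * (p.1 b + p.2)) + y * W x := by
    intro x; ext p; rw [shiftPath_apply]; ring
  have hmem : ∀ x, MemLp (fun p : SamplePath d × ℝ => p.1 x - W x * (p.1 b + p.2)) 2
      (ν.prod (noiseLaw η)) := fun x =>
    (hν.memLp_fst η x).sub ((hν.memLp_obs η b).const_mul (W x))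
  refine ⟨⟨fun T => ⟨?_⟩⟩, fun x => ?_, fun x x' => ?_⟩
  · have hT : Measurable fun h : SamplePath d => T.restrict (fun x => h x) :=
      measurable_pi_lambda _ fun x => measurable_eval_path _
    rw [Measure.map_map hT hmeas]
    have h1 := ((hν.isGaussianProcess_residual η b W).comp_right Sum.inl).hasGaussianLaw T
    have e : ((fun h : SamplePath d => T.restrict fun x => h x) ∘ shiftPath b W y) =
        (fun z : T → ℝ => z + fun x : T => y * W x) ∘
        (fun p : SamplePath d × ℝ => T.restrict fun x => p.1 x - W x * (p.1 b + p.2)) := by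
      ext p x
      exact congrFun (hap x) p
    have hm1 : Measurable
        (fun p : SamplePath d × ℝ => T.restrict fun x => p.1 x - W x * (p.1 b + p.2)) :=
      measurable_pi_lambda _ fun x => by
        have h1 : Measurable fun p : SamplePath d × ℝ => p.1 x :=
          (measurable_eval_path (x : Cube d)).comp measurable_fst
        have h2 : Measurable fun p : SamplePath d × ℝ => p.1 b :=
          (measurable_eval_path b).comp measurable_fst
        exact h1.sub ((h2.add measurable_snd).const_mul _)
    rw [e, ← Measure.map_map (by fun_prop) hm1]
    have := h1.isGaussian_map
    change IsGaussian (Measure.map (fun p : SamplePath d × ℝ =>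
      T.restrict fun x => p.1 x - W x * (p.1 b + p.2)) _) at this
    infer_instance
  · rw [integral_map hmeas.aemeasurable (measurable_eval_path x).aestronglyMeasurable]
    rw [hap x, integral_add ((hmem x).integrable (by norm_num)) (integrable_const _),
      integral_sub ((hν.memLp_fst η x).integrable (by norm_num))
        (((hν.memLp_obs η b).const_mul (W x)).integrable (by norm_num)), integral_const_mul,
      hν.integral_fst, hν.integral_obs]
    simp
    ring
  · rw [covariance_map_fun (measurable_eval_path x).aestronglyMeasurable
      (measurable_eval_path x').aestronglyMeasurable hmeas.aemeasurable, hap x, hap x',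
      covariance_add_const_left ((hmem x).integrable (by norm_num)),
      covariance_add_const_right ((hmem x').integrable (by norm_num)),
      covariance_fun_sub_left (hν.memLp_fst η x) ((hν.memLp_obs η b).const_mul (W x)) (hmem x'),
      covariance_const_mul_left,
      covariance_fun_sub_right (hν.memLp_fst η x) (hν.memLp_fst η x')
        ((hν.memLp_obs η b).const_mul (W x')),
      covariance_fun_sub_right (hν.memLp_obs η b) (hν.memLp_fst η x')
        ((hν.memLp_obs η b).const_mul (W x')), covariance_const_mul_right,
      covariance_const_mul_right, hν.cov_fst_fst, hν.cov_fst_obs, hν.cov_obs_obs,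
      covariance_comm, hν.cov_fst_obs, hW, hW]
    field_simp
    ring

/-- Bayes' rule for one noisy observation: the pair `(h, h b + e)` can be generated by first drawing
the observation and then the path from its conditional law. -/
theorem IsGPLaw.lintegral_obs (hν : IsGPLaw ν m k) {η : ℝ} (hη : 0 < η) (b : Cube d)
    (W : SamplePath d) (hW : ∀ x, W x = k x b / (k b b + η ^ 2))
    {Θ : SamplePath d × ℝ → ℝ≥0∞} (hΘ : Measurable Θ) :
    ∫⁻ p, Θ (p.1, p.1 b + p.2) ∂(ν.prod (noiseLaw η)) =
      ∫⁻ y, ∫⁻ h, Θ (h, y) ∂((ν.prod (noiseLaw η)).map (shiftPath b W y))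
        ∂(gaussianReal (m b) (k b b + η ^ 2).toNNReal) := by
  have := hν.isProbabilityMeasure
  have hv := (hν.pos_obs hη b).ne'
  have hcp : Measurable fun q : ℝ × SamplePath d × ℝ => shiftPath b W q.1 q.2 :=
    (continuous_shiftPath.comp (by fun_prop : Continuous fun q : ℝ × SamplePath d × ℝ =>
      ((b, W, q.1), q.2))).measurable
  have hR : Measurable fun p : SamplePath d × ℝ => shiftPath b W 0 p :=
    measurable_shiftPath b W 0
  have hY : Measurable fun p : SamplePath d × ℝ => p.1 b + p.2 :=
    ((measurable_eval_path b).comp measurable_fst).add measurable_snd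
  -- The gain `W` is the regression coefficient that makes the residual uncorrelated with the
  -- observation. Under joint Gaussianity this is independence of all values, and hence, via a
  -- countable dense set, of the whole path.
  have hindep : IndepFun (fun p : SamplePath d × ℝ => shiftPath b W 0 p)
      (fun p : SamplePath d × ℝ => p.1 b + p.2) (ν.prod (noiseLaw η)) := by
    have h := (hν.isGaussianProcess_residual η b W).indepFun_of_covariance_eq_zero
      (fun x => ((hν.memLp_fst η x).sub ((hν.memLp_obs η b).const_mul (W x))).aemeasurable)
      (fun _ => (hν.memLp_obs η b).aemeasurable) (fun x _ => by
        have h := covariance_fun_sub_left (hν.memLp_fst η x)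
          ((hν.memLp_obs η b).const_mul (W x)) (hν.memLp_obs η b)
        rw [covariance_const_mul_left, hν.cov_fst_obs, hν.cov_obs_obs] at h
        refine h.trans ?_
        rw [hW]
        field_simp
        ring)
    obtain ⟨D, hemb⟩ := exists_measurableEmbedding_eval d
    set r : SamplePath d → D → ℝ := fun h x => h x
    have hφ : Measurable fun z : Cube d → ℝ => fun x : D => z x := by fun_prop
    have hψ : Measurable fun z : Unit → ℝ => z () := by fun_prop
    have h' := h.comp hφ hψ
    have h'' : IndepFun (r ∘ fun p : SamplePath d × ℝ => shiftPath b W 0 p)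
      (fun p : SamplePath d × ℝ => p.1 b + p.2) (ν.prod (noiseLaw η)) := by
      refine (h'.congr (Filter.Eventually.of_forall fun p => ?_)
        (Filter.Eventually.of_forall fun p => rfl))
      ext x
      simp only [Function.comp, r, shiftPath_apply]
      ring
    rw [IndepFun_iff_Indep] at h'' ⊢
    convert h'' using 1
    rw [MeasurableSpace.comap_comp.symm, hemb.comap_eq]
  -- The path is recovered from the independent pair (residual, observation); with the observation
  -- frozen at y this is exactly `shiftPath b W y`.
  have e1 : ∀ p : SamplePath d × ℝ, Θ (p.1, p.1 b + p.2) =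
      Θ (shiftPath b W 0 p + (p.1 b + p.2) • W, p.1 b + p.2) := by
    intro p
    congr 2
    ext x
    simp [shiftPath_apply]
    ring
  have hΘ' : Measurable fun q : SamplePath d × ℝ => Θ (q.1 + q.2 • W, q.2) :=
    hΘ.comp (by
      have : Continuous fun q : SamplePath d × ℝ => (q.1 + q.2 • W, q.2) := by fun_prop
      exact this.measurable)
  have hjoint := (indepFun_iff_map_prod_eq_prod_map_map hR.aemeasurable hY.aemeasurable).1 hindep
  calc ∫⁻ p, Θ (p.1, p.1 b + p.2) ∂(ν.prod (noiseLaw η))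
      = ∫⁻ q, Θ (q.1 + q.2 • W, q.2) ∂((ν.prod (noiseLaw η)).map
          fun p => (shiftPath b W 0 p, p.1 b + p.2)) := by
        rw [lintegral_map hΘ' (hR.prodMk hY)]
        exact lintegral_congr e1
    _ = _ := by
        have := Measure.isProbabilityMeasure_map (μ := ν.prod (noiseLaw η)) hR.aemeasurable
        rw [hjoint, hν.map_obs, lintegral_prod_symm _ hΘ'.aemeasurable]
        refine lintegral_congr fun y => ?_
        have h1 : Measurable fun h : SamplePath d => Θ (h + y • W, y) :=
          hΘ'.comp measurable_prodMk_right
        have h2 : Measurable fun h : SamplePath d => Θ (h, y) :=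
          hΘ.comp measurable_prodMk_right
        rw [lintegral_map h1 hR, lintegral_map h2 (measurable_shiftPath b W y)]
        refine lintegral_congr fun p => ?_
        congr 2
        ext x
        simp [shiftPath_apply]
        ring

end Update

/-! ### Continuity of the covariance and measurable posterior kernels. -/

section Kernel

variable {d : ℕ} {ν : Measure (SamplePath d)} {κ : Cube d → Cube d → ℝ}

/-- The form is the variance of s h(x) + t h(x'). The modulus of the characteristic function of this
variable at 1 is exp(-variance/2), and it is continuous in (x, x') by dominated convergence with
bound 1, since paths are continuous. No moment bound uniform in the points is needed. -/
theorem IsGPLaw.continuous_quadratic {μ₀ : Cube d → ℝ} (hν : IsGPLaw ν μ₀ κ) (s t : ℝ) :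
    Continuous fun q : Cube d × Cube d =>
      s ^ 2 * κ q.1 q.1 + 2 * s * t * κ q.1 q.2 + t ^ 2 * κ q.2 q.2 := by
  have := hν.isProbabilityMeasure
  have hgauss : ∀ q : Cube d × Cube d,
      HasGaussianLaw (fun h : SamplePath d => s * h q.1 + t * h q.2) ν := fun q =>
    (hν.gaussian.hasGaussianLaw_prodMk (s := q.1) (t := q.2)).map_fun
      (s • ContinuousLinearMap.fst ℝ ℝ ℝ + t • ContinuousLinearMap.snd ℝ ℝ ℝ)
  have hvar : ∀ q : Cube d × Cube d, Var[fun h : SamplePath d => s * h q.1 + t * h q.2; ν] =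
      s ^ 2 * κ q.1 q.1 + 2 * s * t * κ q.1 q.2 + t ^ 2 * κ q.2 q.2 := by
    intro q
    have h1 := (hν.memLp_eval q.1).const_mul s
    have h2 := (hν.memLp_eval q.2).const_mul t
    have h := variance_add h1 h2
    rw [covariance_const_mul_left, covariance_const_mul_right, hν.covariance,
      ← covariance_self h1.aemeasurable, ← covariance_self h2.aemeasurable,
      covariance_const_mul_left, covariance_const_mul_right, covariance_const_mul_left,
      covariance_const_mul_right, hν.covariance, hν.covariance] at h
    refine h.trans ?_
    ring
  have hchar : ∀ q : Cube d × Cube d,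
      ‖∫ h : SamplePath d, Complex.exp ((s * h q.1 + t * h q.2 : ℝ) * Complex.I) ∂ν‖ =
      Real.exp (-(s ^ 2 * κ q.1 q.1 + 2 * s * t * κ q.1 q.2 + t ^ 2 * κ q.2 q.2) / 2) := by
    intro q
    have h1 := congrArg (fun μ => charFun μ 1) (hgauss q).map_eq_gaussianReal
    simp only [charFun_gaussianReal] at h1
    rw [charFun_apply_real, integral_map (hgauss q).aemeasurable (by fun_prop)] at h1
    simp only [Complex.ofReal_one, one_mul] at h1
    rw [h1, Complex.norm_exp, ← hvar q]
    congr 1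
    simp [variance_nonneg]
    ring
  have hcont : Continuous fun q : Cube d × Cube d =>
      ∫ h : SamplePath d, Complex.exp ((s * h q.1 + t * h q.2 : ℝ) * Complex.I) ∂ν := by
    refine continuous_of_dominated (bound := fun _ => 1) (fun q => ?_) (fun q => ?_)
      (integrable_const _) ?_
    · have h1 := measurable_eval_path (d := d) q.1
      have h2 := measurable_eval_path (d := d) q.2
      exact (by fun_prop : Measurable fun h : SamplePath d =>
        Complex.exp ((s * h q.1 + t * h q.2 : ℝ) * Complex.I)).aestronglyMeasurable
    · exact Filter.Eventually.of_forall fun h => by rw [Complex.norm_exp_ofReal_mul_I]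
    · exact Filter.Eventually.of_forall fun h => by fun_prop
  have h2 := hcont.norm
  simp_rw [hchar] at h2
  have h3 := (h2.log fun q => (Real.exp_pos _).ne').const_smul (-2 : ℝ)
  refine h3.congr fun q => ?_
  simp only [Pi.smul_apply, Real.log_exp, smul_eq_mul]
  ring

/-- The covariance of a Gaussian law on continuous paths is continuous. -/
theorem IsGPLaw.continuous_cov {μ₀ : Cube d → ℝ} (hν : IsGPLaw ν μ₀ κ) :
    Continuous fun q : Cube d × Cube d => κ q.1 q.2 := by
  -- Polarisation.
  have h := ((hν.continuous_quadratic 1 1).sub (hν.continuous_quadratic 1 (-1))).const_smul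
    (4⁻¹ : ℝ)
  refine h.congr fun q => ?_
  simp only [Pi.smul_apply, Pi.sub_apply, smul_eq_mul]
  ring

/-- The noise term keeps the Gram determinant nonzero, so inversion is continuous in the design.
Joint continuity in design and points makes posterior variances at random queries measurable. -/
theorem IsGPLaw.continuous_posteriorCov {μ₀ : Cube d → ℝ} (hν : IsGPLaw ν μ₀ κ) {η : ℝ}
    (hη : 0 < η) (m : ℕ) :
    Continuous fun q : (Fin m → Cube d) × Cube d × Cube d =>
      posteriorCov κ η q.1 q.2.1 q.2.2 := by
  have hκ := hν.continuous_cov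
  have hG : Continuous fun A : Fin m → Cube d => gramMatrix κ η A := by
    unfold gramMatrix
    refine Continuous.add ?_ continuous_const
    refine continuous_matrix fun i l => ?_
    exact hκ.comp (by fun_prop : Continuous fun A : Fin m → Cube d => (A i, A l))
  have hinv : Continuous fun A : Fin m → Cube d => (gramMatrix κ η A)⁻¹ := by
    simp_rw [Matrix.inv_def, Ring.inverse_eq_inv']
    exact (hG.matrix_det.inv₀ fun A => (hν.isPSDKernel.isUnit_det_gramMatrix hη A).ne_zero).smul
      hG.matrix_adjugate
  unfold posteriorCov
  refine (hκ.comp (by fun_prop : Continuous fun q : (Fin m → Cube d) × Cube d × Cube d =>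
    (q.2.1, q.2.2))).sub (Continuous.dotProduct ?_ (Continuous.matrix_mulVec ?_ ?_))
  · exact continuous_pi fun i => hκ.comp
      (by fun_prop : Continuous fun q : (Fin m → Cube d) × Cube d × Cube d => (q.2.1, q.1 i))
  · exact hinv.comp continuous_fst
  · exact continuous_pi fun i => hκ.comp
      (by fun_prop : Continuous fun q : (Fin m → Cube d) × Cube d × Cube d => (q.2.2, q.1 i))

theorem posteriorMean_fin_zero (η : ℝ) (A : Fin 0 → Cube d) (y : Fin 0 → ℝ) :
    posteriorMean κ η A y = fun _ => 0 := by
  ext x; simp [posteriorMean]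

theorem posteriorCov_fin_zero (η : ℝ) (A : Fin 0 → Cube d) :
    posteriorCov κ η A = κ := by
  ext x x'; simp [posteriorCov]

/-- The gain of the Bayesian update at the query point `b`, given the design `A`. -/
noncomputable def gain (κ : Cube d → Cube d → ℝ) (η : ℝ) {m : ℕ} (A : Fin m → Cube d)
    (b x : Cube d) : ℝ :=
  posteriorCov κ η A x b / (posteriorCov κ η A b b + η ^ 2)

/-- One Bayesian update of a path law having the posterior mean and covariance. -/
theorem IsGPLaw.posterior_succ (hκ : IsPSDKernel κ) {η : ℝ} (hη : 0 < η) {m : ℕ}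
    (A : Fin (m + 1) → Cube d) (y : Fin (m + 1) → ℝ) {ρ : Measure (SamplePath d)}
    (hρ : IsGPLaw ρ (posteriorMean κ η (fun i : Fin m => A i.castSucc) fun i => y i.castSucc)
      (posteriorCov κ η fun i : Fin m => A i.castSucc)) (W : SamplePath d)
    (hW : ∀ x, W x = gain κ η (fun i : Fin m => A i.castSucc) (A (Fin.last m)) x) :
    IsGPLaw ((ρ.prod (noiseLaw η)).map (shiftPath (A (Fin.last m)) W (y (Fin.last m))))
      (posteriorMean κ η A y) (posteriorCov κ η A) := by
  have hv := (hρ.pos_obs hη (A (Fin.last m))).ne'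
  have h := hρ.map_shiftPath hη (A (Fin.last m)) W hW (y (Fin.last m))
  convert h using 1
  · ext x
    rw [hκ.posteriorMean_succ hη A hv, hW]
    rfl
  · ext x x'
    rw [hκ.posteriorCov_succ hη A hv]

/-- The update needs the gain as a path depending measurably on design and query; currying a jointly
continuous function gives even continuous dependence. -/
theorem IsGPLaw.exists_gain {μ₀ : Cube d → ℝ} (hν : IsGPLaw ν μ₀ κ) {η : ℝ} (hη : 0 < η) {m : ℕ}
    (hpos : ∀ (A : Fin m → Cube d) (b : Cube d), 0 < posteriorCov κ η A b b + η ^ 2) :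
    ∃ W : C((Fin m → Cube d) × Cube d, SamplePath d), ∀ p x, W p x = gain κ η p.1 p.2 x := by
  have hc := hν.continuous_posteriorCov hη m
  have h : Continuous fun q : ((Fin m → Cube d) × Cube d) × Cube d =>
      gain κ η q.1.1 q.1.2 q.2 := by
    unfold gain
    refine Continuous.div ?_ (Continuous.add ?_ continuous_const) fun q => (hpos _ _).ne'
    · exact hc.comp (by fun_prop : Continuous fun q : ((Fin m → Cube d) × Cube d) × Cube d =>
        (q.1.1, q.2, q.1.2))
    · exact hc.comp (by fun_prop : Continuous fun q : ((Fin m → Cube d) × Cube d) × Cube d =>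
        (q.1.1, q.1.2, q.1.2))
  exact ⟨ContinuousMap.curry ⟨_, h⟩, fun p x => rfl⟩

/-- The posterior laws form a measurable kernel. -/
theorem IsGPLaw.exists_posteriorKernel (hν : IsGPLaw ν (fun _ => 0) κ) {η : ℝ} (hη : 0 < η)
    (m : ℕ) : ∃ Q : Kernel ((Fin m → Cube d) × (Fin m → ℝ)) (SamplePath d), ∀ p,
      IsGPLaw (Q p) (posteriorMean κ η p.1 p.2) (posteriorCov κ η p.1) := by
  induction m with
  | zero =>
    refine ⟨Kernel.const _ ν, fun p => ?_⟩
    rwa [posteriorMean_fin_zero, posteriorCov_fin_zero, Kernel.const_apply]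
  | succ m ih =>
    obtain ⟨Q, hQ⟩ := ih
    have : IsMarkovKernel Q := ⟨fun p => (hQ p).isProbabilityMeasure⟩
    obtain ⟨W, hW⟩ := hν.exists_gain hη (m := m)
      (fun A b => (hQ (A, 0)).pos_obs hη b)
    let π : (Fin (m + 1) → Cube d) × (Fin (m + 1) → ℝ) → (Fin m → Cube d) × (Fin m → ℝ) :=
      fun p => (fun i => p.1 i.castSucc, fun i => p.2 i.castSucc)
    have hπ : Measurable π := by fun_prop
    let Φ : ((Fin (m + 1) → Cube d) × (Fin (m + 1) → ℝ)) × SamplePath d × ℝ → SamplePath d :=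
      fun q => shiftPath (q.1.1 (Fin.last m)) (W ((π q.1).1, q.1.1 (Fin.last m)))
        (q.1.2 (Fin.last m)) q.2
    have hΦ : Measurable Φ := by
      refine Continuous.measurable ?_
      exact continuous_shiftPath.comp (by fun_prop : Continuous fun
        q : ((Fin (m + 1) → Cube d) × (Fin (m + 1) → ℝ)) × SamplePath d × ℝ =>
        ((q.1.1 (Fin.last m), W (fun i => q.1.1 i.castSucc, q.1.1 (Fin.last m)),
          q.1.2 (Fin.last m)), q.2))
    -- Draw a path from the previous posterior and an independent noise, then shift towards the new
    -- value; the identity factor makes the data visible to `Φ`.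
    let K := (Kernel.id ×ₖ (Q.comap π hπ ×ₖ Kernel.const _ (noiseLaw η))).map Φ
    refine ⟨K, fun p => ?_⟩
    have hK : K p = ((Q (π p)).prod (noiseLaw η)).map (shiftPath (p.1 (Fin.last m))
        (W ((π p).1, p.1 (Fin.last m))) (p.2 (Fin.last m))) := by
      simp only [K]
      rw [Kernel.map_apply _ hΦ, Kernel.prod_apply, Kernel.prod_apply, Kernel.id_apply,
        Kernel.comap_apply, Kernel.const_apply, Measure.dirac_prod,
        Measure.map_map hΦ measurable_prodMk_left]
      rfl
    rw [hK]
    exact IsGPLaw.posterior_succ hν.isPSDKernel hη p.1 p.2 (hQ (π p)) _ (hW _)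

/-- A measurable version of the posterior law, for every number of observations. -/
structure IsPosteriorKernel (κ : Cube d → Cube d → ℝ) (η : ℝ)
    (Q : ∀ m, Kernel ((Fin m → Cube d) × (Fin m → ℝ)) (SamplePath d)) : Prop where
  law : ∀ m p, IsGPLaw (Q m p) (posteriorMean κ η p.1 p.2) (posteriorCov κ η p.1)

theorem IsGPLaw.exists_isPosteriorKernel (hν : IsGPLaw ν (fun _ => 0) κ) {η : ℝ} (hη : 0 < η) :
    ∃ Q, IsPosteriorKernel κ η Q := by
  choose Q hQ using fun m => hν.exists_posteriorKernel hη m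
  exact ⟨Q, ⟨hQ⟩⟩

variable {Q : ∀ m, Kernel ((Fin m → Cube d) × (Fin m → ℝ)) (SamplePath d)} {η : ℝ}

theorem IsPosteriorKernel.isMarkovKernel (hQ : IsPosteriorKernel κ η Q) (m : ℕ) :
    IsMarkovKernel (Q m) :=
  ⟨fun p => (hQ.law m p).isProbabilityMeasure⟩

theorem IsPosteriorKernel.zero_eq (hQ : IsPosteriorKernel κ η Q) (hν : IsGPLaw ν (fun _ => 0) κ)
    (p : (Fin 0 → Cube d) × (Fin 0 → ℝ)) : Q 0 p = ν := by
  refine IsGPLaw.unique ?_ hν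
  have h := hQ.law 0 p
  rwa [posteriorMean_fin_zero, posteriorCov_fin_zero] at h

theorem IsPosteriorKernel.comp_equiv (hQ : IsPosteriorKernel κ η Q) {m m' : ℕ}
    (e : Fin m' ≃ Fin m) (A : Fin m → Cube d) (y : Fin m → ℝ) :
    Q m' (A ∘ e, y ∘ e) = Q m (A, y) := by
  refine IsGPLaw.unique ?_ (hQ.law m (A, y))
  have h := hQ.law m' (A ∘ e, y ∘ e)
  have h1 : posteriorMean κ η (A ∘ e) (y ∘ e) = posteriorMean κ η A y := by
    ext x; exact posteriorMean_comp_equiv κ η A y e x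
  have h2 : posteriorCov κ η (A ∘ e) = posteriorCov κ η A := by
    ext x x'; exact posteriorCov_comp_equiv κ η A e x x'
  simpa only [h1, h2] using h

theorem IsPosteriorKernel.posteriorCov_add_pos (hQ : IsPosteriorKernel κ η Q) (hη : 0 < η) {m : ℕ}
    (A : Fin m → Cube d) (b : Cube d) : 0 < posteriorCov κ η A b b + η ^ 2 :=
  (hQ.law m (A, 0)).pos_obs hη b

theorem IsPosteriorKernel.posteriorCov_nonneg (hQ : IsPosteriorKernel κ η Q) {m : ℕ}
    (A : Fin m → Cube d) (b : Cube d) : 0 ≤ posteriorCov κ η A b b := by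
  rw [← (hQ.law m (A, 0)).covariance, covariance_self (measurable_eval_path b).aemeasurable]
  exact variance_nonneg _ _

/-- Bayes' rule for the posterior kernels: one more observation at `b`. -/
theorem IsPosteriorKernel.lintegral_obs (hQ : IsPosteriorKernel κ η Q) (hη : 0 < η)
    (hν : IsGPLaw ν (fun _ => 0) κ) {m : ℕ} (A : Fin m → Cube d) (y : Fin m → ℝ) (b : Cube d)
    {Θ : SamplePath d × ℝ → ℝ≥0∞} (hΘ : Measurable Θ) :
    ∫⁻ h, ∫⁻ e, Θ (h, h b + e) ∂(noiseLaw η) ∂(Q m (A, y)) =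
      ∫⁻ z, ∫⁻ h, Θ (h, z)
          ∂(Q (m + 1) ((Fin.snoc A b : Fin (m + 1) → Cube d), (Fin.snoc y z : Fin (m + 1) → ℝ)))
        ∂(gaussianReal (posteriorMean κ η A y b) (posteriorCov κ η A b b + η ^ 2).toNNReal) := by
  have hQA := hQ.law m (A, y)
  have := hQA.isProbabilityMeasure
  obtain ⟨W, hW⟩ := hν.exists_gain hη (m := m) (fun A b => hQ.posteriorCov_add_pos hη A b)
  have hΘ' : Measurable fun p : SamplePath d × ℝ => Θ (p.1, p.1 b + p.2) :=
    hΘ.comp (measurable_fst.prodMk (((measurable_eval_path b).comp measurable_fst).add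
      measurable_snd))
  rw [← lintegral_prod _ hΘ'.aemeasurable, hQA.lintegral_obs hη b (W (A, b)) (hW (A, b)) hΘ]
  refine lintegral_congr fun z => ?_
  congr 1
  -- `Q m` and `Q (m + 1)` are not assumed to be related; uniqueness of the Gaussian law forces the
  -- shifted law to be `Q (m + 1)`.
  refine IsGPLaw.unique ?_ (hQ.law (m + 1) _)
  have h := IsGPLaw.posterior_succ hν.isPSDKernel hη (Fin.snoc A b : Fin (m + 1) → Cube d)
    (Fin.snoc y z : Fin (m + 1) → ℝ) (ρ := Q m (A, y)) (by simpa using hQA) (W (A, b))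
    (by simpa using hW (A, b))
  simpa using h

end Kernel

/-! ### Posterior law for a deterministic design. -/

section FixedDesign

variable {d : ℕ} {ν : Measure (SamplePath d)} {κ : Cube d → Cube d → ℝ} {η : ℝ}
  {Q : ∀ m, Kernel ((Fin m → Cube d) × (Fin m → ℝ)) (SamplePath d)}

/-- The vector of noisy observations at the points `A`. -/
def obsVec {n : ℕ} (A : Fin n → Cube d) (w : SamplePath d × (Fin n → ℝ)) (i : Fin n) : ℝ :=
  w.1 (A i) + w.2 i

theorem measurable_obsVec {n : ℕ} (A : Fin n → Cube d) : Measurable (obsVec A) :=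
  measurable_pi_lambda _ fun i => ((measurable_eval_path (A i)).comp measurable_fst).add
    ((measurable_pi_apply i).comp measurable_snd)

theorem measurable_snoc {n : ℕ} {α : Type*} [MeasurableSpace α] :
    Measurable fun q : (Fin n → α) × α => (Fin.snoc q.1 q.2 : Fin (n + 1) → α) := by
  refine measurable_pi_lambda _ fun i => ?_
  refine Fin.lastCases ?_ (fun i => ?_) i
  · simpa using measurable_snd
  · simpa [Function.comp_def] using
      (measurable_pi_apply (X := fun _ : Fin n => α) i).comp (measurable_fst (β := α))

theorem obsVec_snoc {n : ℕ} (A : Fin (n + 1) → Cube d) (w : SamplePath d × (Fin n → ℝ)) (e : ℝ) :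
    obsVec A (w.1, Fin.snoc w.2 e) =
      Fin.snoc (obsVec (fun i : Fin n => A i.castSucc) w) (w.1 (A (Fin.last n)) + e) := by
  ext i
  refine Fin.lastCases ?_ (fun i => ?_) i <;> simp [obsVec]

theorem lintegral_obsMeasure_succ [IsFiniteMeasure ν] (n : ℕ)
    {F : SamplePath d × (Fin (n + 1) → ℝ) → ℝ≥0∞} (hF : Measurable F) :
    ∫⁻ w, F w ∂(obsMeasure ν η (n + 1)) =
      ∫⁻ w, ∫⁻ e, F (w.1, Fin.snoc w.2 e) ∂(noiseLaw η) ∂(obsMeasure ν η n) := by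
  have hmp := (measurePreserving_piFinSuccAbove (fun _ : Fin (n + 1) => noiseLaw η)
    (Fin.last n)).symm
  have hs : Measurable fun q : (SamplePath d × (Fin n → ℝ)) × ℝ =>
      (q.1.1, (Fin.snoc q.1.2 q.2 : Fin (n + 1) → ℝ)) :=
    (measurable_fst.comp measurable_fst).prodMk
      (measurable_snoc.comp ((measurable_snd.comp measurable_fst).prodMk measurable_snd))
  unfold obsMeasure
  have h1 : Measurable fun q : (SamplePath d × (Fin n → ℝ)) =>
      ∫⁻ e, F (q.1, (Fin.snoc q.2 e : Fin (n + 1) → ℝ)) ∂(noiseLaw η) :=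
    (hF.comp hs).lintegral_prod_right'
  rw [lintegral_prod _ hF.aemeasurable, lintegral_prod _ h1.aemeasurable]
  refine lintegral_congr fun h => ?_
  have h2 : Measurable fun y : Fin (n + 1) → ℝ => F (h, y) := hF.comp measurable_prodMk_left
  rw [← hmp.map_eq, lintegral_map h2 hmp.measurable,
    lintegral_prod_symm (fun a => F (h, (MeasurableEquiv.piFinSuccAbove (fun _ => ℝ)
      (Fin.last n)).symm a)) (h2.comp hmp.measurable).aemeasurable]
  refine lintegral_congr fun y => lintegral_congr fun e => ?_
  simp only [MeasurableEquiv.piFinSuccAbove_symm_apply]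
  congr 2
  exact Fin.insertNth_last' e y

theorem IsPosteriorKernel.measurable_lintegral (hQ : IsPosteriorKernel κ η Q) {m : ℕ} {T : Type*}
    [MeasurableSpace T] {p : T → (Fin m → Cube d) × (Fin m → ℝ)} (hp : Measurable p)
    {F : T × SamplePath d → ℝ≥0∞} (hF : Measurable F) :
    Measurable fun t => ∫⁻ h, F (t, h) ∂(Q m (p t)) := by
  have := hQ.isMarkovKernel m
  exact hF.lintegral_kernel_prod_right' (κ := (Q m).comap p hp)

/-- Given the noisy observations at a fixed design, the path is distributed as the posterior. -/
theorem IsPosteriorKernel.lintegral_obsVec (hQ : IsPosteriorKernel κ η Q) (hη : 0 < η)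
    (hν : IsGPLaw ν (fun _ => 0) κ) {n : ℕ} (A : Fin n → Cube d)
    {Θ : SamplePath d × (Fin n → ℝ) → ℝ≥0∞} (hΘ : Measurable Θ) :
    ∫⁻ w, Θ (w.1, obsVec A w) ∂(obsMeasure ν η n) =
      ∫⁻ w, ∫⁻ h, Θ (h, obsVec A w) ∂(Q n (A, obsVec A w)) ∂(obsMeasure ν η n) := by
  have := hν.isProbabilityMeasure
  induction n with
  | zero =>
    simp_rw [hQ.zero_eq hν]
    have hsub : ∀ w : SamplePath d × (Fin 0 → ℝ), obsVec A w = 0 := fun w =>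
      Subsingleton.elim _ _
    simp_rw [hsub]
    unfold obsMeasure
    have h0 : Measurable fun w : SamplePath d × (Fin 0 → ℝ) => Θ (w.1, 0) :=
      hΘ.comp (measurable_fst.prodMk measurable_const)
    rw [lintegral_prod _ h0.aemeasurable]
    simp
  | succ n ih =>
    set A' : Fin n → Cube d := fun i => A i.castSucc
    set b := A (Fin.last n)
    have hA : (Fin.snoc A' b : Fin (n + 1) → Cube d) = A := Fin.snoc_init_self A
    -- The induction hypothesis replaces the path by a posterior draw given the first n
    -- observations; Bayes' rule then handles the last one.
    have key : ∀ Ξ : SamplePath d × (Fin (n + 1) → ℝ) → ℝ≥0∞, Measurable Ξ →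
        ∫⁻ w, Ξ (w.1, obsVec A w) ∂(obsMeasure ν η (n + 1)) =
        ∫⁻ w, ∫⁻ z, ∫⁻ h, Ξ (h, Fin.snoc (obsVec A' w) z) ∂(Q (n + 1) (A, Fin.snoc (obsVec A' w) z))
          ∂(gaussianReal (posteriorMean κ η A' (obsVec A' w) b)
            (posteriorCov κ η A' b b + η ^ 2).toNNReal) ∂(obsMeasure ν η n) := by
      intro Ξ hΞ
      have h0 : Measurable fun w : SamplePath d × (Fin (n + 1) → ℝ) => Ξ (w.1, obsVec A w) :=
        hΞ.comp (measurable_fst.prodMk (measurable_obsVec A))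
      rw [lintegral_obsMeasure_succ n h0]
      simp_rw [obsVec_snoc]
      have hF : Measurable fun q : (SamplePath d × (Fin n → ℝ)) × ℝ =>
          Ξ (q.1.1, Fin.snoc q.1.2 (q.1.1 b + q.2)) := by
        refine hΞ.comp ((measurable_fst.comp measurable_fst).prodMk (measurable_snoc.comp
          ((measurable_snd.comp measurable_fst).prodMk (Measurable.add ?_ measurable_snd))))
        exact (measurable_eval_path b).comp (measurable_fst.comp measurable_fst)
      have hΘ' : Measurable fun q : SamplePath d × (Fin n → ℝ) =>
          ∫⁻ e, Ξ (q.1, Fin.snoc q.2 (q.1 b + e)) ∂(noiseLaw η) := hF.lintegral_prod_right'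
      refine (ih A' hΘ').trans (lintegral_congr fun w => ?_)
      have hsn : Measurable fun q : SamplePath d × ℝ =>
          Ξ (q.1, (Fin.snoc (obsVec A' w) q.2 : Fin (n + 1) → ℝ)) :=
        hΞ.comp (measurable_fst.prodMk (measurable_snoc.comp
          ((measurable_const (a := obsVec A' w)).prodMk measurable_snd)))
      have h := hQ.lintegral_obs hη hν A' (obsVec A' w) b hsn
      rw [hA] at h
      exact h
    have hm : Measurable fun q : SamplePath d × (Fin (n + 1) → ℝ) =>
        ∫⁻ h, Θ (h, q.2) ∂(Q (n + 1) (A, q.2)) :=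
      hQ.measurable_lintegral (measurable_const.prodMk measurable_snd)
        (F := fun r : (SamplePath d × (Fin (n + 1) → ℝ)) × SamplePath d => Θ (r.2, r.1.2))
        (hΘ.comp (measurable_snd.prodMk (measurable_snd.comp measurable_fst)))
    -- The right side is an expectation of the same kind, of `Θ` already averaged over the
    -- posterior. Both sides expand alike, and a second average over the same probability measure
    -- changes nothing.
    rw [key Θ hΘ, key _ hm]
    refine lintegral_congr fun w => lintegral_congr fun z => ?_
    have := (hQ.law (n + 1) (A, (Fin.snoc (obsVec A' w) z : Fin (n + 1) → ℝ))).isProbabilityMeasure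
    simp

end FixedDesign

/-! ### Divergence of Gaussian kernels. -/

section Information

/-- Divergence between two semidirect products of Gaussian kernels over the same base. -/
theorem klDiv_compProd_gaussianReal {X : Type*} [MeasurableSpace X] (J : Measure X)
    [IsProbabilityMeasure J] (K₁ K₂ : Kernel X ℝ) {m₁ m₂ : X → ℝ} (hm₁ : Measurable m₁)
    (hm₂ : Measurable m₂) {v₁ v₂ : ℝ} (hv₁ : 0 < v₁) (hv₂ : 0 < v₂)
    (hK₁ : ∀ x, K₁ x = gaussianReal (m₁ x) v₁.toNNReal)
    (hK₂ : ∀ x, K₂ x = gaussianReal (m₂ x) v₂.toNNReal)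
    (h₁ : Integrable (fun p : X × ℝ => (p.2 - m₁ p.1) ^ 2) (J ⊗ₘ K₁))
    (h₂ : Integrable (fun p : X × ℝ => (p.2 - m₂ p.1) ^ 2) (J ⊗ₘ K₁))
    (hi₁ : ∫ p : X × ℝ, (p.2 - m₁ p.1) ^ 2 ∂(J ⊗ₘ K₁) = v₁)
    (hi₂ : ∫ p : X × ℝ, (p.2 - m₂ p.1) ^ 2 ∂(J ⊗ₘ K₁) = v₂) :
    klDiv (J ⊗ₘ K₁) (J ⊗ₘ K₂) = ENNReal.ofReal (Real.log (v₂ / v₁) / 2) := by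
  have : IsMarkovKernel K₁ := ⟨fun x => by rw [hK₁]; infer_instance⟩
  have : IsMarkovKernel K₂ := ⟨fun x => by rw [hK₂]; infer_instance⟩
  have hv₁' : v₁.toNNReal ≠ 0 := by simpa using hv₁
  have hv₂' : v₂.toNNReal ≠ 0 := by simpa using hv₂
  let r : X × ℝ → ℝ := fun p =>
    gaussianPDFReal (m₁ p.1) v₁.toNNReal p.2 / gaussianPDFReal (m₂ p.1) v₂.toNNReal p.2
  have hp : ∀ {μ : X → ℝ} (_ : Measurable μ) (v : NNReal),
      Measurable fun p : X × ℝ => gaussianPDFReal (μ p.1) v p.2 := fun hμ v =>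
    measurable_uncurry_gaussianPDFReal.comp
      ((hμ.comp measurable_fst).prodMk (measurable_const.prodMk measurable_snd))
  have hr : Measurable r := (hp hm₁ _).div (hp hm₂ _)
  have hwd : J ⊗ₘ K₁ = (J ⊗ₘ K₂).withDensity fun p => ENNReal.ofReal (r p) := by
    refine Measure.ext_of_lintegral _ fun F hF => ?_
    rw [lintegral_withDensity_eq_lintegral_mul _ hr.ennreal_ofReal hF,
      Measure.lintegral_compProd hF,
      Measure.lintegral_compProd (hr.ennreal_ofReal.mul hF)]
    refine lintegral_congr fun x => ?_
    have hF' : Measurable fun y => F (x, y) := hF.comp measurable_prodMk_left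
    have hrF' : Measurable fun y => ((fun q => ENNReal.ofReal (r q)) * F) (x, y) :=
      (hr.ennreal_ofReal.mul hF).comp measurable_prodMk_left
    rw [hK₁, hK₂, gaussianReal_of_var_ne_zero _ hv₁', gaussianReal_of_var_ne_zero _ hv₂',
      lintegral_withDensity_eq_lintegral_mul _ (measurable_gaussianPDF _ _) hF',
      lintegral_withDensity_eq_lintegral_mul _ (measurable_gaussianPDF _ _) hrF']
    refine lintegral_congr fun y => ?_
    simp only [Pi.mul_apply, gaussianPDF]
    rw [← mul_assoc, ← ENNReal.ofReal_mul (gaussianPDFReal_nonneg _ _ _)]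
    congr 2
    have := (gaussianPDFReal_pos (m₂ x) v₂.toNNReal y hv₂').ne'
    simp only [r]
    field_simp
  have hac : J ⊗ₘ K₁ ≪ J ⊗ₘ K₂ := by
    rw [hwd]; exact withDensity_absolutelyContinuous _ _
  have hrn : (J ⊗ₘ K₁).rnDeriv (J ⊗ₘ K₂) =ᵐ[J ⊗ₘ K₁] fun p => ENNReal.ofReal (r p) := by
    have h := Measure.rnDeriv_withDensity (J ⊗ₘ K₂) hr.ennreal_ofReal
    rw [← hwd] at h
    exact hac.ae_le h
  have hllr : llr (J ⊗ₘ K₁) (J ⊗ₘ K₂) =ᵐ[J ⊗ₘ K₁] fun p =>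
      Real.log (v₂ / v₁) / 2 + ((p.2 - m₂ p.1) ^ 2 / (2 * v₂) - (p.2 - m₁ p.1) ^ 2 / (2 * v₁)) := by
    filter_upwards [hrn] with p hp
    have hpos : 0 ≤ r p := div_nonneg (gaussianPDFReal_nonneg _ _ _) (gaussianPDFReal_nonneg _ _ _)
    rw [llr, hp, ENNReal.toReal_ofReal hpos]
    simp only [r]
    rw [Real.log_div (gaussianPDFReal_pos _ _ _ hv₁').ne' (gaussianPDFReal_pos _ _ _ hv₂').ne']
    simp only [gaussianPDFReal, Real.coe_toNNReal _ hv₁.le, Real.coe_toNNReal _ hv₂.le]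
    rw [Real.log_mul (by positivity) (Real.exp_pos _).ne', Real.log_mul (by positivity)
      (Real.exp_pos _).ne', Real.log_exp, Real.log_exp, Real.log_inv, Real.log_inv,
      Real.log_sqrt (by positivity), Real.log_sqrt (by positivity),
      Real.log_mul (by positivity) hv₁.ne', Real.log_mul (by positivity) hv₂.ne',
      Real.log_div hv₂.ne' hv₁.ne']
    ring
  have hint : Integrable (llr (J ⊗ₘ K₁) (J ⊗ₘ K₂)) (J ⊗ₘ K₁) := by
    rw [integrable_congr hllr]
    exact (integrable_const _).add ((h₂.div_const _).sub (h₁.div_const _))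
  have hsub : Integrable (fun p : X × ℝ =>
      (p.2 - m₂ p.1) ^ 2 / (2 * v₂) - (p.2 - m₁ p.1) ^ 2 / (2 * v₁)) (J ⊗ₘ K₁) :=
    (h₂.div_const _).sub (h₁.div_const _)
  -- The quadratic terms integrate to v₂/(2v₂) - v₁/(2v₁) = 0, and only the ratio of normalising
  -- constants survives.
  rw [klDiv_of_ac_of_integrable hac hint, integral_congr_ae hllr,
    integral_add (integrable_const _) hsub,
    integral_sub (h₂.div_const _) (h₁.div_const _), integral_const,
    integral_div (2 * v₂), integral_div (2 * v₁), hi₁, hi₂]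
  simp
  congr 1
  field_simp
  ring

/-- Data processing applied to the map and to its inverse. -/
theorem klDiv_map_measurableEquiv {X Y : Type*} [MeasurableSpace X] [MeasurableSpace Y]
    (e : X ≃ᵐ Y) (μ ν : Measure X) [IsFiniteMeasure μ] [IsFiniteMeasure ν] :
    klDiv (μ.map e) (ν.map e) = klDiv μ ν := by
  refine le_antisymm (klDiv_map_le μ ν e.measurable) ?_
  have h := klDiv_map_le (μ.map e) (ν.map e) e.symm.measurable
  simpa [Measure.map_map e.symm.measurable e.measurable] using h

end Information

/-! ### Chain rule for the information gain. -/

section Chain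

variable {d : ℕ} {ν : Measure (SamplePath d)}

/-- Splitting the observations into the first `m` and the last `k`. -/
def splitObs (α : Type*) [MeasurableSpace α] (m k : ℕ) :
    α × (Fin (m + k) → ℝ) ≃ᵐ (α × (Fin m → ℝ)) × (Fin k → ℝ) where
  toFun p := ((p.1, fun i => p.2 (Fin.castAdd k i)), fun i => p.2 (Fin.natAdd m i))
  invFun q := (q.1.1, Fin.append q.1.2 q.2)
  left_inv p := by
    ext i
    · rfl
    · refine Fin.addCases (fun i => ?_) (fun i => ?_) i <;> simp
  right_inv q := by
    ext i <;> simp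
  measurable_toFun := by
    change Measurable fun p : α × (Fin (m + k) → ℝ) =>
      ((p.1, fun i => p.2 (Fin.castAdd k i)), fun i => p.2 (Fin.natAdd m i))
    fun_prop
  measurable_invFun := by
    change Measurable fun q : (α × (Fin m → ℝ)) × (Fin k → ℝ) => (q.1.1, Fin.append q.1.2 q.2)
    refine (by fun_prop : Measurable fun q : (α × (Fin m → ℝ)) × (Fin k → ℝ) => q.1.1).prodMk
      (measurable_pi_lambda _ fun i => ?_)
    refine Fin.addCases (fun i => ?_) (fun i => ?_) i
    · simp only [Fin.append_left]; fun_prop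
    · simp only [Fin.append_right]; fun_prop

theorem map_castAdd_pi_noiseLaw (η : ℝ) (m k : ℕ) :
    (Measure.pi fun _ : Fin (m + k) => noiseLaw η).map (fun w i => w (Fin.castAdd k i)) =
      Measure.pi fun _ : Fin m => noiseLaw η := by
  refine (Measure.pi_eq fun s hs => ?_).symm
  rw [Measure.map_apply (by fun_prop) (MeasurableSet.univ_pi hs)]
  have : (fun (w : Fin (m + k) → ℝ) (i : Fin m) => w (Fin.castAdd k i)) ⁻¹' Set.univ.pi s =
      Set.univ.pi (Fin.append s fun _ => Set.univ) := by
    ext w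
    simp only [Set.mem_preimage, Set.mem_univ_pi]
    constructor
    · intro h i
      refine Fin.addCases (fun i => ?_) (fun i => ?_) i
      · simpa using h i
      · simp
    · intro h i
      simpa using h (Fin.castAdd k i)
  rw [this, Measure.pi_pi, Fin.prod_univ_add]
  simp

theorem map_castAdd_obsMeasure [IsFiniteMeasure ν] (η : ℝ) (m k : ℕ) :
    (obsMeasure ν η (m + k)).map (fun w => (w.1, fun i => w.2 (Fin.castAdd k i))) =
      obsMeasure ν η m := by
  unfold obsMeasure
  have h := Measure.map_prod_map ν (Measure.pi fun _ : Fin (m + k) => noiseLaw η)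
    (f := id) (g := fun w i => w (Fin.castAdd k i)) measurable_id (by fun_prop)
  rw [map_castAdd_pi_noiseLaw, Measure.map_id] at h
  exact h.symm

/-- Chain rule for the information gain. -/
theorem infoGain_append [IsProbabilityMeasure ν] (η : ℝ) {m k : ℕ} (D : Fin m → Cube d)
    (B : Fin k → Cube d) :
    infoGain ν η (Fin.append D B) = infoGain ν η D + condInfoGain ν η D B := by
  have hpm : ∀ n, IsProbabilityMeasure (obsMeasure ν η n) := fun n => by
    unfold obsMeasure; infer_instance
  have := hpm (m + k)
  set μ := obsMeasure ν η (m + k) with hμ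
  let A := Fin.append D B
  let Z : SamplePath d × (Fin (m + k) → ℝ) → Fin m → ℝ :=
    fun w i => w.1 (D i) + w.2 (Fin.castAdd k i)
  let Y : SamplePath d × (Fin (m + k) → ℝ) → Fin k → ℝ :=
    fun w i => w.1 (B i) + w.2 (Fin.natAdd m i)
  have hA := measurable_obsVec (d := d) A
  have hsplit : ∀ w, splitObs (SamplePath d) m k (w.1, obsVec A w) = ((w.1, Z w), Y w) := by
    intro w
    change ((w.1, _), _) = _
    congr 1
    · congr 1
      ext i; simp [obsVec, A, Z]
    · ext i; simp [obsVec, A, Y]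
  have hZY : ∀ w, ((fun i => obsVec A w (Fin.castAdd k i)) = Z w) ∧
      ((fun i => obsVec A w (Fin.natAdd m i)) = Y w) := by
    intro w
    constructor <;> ext i <;> simp [obsVec, A, Z, Y]
  have hZ : Measurable Z := by
    have : Z = fun w i => obsVec A w (Fin.castAdd k i) := by ext1 w; exact (hZY w).1.symm
    rw [this]; exact measurable_pi_lambda _ fun i => (measurable_pi_apply _).comp hA
  have hY : Measurable Y := by
    have : Y = fun w i => obsVec A w (Fin.natAdd m i) := by ext1 w; exact (hZY w).2.symm
    rw [this]; exact measurable_pi_lambda _ fun i => (measurable_pi_apply _).comp hA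
  have h1 : (μ.map fun w => (w.1, obsVec A w)).map (splitObs (SamplePath d) m k) =
      (μ.map fun w => (w.1, Z w)) ⊗ₘ condDistrib Y (fun w => (w.1, Z w)) μ := by
    rw [compProd_map_condDistrib hY.aemeasurable,
      Measure.map_map (MeasurableEquiv.measurable _) (measurable_fst.prodMk hA)]
    congr 1
    ext1 w
    exact hsplit w
  -- Under the product law the path is independent of all observations, so given path and `Z` the
  -- vector `Y` follows its law given `Z` alone. This is the reference kernel in the conditional
  -- mutual information.
  have h2 : ((μ.map Prod.fst).prod (μ.map (obsVec A))).map (splitObs (SamplePath d) m k) =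
      ((μ.map Prod.fst).prod (μ.map Z)) ⊗ₘ (condDistrib Y Z μ).comap Prod.snd measurable_snd := by
    have := Measure.isProbabilityMeasure_map (μ := μ) hA.aemeasurable
    have := Measure.isProbabilityMeasure_map (μ := μ) hZ.aemeasurable
    refine Measure.ext_of_lintegral _ fun F hF => ?_
    have hF1 : Measurable fun p : SamplePath d × (Fin (m + k) → ℝ) =>
        F (splitObs (SamplePath d) m k p) := hF.comp (MeasurableEquiv.measurable _)
    have hin : Measurable fun p : SamplePath d × (Fin m → ℝ) =>
        ∫⁻ y, F (p, y) ∂(condDistrib Y Z μ p.2) :=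
      hF.lintegral_kernel_prod_right' (κ := (condDistrib Y Z μ).comap Prod.snd measurable_snd)
    rw [lintegral_map hF (MeasurableEquiv.measurable _), lintegral_prod _ hF1.aemeasurable,
      Measure.lintegral_compProd hF]
    simp only [Kernel.comap_apply]
    rw [lintegral_prod _ hin.aemeasurable]
    refine lintegral_congr fun h => ?_
    have hF2 : Measurable fun q : (Fin m → ℝ) × (Fin k → ℝ) => F ((h, q.1), q.2) :=
      hF.comp (by fun_prop)
    have hF3 : Measurable fun y : Fin (m + k) → ℝ => F (splitObs (SamplePath d) m k (h, y)) :=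
      hF1.comp measurable_prodMk_left
    have e := Measure.lintegral_compProd (μ := μ.map Z) (κ := condDistrib Y Z μ) hF2
    rw [compProd_map_condDistrib hY.aemeasurable, lintegral_map hF2 (hZ.prodMk hY)] at e
    rw [← e, lintegral_map hF3 hA]
    refine lintegral_congr fun w => ?_
    change F ((h, _), _) = _
    rw [(hZY w).1, (hZY w).2]
  have hobs : infoGain ν η A = klDiv (μ.map fun w => (w.1, obsVec A w))
      ((μ.map Prod.fst).prod (μ.map (obsVec A))) := rfl
  -- The information gain of `D` is defined with only m noises; the k unused ones are integrated
  -- out.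
  have hD : infoGain ν η D = klDiv (μ.map fun w => (w.1, Z w)) ((μ.map Prod.fst).prod (μ.map Z)) := by
    have hπ : Measurable fun w : SamplePath d × (Fin (m + k) → ℝ) =>
        (w.1, fun i => w.2 (Fin.castAdd k i)) := by fun_prop
    have hDm := measurable_obsVec (d := d) D
    change klDiv ((obsMeasure ν η m).map fun w => (w.1, obsVec D w))
      (((obsMeasure ν η m).map Prod.fst).prod ((obsMeasure ν η m).map (obsVec D))) = _
    rw [← map_castAdd_obsMeasure η m k, Measure.map_map (measurable_fst.prodMk hDm) hπ,
      Measure.map_map measurable_fst hπ, Measure.map_map hDm hπ]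
    rfl
  have := Measure.isProbabilityMeasure_map (μ := μ) hA.aemeasurable
  have := Measure.isProbabilityMeasure_map (μ := μ) hZ.aemeasurable
  have := Measure.isProbabilityMeasure_map (μ := μ) (f := Prod.fst) measurable_fst.aemeasurable
  have := Measure.isProbabilityMeasure_map (μ := μ) (measurable_fst.prodMk hZ).aemeasurable
  have := Measure.isProbabilityMeasure_map (μ := μ) (measurable_fst.prodMk hA).aemeasurable
  -- Both laws are now semidirect products over the pair (path, `Z`). The divergence of the bases is
  -- the gain of `D`, that of the kernels the conditional gain.
  rw [hobs, hD, ← klDiv_map_measurableEquiv (splitObs (SamplePath d) m k), h1, h2,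
    klDiv_compProd_eq_add]
  congr 1
  unfold condInfoGain condMutualInfo
  rw [compProd_map_condDistrib hY.aemeasurable]

end Chain

/-! ### Information carried by one more observation. -/

section OneObservation

variable {d : ℕ} {ν : Measure (SamplePath d)} {κ : Cube d → Cube d → ℝ} {η : ℝ}
  {Q : ∀ m, Kernel ((Fin m → Cube d) × (Fin m → ℝ)) (SamplePath d)}

theorem map_const_add_noiseLaw (η c : ℝ) :
    (noiseLaw η).map (fun e => c + e) = gaussianReal c (η ^ 2).toNNReal := by
  unfold noiseLaw
  rw [gaussianReal_map_const_add, zero_add]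

theorem continuous_posteriorMean {m : ℕ} (κ : Cube d → Cube d → ℝ) (η : ℝ) (A : Fin m → Cube d)
    (x : Cube d) : Continuous fun y => posteriorMean κ η A y x := by
  unfold posteriorMean
  exact Continuous.dotProduct continuous_const (Continuous.matrix_mulVec continuous_const
    continuous_id)

/-- The kernel with Gaussian laws of given mean and constant variance. -/
noncomputable def gaussianKernel {X : Type*} [MeasurableSpace X] (μ : X → ℝ) (hμ : Measurable μ)
    (v : ℝ) : Kernel X ℝ where
  toFun x := gaussianReal (μ x) v.toNNReal
  measurable' := measurable_gaussianReal.comp (hμ.prodMk measurable_const)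

theorem isMarkovKernel_gaussianKernel {X : Type*} [MeasurableSpace X] (μ : X → ℝ)
    (hμ : Measurable μ) (v : ℝ) : IsMarkovKernel (gaussianKernel μ hμ v) :=
  ⟨fun x => by change IsProbabilityMeasure (gaussianReal _ _); infer_instance⟩

theorem integral_sq_sub_gaussianKernel {X : Type*} [MeasurableSpace X] (J : Measure X)
    [IsProbabilityMeasure J] (μ : X → ℝ) (hμ : Measurable μ) {v : ℝ} (hv : 0 ≤ v) :
    Integrable (fun p : X × ℝ => (p.2 - μ p.1) ^ 2) (J ⊗ₘ gaussianKernel μ hμ v) ∧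
      ∫ p : X × ℝ, (p.2 - μ p.1) ^ 2 ∂(J ⊗ₘ gaussianKernel μ hμ v) = v := by
  have := isMarkovKernel_gaussianKernel μ hμ v
  have hφ : Measurable fun p : X × ℝ => p.2 - μ p.1 :=
    measurable_snd.sub (hμ.comp measurable_fst)
  have hmap : (J ⊗ₘ gaussianKernel μ hμ v).map (fun p : X × ℝ => p.2 - μ p.1) =
      gaussianReal 0 v.toNNReal := by
    refine Measure.ext_of_lintegral _ fun F hF => ?_
    have hFφ : Measurable fun p : X × ℝ => F (p.2 - μ p.1) := hF.comp hφ
    rw [lintegral_map hF hφ, Measure.lintegral_compProd hFφ]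
    have : ∀ x, ∫⁻ z, F (z - μ x) ∂(gaussianKernel μ hμ v x) =
        ∫⁻ z, F z ∂(gaussianReal 0 v.toNNReal) := by
      intro x
      change ∫⁻ z, F (z - μ x) ∂(gaussianReal (μ x) v.toNNReal) = _
      rw [← lintegral_map hF (by fun_prop : Measurable fun z => z - μ x),
        gaussianReal_map_sub_const, sub_self]
    simp_rw [this]
    simp
  have hsq : Integrable (fun z : ℝ => z ^ 2) (gaussianReal 0 v.toNNReal) :=
    (memLp_id_gaussianReal' 2 (by norm_num)).integrable_sq
  have hint : ∫ z, z ^ 2 ∂(gaussianReal 0 v.toNNReal) = v := by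
    have h := variance_eq_sub (X := fun z : ℝ => z) (μ := gaussianReal 0 v.toNNReal)
      (memLp_id_gaussianReal' 2 (by norm_num))
    rw [variance_fun_id_gaussianReal, integral_id_gaussianReal] at h
    simpa [hv] using h.symm
  rw [← hmap] at hsq hint
  constructor
  · exact (integrable_map_measure (by fun_prop) hφ.aemeasurable).1 hsq
  · rwa [integral_map hφ.aemeasurable (by fun_prop)] at hint

/-- The information gained from one more observation. -/
theorem IsPosteriorKernel.condInfoGain_one (hQ : IsPosteriorKernel κ η Q) (hη : 0 < η)
    (hν : IsGPLaw ν (fun _ => 0) κ) [IsProbabilityMeasure ν] {m : ℕ} (D : Fin m → Cube d)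
    (B : Fin 1 → Cube d) :
    condInfoGain ν η D B =
      ENNReal.ofReal (Real.log ((posteriorCov κ η D (B 0) (B 0) + η ^ 2) / η ^ 2) / 2) := by
  have hpm : ∀ n, IsProbabilityMeasure (obsMeasure ν η n) := fun n => by
    unfold obsMeasure; infer_instance
  set b := B 0
  set v := posteriorCov κ η D b b + η ^ 2 with hv
  have hvpos : 0 < v := hQ.posteriorCov_add_pos hη D b
  have hη2 : 0 < η ^ 2 := by positivity
  have := hpm (m + 1)
  have := hpm m
  set μ := obsMeasure ν η (m + 1) with hμ
  let Z : SamplePath d × (Fin (m + 1) → ℝ) → Fin m → ℝ :=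
    fun w i => w.1 (D i) + w.2 (Fin.castAdd 1 i)
  let Y : SamplePath d × (Fin (m + 1) → ℝ) → Fin 1 → ℝ :=
    fun w i => w.1 (B i) + w.2 (Fin.natAdd m i)
  have hev : ∀ x : Cube d, ∀ i : Fin (m + 1),
      Measurable fun w : SamplePath d × (Fin (m + 1) → ℝ) => w.1 x + w.2 i := fun x i =>
    ((measurable_eval_path x).comp measurable_fst).add ((measurable_pi_apply i).comp measurable_snd)
  have hZ : Measurable Z := measurable_pi_lambda _ fun i => hev _ _
  have hY : Measurable Y := measurable_pi_lambda _ fun i => hev _ _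
  have hD := measurable_obsVec (d := d) D
  have hJp := Measure.isProbabilityMeasure_map (μ := obsMeasure ν η m)
    (measurable_fst.prodMk hD).aemeasurable
  set J := (obsMeasure ν η m).map fun w => (w.1, obsVec D w) with hJ
  have hm₁ : Measurable fun p : SamplePath d × (Fin m → ℝ) => p.1 b :=
    (measurable_eval_path b).comp measurable_fst
  have hmean := (continuous_posteriorMean κ η D b).measurable
  have hm₂ : Measurable fun p : SamplePath d × (Fin m → ℝ) => posteriorMean κ η D p.2 b :=
    hmean.comp measurable_snd
  -- `K₁` is the law of the new observation when the path is known, `K₂` when only the old data are;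
  -- both are kernels over (path, data) so that their divergence can be taken.
  let K₁ := gaussianKernel (fun p : SamplePath d × (Fin m → ℝ) => p.1 b) hm₁ (η ^ 2)
  let K₂ := gaussianKernel (fun p : SamplePath d × (Fin m → ℝ) => posteriorMean κ η D p.2 b) hm₂ v
  let K := gaussianKernel (fun y => posteriorMean κ η D y b) hmean v
  have : IsMarkovKernel K₁ := isMarkovKernel_gaussianKernel _ _ _
  have : IsMarkovKernel K₂ := isMarkovKernel_gaussianKernel _ _ _
  have : IsMarkovKernel K := isMarkovKernel_gaussianKernel _ _ _
  let e := MeasurableEquiv.funUnique (Fin 1) ℝ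
  have hYe : ∀ w, e (Y w) = w.1 b + w.2 (Fin.last m) := fun w => rfl
  have hZs : ∀ (w : SamplePath d × (Fin m → ℝ)) (z : ℝ),
      Z (w.1, Fin.snoc w.2 z) = obsVec D w := by
    intro w z
    ext i
    change w.1 (D i) + (Fin.snoc w.2 z : Fin (m + 1) → ℝ) i.castSucc = _
    rw [Fin.snoc_castSucc]
    rfl
  -- the joint law of path, old observations and new observation
  have hL : μ.map (fun w => ((w.1, Z w), w.1 b + w.2 (Fin.last m))) = J ⊗ₘ K₁ := by
    refine Measure.ext_of_lintegral _ fun F hF => ?_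
    have hg : Measurable fun w : SamplePath d × (Fin (m + 1) → ℝ) =>
        ((w.1, Z w), w.1 b + w.2 (Fin.last m)) := (measurable_fst.prodMk hZ).prodMk (hev _ _)
    have hin : Measurable fun p : SamplePath d × (Fin m → ℝ) => ∫⁻ z, F (p, z) ∂(K₁ p) :=
      hF.lintegral_kernel_prod_right'
    have hFg : Measurable fun w : SamplePath d × (Fin (m + 1) → ℝ) =>
        F ((w.1, Z w), w.1 b + w.2 (Fin.last m)) := hF.comp hg
    rw [lintegral_map hF hg, hμ, lintegral_obsMeasure_succ m hFg,
      Measure.lintegral_compProd hF, hJ, lintegral_map hin (measurable_fst.prodMk hD)]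
    refine lintegral_congr fun w => ?_
    have hF' : Measurable fun z => F ((w.1, obsVec D w), z) := hF.comp measurable_prodMk_left
    change _ = ∫⁻ z, F ((w.1, obsVec D w), z) ∂(gaussianReal (w.1 b) (η ^ 2).toNNReal)
    rw [← map_const_add_noiseLaw, lintegral_map hF' (by fun_prop)]
    refine lintegral_congr fun z => ?_
    simp only [hZs, Fin.snoc_last]
  have hJμ : μ.map (fun w => (w.1, Z w)) = J := by
    have := congrArg Measure.fst hL
    rwa [Measure.fst_compProd, Measure.fst_map_prodMk (hev _ _)] at this
  -- the joint law of old observations and new observation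
  have hM : μ.map (fun w => (Z w, w.1 b + w.2 (Fin.last m))) = μ.map Z ⊗ₘ K := by
    refine Measure.ext_of_lintegral _ fun F hF => ?_
    have hg : Measurable fun w : SamplePath d × (Fin (m + 1) → ℝ) =>
        (Z w, w.1 b + w.2 (Fin.last m)) := hZ.prodMk (hev _ _)
    have hin : Measurable fun y : Fin m → ℝ => ∫⁻ z, F (y, z) ∂(K y) :=
      hF.lintegral_kernel_prod_right'
    have hΘ : Measurable fun p : (SamplePath d × (Fin m → ℝ)) × ℝ => F (p.1.2, p.1.1 b + p.2) :=
      hF.comp ((measurable_snd.comp measurable_fst).prodMk (((measurable_eval_path b).comp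
        (measurable_fst.comp measurable_fst)).add measurable_snd))
    have hFg : Measurable fun w : SamplePath d × (Fin (m + 1) → ℝ) =>
        F (Z w, w.1 b + w.2 (Fin.last m)) := hF.comp hg
    have hinZ : Measurable fun w : SamplePath d × (Fin (m + 1) → ℝ) =>
        ∫⁻ z, F (Z w, z) ∂(K (Z w)) := hin.comp hZ
    rw [lintegral_map hF hg, Measure.lintegral_compProd hF, lintegral_map hin hZ, hμ,
      lintegral_obsMeasure_succ m hFg, lintegral_obsMeasure_succ m hinZ]
    simp only [hZs, Fin.snoc_last]
    rw [hQ.lintegral_obsVec hη hν D (Θ := fun p => ∫⁻ z, F (p.2, p.1 b + z) ∂(noiseLaw η))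
      hΘ.lintegral_prod_right']
    refine lintegral_congr fun w => ?_
    have hF' : Measurable fun q : SamplePath d × ℝ => F (obsVec D w, q.2) :=
      hF.comp ((measurable_const (a := obsVec D w)).prodMk measurable_snd)
    rw [hQ.lintegral_obs hη hν D (obsVec D w) b hF']
    simp only [lintegral_const, measure_univ, mul_one]
    refine lintegral_congr fun z => ?_
    have := (hQ.law (m + 1) ((Fin.snoc D b : Fin (m + 1) → Cube d),
      (Fin.snoc (obsVec D w) z : Fin (m + 1) → ℝ))).isProbabilityMeasure
    simp
  let K' : Kernel (Fin m → ℝ) (Fin 1 → ℝ) := K.map e.symm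
  have : IsMarkovKernel K' := Kernel.IsMarkovKernel.map _ e.symm.measurable
  have hcd : condDistrib Y Z μ =ᵐ[μ.map Z] K' := by
    refine condDistrib_ae_eq_of_measure_eq_compProd Z hY.aemeasurable ?_
    have h1 : (fun w => (Z w, Y w)) = (fun q : (Fin m → ℝ) × ℝ => (q.1, e.symm q.2)) ∘
        fun w => (Z w, w.1 b + w.2 (Fin.last m)) := by
      ext1 w
      simp only [Function.comp, ← hYe w, MeasurableEquiv.symm_apply_apply]
    have hs : Measurable fun q : (Fin m → ℝ) × ℝ => (q.1, e.symm q.2) :=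
      measurable_fst.prodMk (e.symm.measurable.comp measurable_snd)
    rw [h1, ← Measure.map_map hs (hZ.prodMk (hev _ _)), hM]
    exact Measure.compProd_map e.symm.measurable |>.symm
  have hR : (J ⊗ₘ (condDistrib Y Z μ).comap Prod.snd measurable_snd).map
      (fun q => (q.1, e q.2)) = J ⊗ₘ K₂ := by
    let C₁ : Kernel (SamplePath d × (Fin m → ℝ)) (Fin 1 → ℝ) :=
      (condDistrib Y Z μ).comap Prod.snd measurable_snd
    let C₂ : Kernel (SamplePath d × (Fin m → ℝ)) (Fin 1 → ℝ) := K'.comap Prod.snd measurable_snd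
    have h1 : C₁ =ᵐ[J] C₂ := by
      have h2 : μ.map Z = J.map Prod.snd := by
        rw [← hJμ, Measure.map_map measurable_snd (measurable_fst.prodMk hZ)]; rfl
      rw [h2] at hcd
      filter_upwards [ae_of_ae_map measurable_snd.aemeasurable hcd] with p hp
      exact hp
    change (J ⊗ₘ C₁).map _ = _
    rw [Measure.compProd_congr h1]
    refine (Measure.compProd_map e.measurable).symm.trans ?_
    congr 1
    ext1 p
    rw [Kernel.map_apply _ e.measurable, Kernel.comap_apply, Kernel.map_apply _ e.symm.measurable,
      Measure.map_map e.measurable e.symm.measurable]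
    simp only [MeasurableEquiv.self_comp_symm, Measure.map_id]
    rfl
  let E := (MeasurableEquiv.refl (SamplePath d × (Fin m → ℝ))).prodCongr e
  have hEm : Measurable fun q : (SamplePath d × (Fin m → ℝ)) × (Fin 1 → ℝ) => (q.1, e q.2) :=
    E.measurable
  have hLe : (μ.map fun w => ((w.1, Z w), Y w)).map (fun q => (q.1, e q.2)) = J ⊗ₘ K₁ := by
    rw [Measure.map_map hEm ((measurable_fst.prodMk hZ).prodMk hY), ← hL]
    rfl
  have hsnd : Measurable fun q : (SamplePath d × (Fin m → ℝ)) × ℝ => (q.1.2, q.2) := by fun_prop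
  have hLM : (J ⊗ₘ K₁).map (fun q => (q.1.2, q.2)) = μ.map Z ⊗ₘ K := by
    rw [← hL, ← hM, Measure.map_map hsnd ((measurable_fst.prodMk hZ).prodMk (hev _ _))]
    rfl
  have := Measure.isProbabilityMeasure_map (μ := μ) hZ.aemeasurable
  have h1 := integral_sq_sub_gaussianKernel J _ hm₁ hη2.le
  have h2 := integral_sq_sub_gaussianKernel (μ.map Z) _ hmean hvpos.le
  have hsqm : Measurable fun p : (Fin m → ℝ) × ℝ => (p.2 - posteriorMean κ η D p.1 b) ^ 2 :=
    (measurable_snd.sub (hmean.comp measurable_fst)).pow_const 2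
  -- The squared deviation from the posterior mean does not involve the path, so its integral is
  -- taken under the marginal of old data and new observation, where it equals `v`.
  rw [← hLM, integrable_map_measure hsqm.aestronglyMeasurable hsnd.aemeasurable,
    integral_map hsnd.aemeasurable hsqm.aestronglyMeasurable] at h2
  have hfin := Measure.isProbabilityMeasure_map (μ := μ)
    ((measurable_fst.prodMk hZ).prodMk hY).aemeasurable
  change klDiv (μ.map fun w => ((w.1, Z w), Y w))
    ((μ.map fun w => (w.1, Z w)) ⊗ₘ (condDistrib Y Z μ).comap Prod.snd measurable_snd) = _
  rw [hJμ, ← klDiv_map_measurableEquiv E]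
  have hE : ∀ ρ : Measure ((SamplePath d × (Fin m → ℝ)) × (Fin 1 → ℝ)),
      ρ.map E = ρ.map (fun q => (q.1, e q.2)) := fun _ => rfl
  rw [hE, hE, hLe, hR]
  exact klDiv_compProd_gaussianReal J K₁ K₂ hm₁ hm₂ hη2 hvpos (fun _ => rfl) (fun _ => rfl)
    h1.1 h2.1 h1.2 h2.2

end OneObservation

/-! ### Posterior variances against information. -/

section InfoBounds

variable {d : ℕ} {ν : Measure (SamplePath d)} {κ : Cube d → Cube d → ℝ} {η : ℝ}
  {Q : ∀ m, Kernel ((Fin m → Cube d) × (Fin m → ℝ)) (SamplePath d)}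

theorem infoGain_fin_zero [IsProbabilityMeasure ν] (A : Fin 0 → Cube d) : infoGain ν η A = 0 := by
  have hpm : IsProbabilityMeasure (obsMeasure ν η 0) := by unfold obsMeasure; infer_instance
  have hm := Measure.isProbabilityMeasure_map (μ := obsMeasure ν η 0)
    (f := Prod.fst) measurable_fst.aemeasurable
  change klDiv ((obsMeasure ν η 0).map fun w => (w.1, obsVec A w))
      (((obsMeasure ν η 0).map Prod.fst).prod ((obsMeasure ν η 0).map (obsVec A))) = 0
  have h : obsVec A = fun _ => 0 := funext fun w => Subsingleton.elim _ _
  have h2 : (obsMeasure ν η 0).map (fun w => (w.1, (0 : Fin 0 → ℝ))) =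
      ((obsMeasure ν η 0).map Prod.fst).map fun x => (x, (0 : Fin 0 → ℝ)) := by
    rw [Measure.map_map (by fun_prop) measurable_fst]; rfl
  rw [h, Measure.map_const, measure_univ, one_smul, Measure.prod_dirac, h2]
  exact klDiv_self _

theorem IsPosteriorKernel.infoGain_snoc (hQ : IsPosteriorKernel κ η Q) (hη : 0 < η)
    (hν : IsGPLaw ν (fun _ => 0) κ) {m : ℕ} (A : Fin m → Cube d) (b : Cube d) :
    infoGain ν η (Fin.snoc A b : Fin (m + 1) → Cube d) = infoGain ν η A +
      ENNReal.ofReal (Real.log ((posteriorCov κ η A b b + η ^ 2) / η ^ 2) / 2) := by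
  have := hν.isProbabilityMeasure
  have h := infoGain_append (ν := ν) η A (fun _ : Fin 1 => b)
  rw [Fin.append_right_eq_snoc, hQ.condInfoGain_one hη hν] at h
  exact h

theorem IsPosteriorKernel.infoGain_ne_top (hQ : IsPosteriorKernel κ η Q) (hη : 0 < η)
    (hν : IsGPLaw ν (fun _ => 0) κ) {n : ℕ} (A : Fin n → Cube d) : infoGain ν η A ≠ ∞ := by
  have := hν.isProbabilityMeasure
  induction n with
  | zero => rw [infoGain_fin_zero]; simp
  | succ n ih =>
    rw [← Fin.snoc_init_self A, hQ.infoGain_snoc hη hν]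
    exact ENNReal.add_ne_top.2 ⟨ih _, ENNReal.ofReal_ne_top⟩

theorem IsPosteriorKernel.one_le_ratio (hQ : IsPosteriorKernel κ η Q) (hη : 0 < η) {m : ℕ}
    (A : Fin m → Cube d) (b : Cube d) : 1 ≤ (posteriorCov κ η A b b + η ^ 2) / η ^ 2 := by
  rw [le_div_iff₀ (by positivity)]
  have := hQ.posteriorCov_nonneg A b
  linarith

theorem IsPosteriorKernel.toReal_infoGain_snoc (hQ : IsPosteriorKernel κ η Q) (hη : 0 < η)
    (hν : IsGPLaw ν (fun _ => 0) κ) {m : ℕ} (A : Fin m → Cube d) (b : Cube d) :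
    (infoGain ν η (Fin.snoc A b : Fin (m + 1) → Cube d)).toReal = (infoGain ν η A).toReal +
      Real.log ((posteriorCov κ η A b b + η ^ 2) / η ^ 2) / 2 := by
  rw [hQ.infoGain_snoc hη hν, ENNReal.toReal_add (hQ.infoGain_ne_top hη hν A)
    ENNReal.ofReal_ne_top, ENNReal.toReal_ofReal]
  have := Real.log_nonneg (hQ.one_le_ratio hη A b)
  linarith

theorem IsPosteriorKernel.posteriorCov_snoc (hQ : IsPosteriorKernel κ η Q) (hη : 0 < η)
    (hκ : IsPSDKernel κ) {m : ℕ} (A : Fin m → Cube d) (b x x' : Cube d) :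
    posteriorCov κ η (Fin.snoc A b : Fin (m + 1) → Cube d) x x' =
      posteriorCov κ η A x x' - posteriorCov κ η A x b * posteriorCov κ η A x' b /
        (posteriorCov κ η A b b + η ^ 2) := by
  have h := hκ.posteriorCov_succ hη (Fin.snoc A b : Fin (m + 1) → Cube d)
    (by simpa using (hQ.posteriorCov_add_pos hη A b).ne') x x'
  simpa using h

theorem IsPosteriorKernel.posteriorCov_le (hQ : IsPosteriorKernel κ η Q) (hη : 0 < η)
    (hκ : IsPSDKernel κ) {m : ℕ} (A : Fin m → Cube d) (x : Cube d) :
    posteriorCov κ η A x x ≤ κ x x := by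
  induction m with
  | zero => rw [posteriorCov_fin_zero]
  | succ m ih =>
    rw [← Fin.snoc_init_self A, hQ.posteriorCov_snoc hη hκ]
    have h1 := ih (Fin.init A)
    have h2 : 0 ≤ posteriorCov κ η (Fin.init A) x (A (Fin.last m)) *
        posteriorCov κ η (Fin.init A) x (A (Fin.last m)) /
        (posteriorCov κ η (Fin.init A) (A (Fin.last m)) (A (Fin.last m)) + η ^ 2) :=
      div_nonneg (mul_self_nonneg _) (hQ.posteriorCov_add_pos hη _ _).le
    linarith

/-- Cauchy–Schwarz for a positive semidefinite kernel, from the discriminant of its quadratic form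
at two points. -/
theorem IsPosteriorKernel.posteriorCov_sq_le (hQ : IsPosteriorKernel κ η Q) {m : ℕ}
    (A : Fin m → Cube d) (x b : Cube d) :
    posteriorCov κ η A x b ^ 2 ≤ posteriorCov κ η A x x * posteriorCov κ η A b b := by
  have hP := (hQ.law m (A, 0)).isPSDKernel
  have key : ∀ s t : ℝ, 0 ≤ s ^ 2 * posteriorCov κ η A x x + 2 * s * t * posteriorCov κ η A x b +
      t ^ 2 * posteriorCov κ η A b b := by
    intro s t
    have h := hP.nonneg ![x, b] ![s, t]
    simp [Matrix.mulVec, dotProduct, Fin.sum_univ_two] at h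
    rw [hP.symm b x] at h
    linarith
  have h := discrim_le_zero (a := posteriorCov κ η A x x) (b := 2 * posteriorCov κ η A x b)
    (c := posteriorCov κ η A b b) (fun s => by have := key s 1; linarith)
  rw [discrim] at h
  linarith

/-- Further observations reduce the posterior variance by at most the exponential of twice the
information they carry. -/
theorem IsPosteriorKernel.posteriorCov_le_exp_mul (hQ : IsPosteriorKernel κ η Q) (hη : 0 < η)
    (hν : IsGPLaw ν (fun _ => 0) κ) {m k : ℕ} (D : Fin m → Cube d) (B : Fin k → Cube d)
    (x : Cube d) :
    posteriorCov κ η D x x ≤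
      Real.exp (2 * ((infoGain ν η (Fin.append D B)).toReal - (infoGain ν η D).toReal)) *
        posteriorCov κ η (Fin.append D B) x x := by
  have hκ := hν.isPSDKernel
  induction k with
  | zero =>
    have : Fin.append D B = D := by
      rw [Subsingleton.elim B Fin.elim0]
      exact Fin.append_elim0 D
    simp only [Nat.add_zero, this, sub_self, mul_zero, Real.exp_zero, one_mul, le_refl]
  | succ k ih =>
    set A := Fin.append D (Fin.init B) with hA
    set b := B (Fin.last k)
    have hB : Fin.append D B = (Fin.snoc A b : Fin (m + k + 1) → Cube d) := by
      rw [← Fin.snoc_init_self B, Fin.append_snoc]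
    have h1 := ih (Fin.init B)
    rw [← hA] at h1
    have e1 : infoGain ν η (Fin.append D B) =
      infoGain ν η (Fin.snoc A b : Fin (m + k + 1) → Cube d) := by rw [← hB]
    have e2 : posteriorCov κ η (Fin.append D B) x x =
      posteriorCov κ η (Fin.snoc A b : Fin (m + k + 1) → Cube d) x x := by rw [← hB]
    rw [e1, e2, hQ.toReal_infoGain_snoc hη hν, hQ.posteriorCov_snoc hη hκ]
    set s := posteriorCov κ η A x x
    set c := posteriorCov κ η A x b
    set t := posteriorCov κ η A b b
    have hc : c ^ 2 ≤ s * t := hQ.posteriorCov_sq_le A x b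
    have hv : 0 < t + η ^ 2 := hQ.posteriorCov_add_pos hη A b
    have hη2 : 0 < η ^ 2 := by positivity
    -- By Cauchy–Schwarz, observing `b` divides the variance at `x` by at most 1 + t/η², which is
    -- the exponential of twice the information in that observation.
    have hstep : s ≤ (t + η ^ 2) / η ^ 2 * (s - c * c / (t + η ^ 2)) := by
      have : (t + η ^ 2) / η ^ 2 * (s - c * c / (t + η ^ 2)) =
          (s * (t + η ^ 2) - c ^ 2) / η ^ 2 := by field_simp
      rw [this, le_div_iff₀ hη2]
      linarith
    have hexp : Real.exp (2 * ((infoGain ν η A).toReal +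
        Real.log ((t + η ^ 2) / η ^ 2) / 2 - (infoGain ν η D).toReal)) =
        Real.exp (2 * ((infoGain ν η A).toReal - (infoGain ν η D).toReal)) *
          ((t + η ^ 2) / η ^ 2) := by
      rw [← Real.exp_log (show 0 < (t + η ^ 2) / η ^ 2 by positivity), ← Real.exp_add,
        Real.exp_log (show 0 < (t + η ^ 2) / η ^ 2 by positivity)]
      ring_nf
    rw [hexp, mul_assoc]
    exact h1.trans (mul_le_mul_of_nonneg_left hstep (Real.exp_pos _).le)

/-- By the chain rule the difference of gains is the conditional information that `ξ` bounds;
finiteness of all gains permits the subtraction. -/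
theorem IsPosteriorKernel.posteriorCov_le_inflation_mul (hQ : IsPosteriorKernel κ η Q) (hη : 0 < η)
    (hν : IsGPLaw ν (fun _ => 0) κ) [IsFiniteMeasure ν] {M : ℕ} {ξ : ℝ}
    (hξ : IsInflationBound ν η M ξ) {m k : ℕ} (hk : k < M) (D : Fin m → Cube d)
    (B : Fin k → Cube d) (x : Cube d) :
    posteriorCov κ η D x x ≤ ξ * posteriorCov κ η (Fin.append D B) x x := by
  have := hν.isProbabilityMeasure
  refine (hQ.posteriorCov_le_exp_mul hη hν D B x).trans ?_
  refine mul_le_mul_of_nonneg_right ?_ (hQ.posteriorCov_nonneg _ x)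
  have h := hξ.2 m k D B hk
  have hch := infoGain_append (ν := ν) η D B
  have hne : condInfoGain ν η D B ≠ ∞ := fun h0 =>
    hQ.infoGain_ne_top hη hν (Fin.append D B) (by rw [hch, h0, add_top])
  have e : (infoGain ν η (Fin.append D B)).toReal - (infoGain ν η D).toReal =
      (condInfoGain ν η D B).toReal := by
    rw [hch, ENNReal.toReal_add (hQ.infoGain_ne_top hη hν D) hne]
    ring
  have h2 : (condInfoGain ν η D B).toReal ≤ Real.log ξ / 2 := by
    have e2 : (condInfoGain ν η D B : EReal) = ((condInfoGain ν η D B).toReal : EReal) :=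
      (EReal.coe_ennreal_toReal hne).symm
    rw [e2] at h
    exact_mod_cast h
  rw [e, ← Real.exp_log hξ.1]
  exact Real.exp_le_exp.2 (by linarith)

/-- The posterior variance at the `i`-th point of a design given the observations at the earlier
points. -/
noncomputable def predVar (κ : Cube d → Cube d → ℝ) (η : ℝ) {n : ℕ} (A : Fin n → Cube d) (i : Fin n) : ℝ :=
  posteriorCov κ η (fun l : Fin i => A (l.castLE i.2.le)) (A i) (A i)

/-- The chain rule, iterated one point at a time. -/
theorem IsPosteriorKernel.toReal_infoGain (hQ : IsPosteriorKernel κ η Q) (hη : 0 < η)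
    (hν : IsGPLaw ν (fun _ => 0) κ) {n : ℕ} (A : Fin n → Cube d) :
    (infoGain ν η A).toReal = ∑ i, Real.log ((predVar κ η A i + η ^ 2) / η ^ 2) / 2 := by
  have := hν.isProbabilityMeasure
  induction n with
  | zero => rw [infoGain_fin_zero]; simp
  | succ n ih =>
    have h := hQ.toReal_infoGain_snoc hη hν (Fin.init A) (A (Fin.last n))
    rw [Fin.snoc_init_self] at h
    rw [h, ih, Fin.sum_univ_castSucc]
    rfl

/-- Makes the supremum defining γ_n finite; an infinite one would become 0 under `toReal`. -/
theorem IsPosteriorKernel.infoGain_le (hQ : IsPosteriorKernel κ η Q) (hη : 0 < η)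
    (hν : IsGPLaw ν (fun _ => 0) κ) (hκ1 : ∀ x x', κ x x' ≤ 1) {n : ℕ} (A : Fin n → Cube d) :
    infoGain ν η A ≤ ENNReal.ofReal (n * (Real.log ((1 + η ^ 2) / η ^ 2) / 2)) := by
  rw [← ENNReal.ofReal_toReal (hQ.infoGain_ne_top hη hν A)]
  refine ENNReal.ofReal_le_ofReal ?_
  rw [hQ.toReal_infoGain hη hν A]
  refine (Finset.sum_le_card_nsmul _ _ (Real.log ((1 + η ^ 2) / η ^ 2) / 2) fun i _ => ?_).trans
    (by simp)
  have h1 : predVar κ η A i ≤ 1 :=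
    (hQ.posteriorCov_le hη hν.isPSDKernel _ _).trans (hκ1 _ _)
  have h2 : 0 < predVar κ η A i + η ^ 2 := hQ.posteriorCov_add_pos hη _ _
  have hη2 : 0 < η ^ 2 := by positivity
  have := Real.log_le_log (div_pos h2 hη2)
    (div_le_div_of_nonneg_right (by linarith : predVar κ η A i + η ^ 2 ≤ 1 + η ^ 2) hη2.le)
  linarith

theorem IsPosteriorKernel.sum_log_le_maxInfoGain (hQ : IsPosteriorKernel κ η Q) (hη : 0 < η)
    (hν : IsGPLaw ν (fun _ => 0) κ) (hκ1 : ∀ x x', κ x x' ≤ 1) {n : ℕ} (A : Fin n → Cube d) :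
    ∑ i, Real.log ((predVar κ η A i + η ^ 2) / η ^ 2) ≤ 2 * maxInfoGain ν η n := by
  have h : (infoGain ν η A).toReal ≤ maxInfoGain ν η n := by
    refine ENNReal.toReal_mono (ne_top_of_le_ne_top ENNReal.ofReal_ne_top
      (iSup_le fun A => hQ.infoGain_le hη hν hκ1 A)) (le_iSup (fun A => infoGain ν η A) A)
  rw [hQ.toReal_infoGain hη hν A, ← Finset.sum_div] at h
  linarith

/-- Bernoulli's inequality (1 + c)^s ≤ 1 + cs for exponents in [0, 1]. With c = η⁻² it converts a
variance into an information increment and produces the constant C₂. -/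
theorem le_log_div_log {c s : ℝ} (hc : 0 < c) (hs : 0 ≤ s) (hs1 : s ≤ 1) :
    s ≤ Real.log (1 + c * s) / Real.log (1 + c) := by
  have hl : 0 < Real.log (1 + c) := Real.log_pos (by linarith)
  rw [le_div_iff₀ hl, ← Real.log_rpow (by linarith)]
  refine Real.log_le_log (by positivity) ?_
  rw [mul_comm c s]
  exact rpow_one_add_le_one_add_mul_self (by linarith) hs hs1

end InfoBounds

/-! ### Completion orders and the inflated sum of variances. -/

section CompletionOrder

/-- With numbering from 0, exactly j jobs precede job j, so at most M - 1 of them are unfinished at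
its dispatch. -/
theorem lt_numCompleted_add (mode : ParallelMode) {M : ℕ} (hM : 1 ≤ M) (j : ℕ) :
    j < numCompleted mode M j + M := by
  cases mode with
  | sync =>
    have h1 := Nat.div_add_mod j M
    have h2 := Nat.mod_lt j hM
    simp only [numCompleted]
    omega
  | async =>
    simp only [numCompleted]
    omega

/-- Job `c l` was dispatched with at most l completions behind it, job j with more than l. The
completion count is monotone in the job number, so `c l` comes first. -/
theorem IsCompletionOrder.lt_of_lt_numCompleted {mode : ParallelMode} {M : ℕ} {c : ℕ → ℕ}
    (hc : IsCompletionOrder mode M c) {l j : ℕ} (h : l < numCompleted mode M j) : c l < j := by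
  have h1 := hc.2 l
  cases mode with
  | sync =>
    simp only [numCompleted] at h h1
    have h2 : c l / M < j / M := lt_of_mul_lt_mul_left (h1.trans_lt h) (Nat.zero_le M)
    exact lt_of_not_ge fun h3 => absurd (Nat.div_le_div_right (c := M) h3) (not_le.2 h2)
  | async =>
    simp only [numCompleted] at h h1
    omega

theorem exists_equiv_comp_eq {α : Type*} {m k : ℕ} {p : Fin m → α} {q : Fin k → α}
    (hp : Function.Injective p) (hq : Function.Injective q) (h : Set.range p = Set.range q) :
    ∃ e : Fin m ≃ Fin k, q ∘ e = p := by
  refine ⟨((Equiv.ofInjective p hp).trans (Equiv.setCongr h)).trans (Equiv.ofInjective q hq).symm,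
    funext fun i => ?_⟩
  simp only [Function.comp_apply, Equiv.trans_apply, Equiv.apply_ofInjective_symm]
  rfl

variable {d : ℕ} {ν : Measure (SamplePath d)} {κ : Cube d → Cube d → ℝ} {η : ℝ}
  {Q : ∀ m, Kernel ((Fin m → Cube d) × (Fin m → ℝ)) (SamplePath d)}

/-- Enlarging the set of observed jobs by fewer than `M` jobs reduces the posterior variance by a
factor of at most `ξ`. -/
theorem IsPosteriorKernel.posteriorCov_le_of_range_subset (hQ : IsPosteriorKernel κ η Q)
    (hη : 0 < η) (hν : IsGPLaw ν (fun _ => 0) κ) [IsFiniteMeasure ν] {M : ℕ} {ξ : ℝ}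
    (hξ : IsInflationBound ν η M ξ) {m k : ℕ} {p : Fin m → ℕ} {q : Fin k → ℕ}
    (hp : Function.Injective p) (hq : Function.Injective q) (hpq : Set.range p ⊆ Set.range q)
    (hk : k < m + M) (X : ℕ → Cube d) (x : Cube d) :
    posteriorCov κ η (X ∘ p) x x ≤ ξ * posteriorCov κ η (X ∘ q) x x := by
  -- The jobs missing from `p`: appended to `p` they give a rearrangement of `q`, and posterior
  -- covariances ignore order.
  set T : Finset ℕ := Finset.univ.image q \ Finset.univ.image p
  have hsub : Finset.univ.image p ⊆ Finset.univ.image q := by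
    intro a ha
    obtain ⟨i, -, rfl⟩ := Finset.mem_image.1 ha
    obtain ⟨l, hl⟩ := hpq ⟨i, rfl⟩
    exact Finset.mem_image.2 ⟨l, Finset.mem_univ _, hl⟩
  have hcard : T.card = k - m := by
    rw [Finset.card_sdiff_of_subset hsub, Finset.card_image_of_injective _ hq,
      Finset.card_image_of_injective _ hp]
    simp
  set r := T.orderEmbOfFin hcard
  have hr : Set.range r = T := Finset.range_orderEmbOfFin T hcard
  have hinj : Function.Injective (Fin.append p r) := by
    rw [Fin.append_injective_iff]
    refine ⟨hp, r.injective, fun i l h => ?_⟩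
    have h1 : r l ∈ T := Finset.orderEmbOfFin_mem T hcard l
    rw [← h] at h1
    exact (Finset.mem_sdiff.1 h1).2 (Finset.mem_image.2 ⟨i, Finset.mem_univ _, rfl⟩)
  have hrange : Set.range (Fin.append p r) = Set.range q := by
    have hra : Set.range (Fin.append p r) = Set.range p ∪ Set.range r := by
      ext a
      constructor
      · rintro ⟨i, rfl⟩
        refine Fin.addCases (fun i => ?_) (fun i => ?_) i <;> simp
      · rintro (⟨i, rfl⟩ | ⟨i, rfl⟩)
        · exact ⟨Fin.castAdd _ i, by simp⟩
        · exact ⟨Fin.natAdd _ i, by simp⟩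
    rw [hra, hr]
    ext a
    simp only [T, Set.mem_union, Finset.coe_sdiff, Finset.coe_image, Finset.coe_univ,
      Set.image_univ, Set.mem_sdiff]
    constructor
    · rintro (h | h)
      · exact hpq h
      · exact h.1
    · intro h
      by_cases h' : a ∈ Set.range p
      · exact Or.inl h'
      · exact Or.inr ⟨h, h'⟩
  have hmk : m ≤ k := by
    have := Finset.card_le_card hsub
    rw [Finset.card_image_of_injective _ hq, Finset.card_image_of_injective _ hp] at this
    simpa using this
  obtain ⟨e, he⟩ := exists_equiv_comp_eq hinj hq hrange
  have h1 := hQ.posteriorCov_le_inflation_mul hη hν hξ (k := k - m) (by omega) (X ∘ p) (X ∘ r) x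
  have h2 : Fin.append (X ∘ p) (X ∘ r) = (X ∘ q) ∘ e := by
    rw [Function.comp_assoc, he]
    ext i : 1
    refine Fin.addCases (fun i => ?_) (fun i => ?_) i <;> simp
  rw [h2, posteriorCov_comp_equiv] at h1
  exact h1

/-- Each job sees a delayed data set, and no single design has these variances as its predictive
variances. Enlarging the data to all finishers dispatched earlier costs a factor `ξ` and yields the
predictive variances of one sorted design. -/
theorem IsPosteriorKernel.sum_posteriorCov_le (hQ : IsPosteriorKernel κ η Q)
    (hη : 0 < η) (hν : IsGPLaw ν (fun _ => 0) κ) [IsFiniteMeasure ν] (hκ1 : ∀ x x', κ x x' ≤ 1)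
    {mode : ParallelMode} {M : ℕ} (hM : 1 ≤ M) {ξ : ℝ} (hξ : IsInflationBound ν η M ξ)
    {c : ℕ → ℕ} (hc : IsCompletionOrder mode M c) (X : ℕ → Cube d) (n : ℕ) :
    ∑ i : Fin n, posteriorCov κ η (fun l : Fin (numCompleted mode M (c i)) => X (c l))
        (X (c i)) (X (c i)) ≤
      ξ * (2 / Real.log (1 + (η ^ 2)⁻¹)) * maxInfoGain ν η n := by
  set cr : Fin n → ℕ := fun i => c i
  have hcr : Function.Injective cr := fun i l h => Fin.ext (hc.1 h)
  -- `τ k` is the completion rank of the k-th finisher in order of dispatch.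
  set τ := Tuple.sort cr
  have hs : StrictMono (cr ∘ τ) :=
    (Tuple.monotone_sort cr).strictMono_of_injective (hcr.comp τ.injective)
  have hη2 : 0 < (η ^ 2)⁻¹ := by positivity
  have hlog : 0 < Real.log (1 + (η ^ 2)⁻¹) := Real.log_pos (by linarith)
  have hterm : ∀ k : Fin n,
      posteriorCov κ η (fun l : Fin (numCompleted mode M (c (τ k))) => X (c l))
        (X (c (τ k))) (X (c (τ k))) ≤
      ξ / Real.log (1 + (η ^ 2)⁻¹) *
        Real.log ((predVar κ η (X ∘ cr ∘ τ) k + η ^ 2) / η ^ 2) := by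
    intro k
    -- The k finishers sorted before this one have distinct smaller job numbers. Hence fewer than
    -- `M` jobs are added to its data.
    have hk : (k : ℕ) ≤ c (τ k) := by
      have := Fintype.card_le_of_injective
        (fun l : Fin k => (⟨cr (τ (l.castLE k.2.le)), hs (by exact l.2)⟩ : Fin (c (τ k))))
        (fun l l' h => by
          have := (hs.injective (Fin.mk.inj_iff.1 h))
          exact Fin.castLE_injective _ this)
      simpa using this
    have h1 := hQ.posteriorCov_le_of_range_subset hη hν hξ
      (p := fun l : Fin (numCompleted mode M (c (τ k))) => c l)
      (q := fun l : Fin k => cr (τ (l.castLE k.2.le)))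
      (fun l l' h => Fin.ext (hc.1 h))
      (fun l l' h => Fin.castLE_injective _ (hs.injective h))
      (by
        -- A result available to the job belongs to an earlier finisher, hence to one of the first
        -- n, and to an earlier dispatch, hence to the sorted prefix.
        rintro _ ⟨l, rfl⟩
        have hl : (l : ℕ) < n := l.2.trans_le ((hc.2 _).trans (τ k).2.le)
        have hlt : c l < c (τ k) := hc.lt_of_lt_numCompleted l.2
        set l' := τ.symm ⟨l, hl⟩
        have hl' : τ l' = ⟨l, hl⟩ := τ.apply_symm_apply _
        have hlk : l' < k := by
          rw [← hs.lt_iff_lt]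
          simpa [hl', cr] using hlt
        refine ⟨⟨l', hlk⟩, ?_⟩
        change cr (τ l') = c l
        rw [hl'])
      (hk.trans_lt (lt_numCompleted_add mode hM _)) X (X (c (τ k)))
    have h0 : 0 ≤ predVar κ η (X ∘ cr ∘ τ) k := hQ.posteriorCov_nonneg _ _
    have h2 : predVar κ η (X ∘ cr ∘ τ) k ≤ 1 :=
      (hQ.posteriorCov_le hη hν.isPSDKernel _ _).trans (hκ1 _ _)
    have h3 := le_log_div_log hη2 h0 h2
    have h4 : 1 + (η ^ 2)⁻¹ * predVar κ η (X ∘ cr ∘ τ) k =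
        (predVar κ η (X ∘ cr ∘ τ) k + η ^ 2) / η ^ 2 := by
      field_simp
      ring
    rw [h4] at h3
    refine h1.trans ((mul_le_mul_of_nonneg_left h3 hξ.1.le).trans_eq ?_)
    ring
  rw [← Equiv.sum_comp τ]
  refine (Finset.sum_le_sum fun k _ => hterm k).trans ?_
  rw [← Finset.mul_sum]
  refine (mul_le_mul_of_nonneg_left (hQ.sum_log_le_maxInfoGain hη hν hκ1 (X ∘ cr ∘ τ))
    (div_nonneg hξ.1.le hlog.le)).trans_eq ?_
  ring

end CompletionOrder

/-! ### One adaptive job, given its past. -/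

section Adaptive

variable {Ω : Type*} [MeasurableSpace Ω] {P : Measure Ω} {d : ℕ} {κ : Cube d → Cube d → ℝ} {η : ℝ}
  {Q : ∀ m, Kernel ((Fin m → Cube d) × (Fin m → ℝ)) (SamplePath d)}
  {mode : ParallelMode} {M : ℕ} {sel : SamplePath d → Cube d} {f : Ω → SamplePath d}
  {c : Ω → ℕ → ℕ} {ε : ℕ → Ω → ℝ} {g : ℕ → Ω → SamplePath d}

/-- The query points and the observations of the jobs listed by `s`. -/
def jobData (sel : SamplePath d → Cube d) (f : Ω → SamplePath d) (ε : ℕ → Ω → ℝ)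
    (g : ℕ → Ω → SamplePath d) {m : ℕ} (s : Fin m → ℕ) (ω : Ω) :
    (Fin m → Cube d) × (Fin m → ℝ) :=
  (fun i => sel (g (s i) ω), fun i => f ω (sel (g (s i) ω)) + ε (s i) ω)

theorem measurable_eval {d : ℕ} : Measurable fun q : SamplePath d × Cube d => q.1 q.2 :=
  Continuous.measurable (by fun_prop)

/-- The type of the past of job `j`. -/
abbrev PastData (d j : ℕ) : Type :=
  (SamplePath d × (ℕ → ℕ)) × ((Fin j → ℝ) × (Fin j → SamplePath d))

theorem IsParallelTS.measurable_history [IsFiniteMeasure P]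
    (hTS : IsParallelTS P mode M κ η sel f c ε g) (j : ℕ) : Measurable (history f c ε g j) :=
  (hTS.measurable_f.prodMk hTS.measurable_c).prodMk
    ((measurable_pi_lambda _ fun k : Fin j => hTS.measurable_noise k).prodMk
      (measurable_pi_lambda _ fun k : Fin j => hTS.measurable_sample k))

theorem IsParallelTS.measurable_jobData [IsFiniteMeasure P]
    (hTS : IsParallelTS P mode M κ η sel f c ε g) {m : ℕ} (s : Fin m → ℕ) :
    Measurable (jobData sel f ε g s) := by
  have hx : ∀ i, Measurable fun ω => sel (g (s i) ω) := fun i =>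
    hTS.measurable_sel.comp (hTS.measurable_sample _)
  refine (measurable_pi_lambda _ hx).prodMk (measurable_pi_lambda _ fun i => ?_)
  exact (measurable_eval.comp (hTS.measurable_f.prodMk (hx i))).add (hTS.measurable_noise _)

/-- The posterior sample and the noise of job `j`, given the past. -/
theorem IsParallelTS.lintegral_fresh [IsProbabilityMeasure P]
    (hTS : IsParallelTS P mode M κ η sel f c ε g) (hQ : IsPosteriorKernel κ η Q) (j : ℕ)
    {Ψ : (PastData d j × SamplePath d) × ℝ → ℝ≥0∞} (hΨ : Measurable Ψ) :
    ∫⁻ ω, Ψ ((history f c ε g j ω, g j ω), ε j ω) ∂P =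
      ∫⁻ ω, ∫⁻ h, ∫⁻ e, Ψ ((history f c ε g j ω, h), e) ∂noiseLaw η
        ∂(Q _ (jobData sel f ε g (fun i : Fin (numCompleted mode M j) => c ω i) ω)) ∂P := by
  have hH := hTS.measurable_history j
  have hg := hTS.measurable_sample j
  have hε := hTS.measurable_noise j
  have hHg : Measurable fun ω => (history f c ε g j ω, g j ω) := hH.prodMk hg
  have hind := (indepFun_iff_map_prod_eq_prod_map_map hHg.aemeasurable hε.aemeasurable).1
    (hTS.noise_indep j).symm
  rw [hTS.noise_law j] at hind
  have hΨ1 : Measurable fun q : _ × SamplePath d => ∫⁻ e, Ψ (q, e) ∂noiseLaw η :=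
    hΨ.lintegral_prod_right'
  calc ∫⁻ ω, Ψ ((history f c ε g j ω, g j ω), ε j ω) ∂P
      = ∫⁻ q, Ψ q ∂(P.map fun ω => ((history f c ε g j ω, g j ω), ε j ω)) :=
        (lintegral_map hΨ (hHg.prodMk hε)).symm
    _ = ∫⁻ q, ∫⁻ e, Ψ (q, e) ∂noiseLaw η ∂(P.map fun ω => (history f c ε g j ω, g j ω)) := by
        rw [hind, lintegral_prod _ hΨ.aemeasurable]
    _ = ∫⁻ ω, ∫⁻ h, ∫⁻ e, Ψ ((history f c ε g j ω, h), e) ∂noiseLaw η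
        ∂(condDistrib (g j) (history f c ε g j) P (history f c ε g j ω)) ∂P := by
        rw [← compProd_map_condDistrib hg.aemeasurable, Measure.lintegral_compProd hΨ1,
          lintegral_map hΨ1.lintegral_kernel_prod_right' hH]
    _ = _ := by
        refine lintegral_congr_ae ?_
        -- The conditional law of the sample is only known to be Gaussian with the posterior mean
        -- and covariance; uniqueness identifies it with the kernel.
        filter_upwards [hTS.sample_law j] with ω hω
        rw [hω.unique (hQ.law _ (jobData sel f ε g
          (fun i : Fin (numCompleted mode M j) => c ω i) ω))]

/-- The event that the first `n` completed jobs are those prescribed by `c₀`. -/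
def orderEvent (c : Ω → ℕ → ℕ) (c₀ : ℕ → ℕ) (n : ℕ) : Set Ω := {ω | ∀ i < n, c ω i = c₀ i}

theorem measurableSet_prefix (c₀ : ℕ → ℕ) (n : ℕ) :
    MeasurableSet {s : ℕ → ℕ | ∀ i < n, s i = c₀ i} := by
  have : {s : ℕ → ℕ | ∀ i < n, s i = c₀ i} = ⋂ i, ⋂ (_ : i < n), {s : ℕ → ℕ | s i = c₀ i} := by
    ext; simp
  rw [this]
  exact MeasurableSet.iInter fun i => MeasurableSet.iInter fun _ =>
    measurableSet_eq_fun (measurable_pi_apply i) measurable_const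

theorem IsParallelTS.measurableSet_orderEvent [IsFiniteMeasure P]
    (hTS : IsParallelTS P mode M κ η sel f c ε g) (c₀ : ℕ → ℕ) (n : ℕ) :
    MeasurableSet (orderEvent c c₀ n) :=
  hTS.measurable_c (measurableSet_prefix c₀ n)

/-- A list of jobs is closed if it contains the jobs whose results were available for its own
members. -/
def IsClosedJobList (mode : ParallelMode) (M : ℕ) (c₀ : ℕ → ℕ) (n : ℕ) {m : ℕ} (s : Fin m → ℕ) :
    Prop :=
  ∀ k, ∀ i < numCompleted mode M (s k), i < n ∧ c₀ i ∈ Set.range s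

theorem IsClosedJobList.exists_index {c₀ : ℕ → ℕ} {n : ℕ} (hc : IsCompletionOrder mode M c₀)
    {m : ℕ} {s : Fin (m + 1) → ℕ} (h : IsClosedJobList mode M c₀ n s) (hs : StrictMono s)
    (k : Fin (m + 1)) {i : ℕ} (hi : i < numCompleted mode M (s k)) :
    ∃ l : Fin m, s l.castSucc = c₀ i ∧ l.castSucc < k := by
  obtain ⟨-, l, hl⟩ := h k i hi
  have hlt : l < k := hs.lt_iff_lt.1 (hl ▸ hc.lt_of_lt_numCompleted hi)
  have hll : l ≠ Fin.last m := (hlt.trans_le (Fin.le_last k)).ne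
  exact ⟨l.castPred hll, by simpa using hl, by simpa using hlt⟩

theorem IsClosedJobList.castSucc {c₀ : ℕ → ℕ} {n : ℕ} (hc : IsCompletionOrder mode M c₀)
    {m : ℕ} {s : Fin (m + 1) → ℕ} (h : IsClosedJobList mode M c₀ n s) (hs : StrictMono s) :
    IsClosedJobList mode M c₀ n (s ∘ Fin.castSucc) := fun k i hi => by
  obtain ⟨l, hl, -⟩ := h.exists_index hc hs k.castSucc hi
  exact ⟨(h _ i hi).1, l, hl⟩

/-- One more job: the last job of a closed list, given the other ones. -/
theorem IsParallelTS.setLIntegral_jobData_last [IsProbabilityMeasure P]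
    (hTS : IsParallelTS P mode M κ η sel f c ε g) (hQ : IsPosteriorKernel κ η Q)
    {c₀ : ℕ → ℕ} {n : ℕ}
    {m j : ℕ} {s : Fin (m + 1) → ℕ} (hs : StrictMono s) (hj : s (Fin.last m) = j)
    (π : Fin (numCompleted mode M j) → Fin m)
    (hπ : ∀ i : Fin _, (i : ℕ) < n ∧ s (π i).castSucc = c₀ i)
    {Φ : ((Fin (m + 1) → Cube d) × (Fin (m + 1) → ℝ)) × SamplePath d → ℝ≥0∞} (hΦ : Measurable Φ) :
    ∫⁻ ω in orderEvent c c₀ n, Φ (jobData sel f ε g s ω, f ω) ∂P =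
      ∫⁻ ω in orderEvent c c₀ n,
        (fun q : ((Fin m → Cube d) × (Fin m → ℝ)) × SamplePath d =>
          ∫⁻ h, ∫⁻ e, Φ ((Fin.snoc q.1.1 (sel h), Fin.snoc q.1.2 (q.2 (sel h) + e)), q.2)
            ∂noiseLaw η ∂(Q _ (q.1.1 ∘ π, q.1.2 ∘ π)))
          (jobData sel f ε g (s ∘ Fin.castSucc) ω, f ω) ∂P := by
  have hlt : ∀ k : Fin m, s k.castSucc < j := fun k =>
    hj ▸ hs (Fin.castSucc_lt_last k)
  -- All other listed jobs have numbers below `j`, so their data are functions of the history of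
  -- `j`, finished or not.
  let G : PastData d j → (Fin m → Cube d) × (Fin m → ℝ) := fun q =>
    (fun k => sel (q.2.2 ⟨_, hlt k⟩), fun k => q.1.1 (sel (q.2.2 ⟨_, hlt k⟩)) + q.2.1 ⟨_, hlt k⟩)
  have hGω : ∀ ω, G (history f c ε g j ω) = jobData sel f ε g (s ∘ Fin.castSucc) ω := fun ω => rfl
  have hsel := hTS.measurable_sel
  have hG : Measurable G := by
    have hx : ∀ k : Fin m, Measurable fun q : PastData d j => sel (q.2.2 ⟨_, hlt k⟩) := fun k =>
      hsel.comp ((measurable_pi_apply _).comp (measurable_snd.comp measurable_snd))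
    refine (measurable_pi_lambda _ hx).prodMk (measurable_pi_lambda _ fun k => ?_)
    exact (measurable_eval.comp ((measurable_fst.comp measurable_fst).prodMk (hx k))).add
      ((measurable_pi_apply _).comp (measurable_fst.comp measurable_snd))
  let S : Set (ℕ → ℕ) := {t | ∀ i < n, t i = c₀ i}
  have hS : MeasurableSet S := measurableSet_prefix c₀ n
  let Θ : (PastData d j × SamplePath d) × ℝ → ℝ≥0∞ := fun q =>
    Φ ((Fin.snoc (G q.1.1).1 (sel q.1.2), Fin.snoc (G q.1.1).2 (q.1.1.1.1 (sel q.1.2) + q.2)),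
      q.1.1.1.1)
  have hΘ : Measurable Θ := by
    have h1 : Measurable fun q : (PastData d j × SamplePath d) × ℝ => sel q.1.2 :=
      hsel.comp (measurable_snd.comp measurable_fst)
    have h2 : Measurable fun q : (PastData d j × SamplePath d) × ℝ => G q.1.1 :=
      hG.comp (measurable_fst.comp measurable_fst)
    have h3 : Measurable fun q : (PastData d j × SamplePath d) × ℝ => q.1.1.1.1 := by fun_prop
    have h4 : Measurable fun q : (PastData d j × SamplePath d) × ℝ => q.1.1.1.1 (sel q.1.2) + q.2 :=
      (measurable_eval.comp (h3.prodMk h1)).add measurable_snd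
    have h5 := measurable_snoc.comp ((measurable_fst.comp h2).prodMk h1)
    have h6 := measurable_snoc.comp ((measurable_snd.comp h2).prodMk h4)
    exact hΦ.comp ((h5.prodMk h6).prodMk h3)
  -- The completion order is part of the history, so restricting to the order event commutes with
  -- integrating out the fresh sample and noise.
  let Ψ : (PastData d j × SamplePath d) × ℝ → ℝ≥0∞ :=
    ((fun q : (PastData d j × SamplePath d) × ℝ => q.1.1.1.2) ⁻¹' S).indicator Θ
  have hΨ : Measurable Ψ := hΘ.indicator
    ((by fun_prop : Measurable fun q : (PastData d j × SamplePath d) × ℝ => q.1.1.1.2) hS)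
  have hE := hTS.measurableSet_orderEvent c₀ n
  rw [← lintegral_indicator hE, ← lintegral_indicator hE]
  have hleft : ∀ ω, (orderEvent c c₀ n).indicator (fun ω => Φ (jobData sel f ε g s ω, f ω)) ω =
      Ψ ((history f c ε g j ω, g j ω), ε j ω) := by
    intro ω
    have e1 : jobData sel f ε g s ω = (Fin.snoc (jobData sel f ε g (s ∘ Fin.castSucc) ω).1
        (sel (g j ω)), Fin.snoc (jobData sel f ε g (s ∘ Fin.castSucc) ω).2
        (f ω (sel (g j ω)) + ε j ω)) := by
      rw [← hj]
      refine Prod.ext ?_ ?_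
      · exact (Fin.snoc_init_self (jobData sel f ε g s ω).1).symm
      · exact (Fin.snoc_init_self (jobData sel f ε g s ω).2).symm
    by_cases hω : ω ∈ orderEvent c c₀ n
    · have h2 : ((history f c ε g j ω, g j ω), ε j ω) ∈
        ((fun q : (PastData d j × SamplePath d) × ℝ => q.1.1.1.2) ⁻¹' S) := hω
      rw [Set.indicator_of_mem hω, e1]
      exact (Set.indicator_of_mem h2 Θ).symm
    · have h2 : ((history f c ε g j ω, g j ω), ε j ω) ∉
        ((fun q : (PastData d j × SamplePath d) × ℝ => q.1.1.1.2) ⁻¹' S) := hω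
      rw [Set.indicator_of_notMem hω]
      exact (Set.indicator_of_notMem h2 Θ).symm
  rw [lintegral_congr hleft, hTS.lintegral_fresh hQ j hΨ]
  refine lintegral_congr fun ω => ?_
  by_cases hω : ω ∈ orderEvent c c₀ n
  · rw [Set.indicator_of_mem hω]
    have e2 : jobData sel f ε g (fun i : Fin (numCompleted mode M j) => c ω i) ω =
        ((jobData sel f ε g (s ∘ Fin.castSucc) ω).1 ∘ π,
          (jobData sel f ε g (s ∘ Fin.castSucc) ω).2 ∘ π) := by
      have e3 : (fun i : Fin (numCompleted mode M j) => c ω i) = (s ∘ Fin.castSucc) ∘ π :=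
        funext fun i => (hω i (hπ i).1).trans (hπ i).2.symm
      rw [e3]
      rfl
    rw [e2]
    beta_reduce
    refine lintegral_congr fun h => lintegral_congr fun e => ?_
    have h2 : ((history f c ε g j ω, h), e) ∈
      ((fun q : (PastData d j × SamplePath d) × ℝ => q.1.1.1.2) ⁻¹' S) := hω
    exact Set.indicator_of_mem h2 _
  · rw [Set.indicator_of_notMem hω]
    have h2 : ∀ h e, Ψ ((history f c ε g j ω, h), e) = 0 := fun h e => by
      have h3 : ((history f c ε g j ω, h), e) ∉
        ((fun q : (PastData d j × SamplePath d) × ℝ => q.1.1.1.2) ⁻¹' S) := hω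
      exact Set.indicator_of_notMem h3 _
    simp [h2]

end Adaptive

/-! ### Posterior law for adaptively collected data. -/

section AdaptivePosterior

variable {Ω : Type*} [MeasurableSpace Ω] {P : Measure Ω} {d : ℕ} {κ : Cube d → Cube d → ℝ} {η : ℝ}
  {Q : ∀ m, Kernel ((Fin m → Cube d) × (Fin m → ℝ)) (SamplePath d)}
  {mode : ParallelMode} {M : ℕ} {sel : SamplePath d → Cube d} {f : Ω → SamplePath d}
  {c : Ω → ℕ → ℕ} {ε : ℕ → Ω → ℝ} {g : ℕ → Ω → SamplePath d}

theorem IsPosteriorKernel.measurable_update (hQ : IsPosteriorKernel κ η Q)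
    (hsel : Measurable sel) {m k : ℕ} (π : Fin k → Fin m)
    {Φ : ((Fin (m + 1) → Cube d) × (Fin (m + 1) → ℝ)) × SamplePath d → ℝ≥0∞} (hΦ : Measurable Φ) :
    Measurable fun q : ((Fin m → Cube d) × (Fin m → ℝ)) × SamplePath d =>
      ∫⁻ h, ∫⁻ e, Φ ((Fin.snoc q.1.1 (sel h), Fin.snoc q.1.2 (q.2 (sel h) + e)), q.2)
        ∂noiseLaw η ∂(Q k (q.1.1 ∘ π, q.1.2 ∘ π)) := by
  have hp : Measurable fun q : ((Fin m → Cube d) × (Fin m → ℝ)) × SamplePath d =>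
      (q.1.1 ∘ π, q.1.2 ∘ π) := by
    refine (measurable_pi_lambda _ fun i => ?_).prodMk (measurable_pi_lambda _ fun i => ?_)
    · exact (measurable_pi_apply (π i)).comp (measurable_fst.comp measurable_fst)
    · exact (measurable_pi_apply (π i)).comp (measurable_snd.comp measurable_fst)
  refine hQ.measurable_lintegral hp (F := fun t =>
    ∫⁻ e, Φ ((Fin.snoc t.1.1.1 (sel t.2), Fin.snoc t.1.1.2 (t.1.2 (sel t.2) + e)), t.1.2)
        ∂noiseLaw η) ?_
  have hΘ : Measurable fun q : ((((Fin m → Cube d) × (Fin m → ℝ)) × SamplePath d) ×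
      SamplePath d) × ℝ =>
      Φ ((Fin.snoc q.1.1.1.1 (sel q.1.2), Fin.snoc q.1.1.1.2 (q.1.1.2 (sel q.1.2) + q.2)),
        q.1.1.2) := by
    have h1 : Measurable fun q : ((((Fin m → Cube d) × (Fin m → ℝ)) × SamplePath d) ×
      SamplePath d) × ℝ => sel q.1.2 := hsel.comp (measurable_snd.comp measurable_fst)
    have h3 : Measurable fun q : ((((Fin m → Cube d) × (Fin m → ℝ)) × SamplePath d) ×
      SamplePath d) × ℝ => q.1.1.2 := by fun_prop
    have h2 : Measurable fun q : ((((Fin m → Cube d) × (Fin m → ℝ)) × SamplePath d) ×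
      SamplePath d) × ℝ => q.1.1.1 := by fun_prop
    have h4 : Measurable fun q : ((((Fin m → Cube d) × (Fin m → ℝ)) × SamplePath d) ×
      SamplePath d) × ℝ => q.1.1.2 (sel q.1.2) + q.2 :=
      (measurable_eval.comp (h3.prodMk h1)).add measurable_snd
    have h5 := measurable_snoc.comp ((measurable_fst.comp h2).prodMk h1)
    have h6 := measurable_snoc.comp ((measurable_snd.comp h2).prodMk h4)
    exact hΦ.comp ((h5.prodMk h6).prodMk h3)
  exact hΘ.lintegral_prod_right'

/-- Given the listed data, the sample behind the new query is independent of the function. Fubini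
therefore allows the query to be frozen first, and Bayes' rule at a fixed point applies. The sample
may use only the part of the data selected by `π`. -/
theorem IsPosteriorKernel.lintegral_update (hQ : IsPosteriorKernel κ η Q) (hη : 0 < η)
    {ν : Measure (SamplePath d)} (hν : IsGPLaw ν (fun _ => 0) κ)
    (hsel : Measurable sel) {m k : ℕ} (π : Fin k → Fin m) (A : Fin m → Cube d) (y : Fin m → ℝ)
    {Φ : ((Fin (m + 1) → Cube d) × (Fin (m + 1) → ℝ)) × SamplePath d → ℝ≥0∞} (hΦ : Measurable Φ) :
    ∫⁻ u, ∫⁻ h, ∫⁻ e, Φ ((Fin.snoc A (sel h), Fin.snoc y (u (sel h) + e)), u)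
        ∂noiseLaw η ∂(Q k (A ∘ π, y ∘ π)) ∂(Q m (A, y)) =
      ∫⁻ h, ∫⁻ z, ∫⁻ u, Φ ((Fin.snoc A (sel h), Fin.snoc y z), u)
          ∂(Q (m + 1) ((Fin.snoc A (sel h) : Fin (m + 1) → Cube d),
            (Fin.snoc y z : Fin (m + 1) → ℝ)))
        ∂(gaussianReal (posteriorMean κ η A y (sel h))
          (posteriorCov κ η A (sel h) (sel h) + η ^ 2).toNNReal) ∂(Q k (A ∘ π, y ∘ π)) := by
  have := hQ.isMarkovKernel m
  have := hQ.isMarkovKernel k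
  have hΘ : Measurable fun q : (SamplePath d × SamplePath d) × ℝ =>
      Φ ((Fin.snoc A (sel q.1.2), Fin.snoc y (q.1.1 (sel q.1.2) + q.2)), q.1.1) := by
    have h1 : Measurable fun q : (SamplePath d × SamplePath d) × ℝ => sel q.1.2 :=
      hsel.comp (measurable_snd.comp measurable_fst)
    have h3 : Measurable fun q : (SamplePath d × SamplePath d) × ℝ => q.1.1 := by fun_prop
    have h4 : Measurable fun q : (SamplePath d × SamplePath d) × ℝ => q.1.1 (sel q.1.2) + q.2 :=
      (measurable_eval.comp (h3.prodMk h1)).add measurable_snd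
    have h5 := measurable_snoc.comp ((measurable_const (a := A)).prodMk h1)
    have h6 := measurable_snoc.comp ((measurable_const (a := y)).prodMk h4)
    exact hΦ.comp ((h5.prodMk h6).prodMk h3)
  rw [lintegral_lintegral_swap (hΘ.lintegral_prod_right').aemeasurable]
  refine lintegral_congr fun h => ?_
  refine hQ.lintegral_obs hη hν A y (sel h)
    (Θ := fun q => Φ ((Fin.snoc A (sel h), Fin.snoc y q.2), q.1)) ?_
  have h5 : Measurable fun q : SamplePath d × ℝ => (Fin.snoc y q.2 : Fin (m + 1) → ℝ) :=
    measurable_snoc.comp ((measurable_const (a := y)).prodMk measurable_snd)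
  exact hΦ.comp ((measurable_const.prodMk h5).prodMk measurable_fst)

/-- On the event that the order of completion is `c₀`, the function is distributed, given the
evaluations of a closed list of jobs, as the posterior process. -/
theorem IsParallelTS.setLIntegral_jobData_of_strictMono [IsProbabilityMeasure P]
    (hTS : IsParallelTS P mode M κ η sel f c ε g) (hQ : IsPosteriorKernel κ η Q) (hη : 0 < η)
    (hν : IsGPLaw (P.map f) (fun _ => 0) κ) {c₀ : ℕ → ℕ} (hc : IsCompletionOrder mode M c₀) {n : ℕ}
    {m : ℕ} {s : Fin m → ℕ} (hs : StrictMono s) (hcl : IsClosedJobList mode M c₀ n s)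
    {Φ : ((Fin m → Cube d) × (Fin m → ℝ)) × SamplePath d → ℝ≥0∞} (hΦ : Measurable Φ) :
    ∫⁻ ω in orderEvent c c₀ n, Φ (jobData sel f ε g s ω, f ω) ∂P =
      ∫⁻ ω in orderEvent c c₀ n, ∫⁻ h, Φ (jobData sel f ε g s ω, h)
        ∂(Q m (jobData sel f ε g s ω)) ∂P := by
  induction m with
  | zero =>
    have he : ∀ ω, jobData sel f ε g s ω = (Fin.elim0, Fin.elim0) := fun ω =>
      Prod.ext (Subsingleton.elim _ _) (Subsingleton.elim _ _)
    simp only [he, hQ.zero_eq hν]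
    set F : SamplePath d → ℝ≥0∞ := fun h => Φ ((Fin.elim0, Fin.elim0), h) with hF
    have hFm : Measurable F := hΦ.comp measurable_prodMk_left
    have hE := hTS.measurableSet_orderEvent c₀ n
    -- With no data, the prior survives conditioning on the order event because the order is
    -- independent of `f`.
    have hind : IndepFun f (fun ω => (orderEvent c c₀ n).indicator (fun _ => (1 : ℝ≥0∞)) ω) P :=
      hTS.indep_order.comp measurable_id
        (measurable_one.indicator (measurableSet_prefix c₀ n))
    have h1 := lintegral_mul_eq_lintegral_mul_lintegral_of_indepFun
      (f := fun ω => F (f ω)) (g := fun ω => (orderEvent c c₀ n).indicator (fun _ => (1 : ℝ≥0∞)) ω)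
      (hFm.comp hTS.measurable_f) (measurable_one.indicator hE) (hind.comp hFm measurable_id)
    rw [lintegral_indicator hE, setLIntegral_const, one_mul] at h1
    rw [setLIntegral_const, lintegral_map hFm hTS.measurable_f, ← h1, ← lintegral_indicator hE]
    refine lintegral_congr fun ω => ?_
    by_cases hω : ω ∈ orderEvent c c₀ n <;> simp [hω, hF]
  | succ m ih =>
    have hex := fun i : Fin (numCompleted mode M (s (Fin.last m))) =>
      hcl.exists_index hc hs (Fin.last m) i.2
    choose π hπ using hex
    have hπ' : ∀ i : Fin (numCompleted mode M (s (Fin.last m))),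
        (i : ℕ) < n ∧ s (π i).castSucc = c₀ i := fun i => ⟨(hcl _ i i.2).1, (hπ i).1⟩
    have hcl' := hcl.castSucc hc hs
    have hs' : StrictMono (s ∘ Fin.castSucc) := hs.comp Fin.strictMono_castSucc
    have step : ∀ {Φ : ((Fin (m + 1) → Cube d) × (Fin (m + 1) → ℝ)) × SamplePath d → ℝ≥0∞},
        Measurable Φ → ∫⁻ ω in orderEvent c c₀ n, Φ (jobData sel f ε g s ω, f ω) ∂P =
        ∫⁻ ω in orderEvent c c₀ n, (fun D : (Fin m → Cube d) × (Fin m → ℝ) =>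
          ∫⁻ h, ∫⁻ z, ∫⁻ u, Φ ((Fin.snoc D.1 (sel h), Fin.snoc D.2 z), u)
            ∂(Q (m + 1) ((Fin.snoc D.1 (sel h) : Fin (m + 1) → Cube d),
              (Fin.snoc D.2 z : Fin (m + 1) → ℝ)))
          ∂(gaussianReal (posteriorMean κ η D.1 D.2 (sel h))
            (posteriorCov κ η D.1 (sel h) (sel h) + η ^ 2).toNNReal)
          ∂(Q _ (D.1 ∘ π, D.2 ∘ π))) (jobData sel f ε g (s ∘ Fin.castSucc) ω) ∂P := by
      intro Φ hΦ
      rw [hTS.setLIntegral_jobData_last hQ hs rfl π hπ' hΦ,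
        ih hs' hcl' (hQ.measurable_update hTS.measurable_sel π hΦ)]
      refine lintegral_congr fun ω => ?_
      exact hQ.lintegral_update hη hν hTS.measurable_sel π _ _ hΦ
    -- As for fixed designs: apply `step` also to the posterior average of `Φ`, on which a further
    -- average has no effect.
    have hΦ' : Measurable fun q : ((Fin (m + 1) → Cube d) × (Fin (m + 1) → ℝ)) × SamplePath d =>
        ∫⁻ h, Φ (q.1, h) ∂(Q (m + 1) q.1) :=
      hQ.measurable_lintegral measurable_fst (F := fun t => Φ (t.1.1, t.2)) (by fun_prop)
    have := hQ.isMarkovKernel (m + 1)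
    rw [step hΦ]
    have h2 := step hΦ'
    simp only [lintegral_const, measure_univ, mul_one] at h2
    exact h2.symm

/-- Sorting reduces to increasing lists, where the induction runs; the posterior is invariant under
permutation of its data. -/
theorem IsParallelTS.setLIntegral_jobData [IsProbabilityMeasure P]
    (hTS : IsParallelTS P mode M κ η sel f c ε g) (hQ : IsPosteriorKernel κ η Q) (hη : 0 < η)
    (hν : IsGPLaw (P.map f) (fun _ => 0) κ) {c₀ : ℕ → ℕ} (hc : IsCompletionOrder mode M c₀) {n : ℕ}
    {m : ℕ} {s : Fin m → ℕ} (hs : Function.Injective s) (hcl : IsClosedJobList mode M c₀ n s)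
    {Φ : ((Fin m → Cube d) × (Fin m → ℝ)) × SamplePath d → ℝ≥0∞} (hΦ : Measurable Φ) :
    ∫⁻ ω in orderEvent c c₀ n, Φ (jobData sel f ε g s ω, f ω) ∂P =
      ∫⁻ ω in orderEvent c c₀ n, ∫⁻ h, Φ (jobData sel f ε g s ω, h)
        ∂(Q m (jobData sel f ε g s ω)) ∂P := by
  set e := Tuple.sort s
  have hmono : StrictMono (s ∘ e) :=
    (Tuple.monotone_sort s).strictMono_of_injective (hs.comp e.injective)
  have hcl' : IsClosedJobList mode M c₀ n (s ∘ e) := fun k i hi => by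
    rw [e.surjective.range_comp]
    exact hcl (e k) i hi
  let T : (Fin m → Cube d) × (Fin m → ℝ) → (Fin m → Cube d) × (Fin m → ℝ) := fun D =>
    (D.1 ∘ e.symm, D.2 ∘ e.symm)
  have hT : Measurable T := by
    refine (measurable_pi_lambda _ fun i => ?_).prodMk (measurable_pi_lambda _ fun i => ?_)
    · exact (measurable_pi_apply (e.symm i)).comp measurable_fst
    · exact (measurable_pi_apply (e.symm i)).comp measurable_snd
  have hTe : ∀ ω, T (jobData sel f ε g (s ∘ e) ω) = jobData sel f ε g s ω := fun ω => by
    refine Prod.ext (funext fun i => ?_) (funext fun i => ?_) <;> simp [T, jobData]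
  have hTQ : ∀ ω, Q m (jobData sel f ε g (s ∘ e) ω) = Q m (jobData sel f ε g s ω) := fun ω =>
    hQ.comp_equiv e (jobData sel f ε g s ω).1 (jobData sel f ε g s ω).2
  have h := hTS.setLIntegral_jobData_of_strictMono hQ hη hν hc hmono hcl'
    (Φ := fun q => Φ (T q.1, q.2)) (hΦ.comp ((hT.comp measurable_fst).prodMk measurable_snd))
  simpa only [hTe, hTQ] using h

/-- The posterior sample of a completed job, given the function and the evaluations available to the
job, is distributed as the posterior. -/
theorem IsParallelTS.setLIntegral_sample [IsProbabilityMeasure P]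
    (hTS : IsParallelTS P mode M κ η sel f c ε g) (hQ : IsPosteriorKernel κ η Q)
    {c₀ : ℕ → ℕ} (hc : IsCompletionOrder mode M c₀) {n i j : ℕ}
    (hi : i < n) (hj : c₀ i = j)
    {Φ : (((Fin (numCompleted mode M j) → Cube d) × (Fin (numCompleted mode M j) → ℝ)) ×
      SamplePath d) × SamplePath d → ℝ≥0∞} (hΦ : Measurable Φ) :
    ∫⁻ ω in orderEvent c c₀ n, Φ ((jobData sel f ε g (fun l => c₀ l) ω, f ω), g j ω) ∂P =
      ∫⁻ ω in orderEvent c c₀ n, ∫⁻ h, Φ ((jobData sel f ε g (fun l => c₀ l) ω, f ω), h)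
        ∂(Q (numCompleted mode M j) (jobData sel f ε g (fun l => c₀ l) ω)) ∂P := by
  have hlt : ∀ k : Fin (numCompleted mode M j), c₀ k < j := fun k =>
    hc.lt_of_lt_numCompleted k.2
  have hln : ∀ k : Fin (numCompleted mode M j), (k : ℕ) < n := fun k =>
    k.2.trans_le ((hj ▸ hc.2 i).trans hi.le)
  let G : PastData d j → (Fin (numCompleted mode M j) → Cube d) × (Fin (numCompleted mode M j) → ℝ) :=
    fun q => (fun k => sel (q.2.2 ⟨_, hlt k⟩),
      fun k => q.1.1 (sel (q.2.2 ⟨_, hlt k⟩)) + q.2.1 ⟨_, hlt k⟩)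
  have hG : Measurable G := by
    have hx : ∀ k : Fin (numCompleted mode M j), Measurable fun q : PastData d j =>
        sel (q.2.2 ⟨_, hlt k⟩) := fun k =>
      hTS.measurable_sel.comp ((measurable_pi_apply _).comp (measurable_snd.comp measurable_snd))
    refine (measurable_pi_lambda _ hx).prodMk (measurable_pi_lambda _ fun k => ?_)
    exact (measurable_eval.comp ((measurable_fst.comp measurable_fst).prodMk (hx k))).add
      ((measurable_pi_apply _).comp (measurable_fst.comp measurable_snd))
  let S : Set (ℕ → ℕ) := {t | ∀ i < n, t i = c₀ i}
  have hS : MeasurableSet S := measurableSet_prefix c₀ n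
  let Θ : (PastData d j × SamplePath d) × ℝ → ℝ≥0∞ := fun q => Φ ((G q.1.1, q.1.1.1.1), q.1.2)
  have hΘ : Measurable Θ :=
    hΦ.comp (((hG.comp (measurable_fst.comp measurable_fst)).prodMk
      (measurable_fst.comp (measurable_fst.comp (measurable_fst.comp measurable_fst)))).prodMk
      (measurable_snd.comp measurable_fst))
  let R : Set ((PastData d j × SamplePath d) × ℝ) := (fun q => q.1.1.1.2) ⁻¹' S
  have hR : MeasurableSet R :=
    (by fun_prop : Measurable fun q : (PastData d j × SamplePath d) × ℝ => q.1.1.1.2) hS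
  have hE := hTS.measurableSet_orderEvent c₀ n
  have h := hTS.lintegral_fresh hQ j (hΘ.indicator hR)
  rw [← lintegral_indicator hE, ← lintegral_indicator hE]
  refine Eq.trans (lintegral_congr fun ω => ?_) (h.trans (lintegral_congr fun ω => ?_))
  · by_cases hω : ω ∈ orderEvent c c₀ n
    · have h2 : ((history f c ε g j ω, g j ω), ε j ω) ∈ R := hω
      rw [Set.indicator_of_mem hω]
      exact (Set.indicator_of_mem h2 Θ).symm
    · have h2 : ((history f c ε g j ω, g j ω), ε j ω) ∉ R := hω
      rw [Set.indicator_of_notMem hω]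
      exact (Set.indicator_of_notMem h2 Θ).symm
  · by_cases hω : ω ∈ orderEvent c c₀ n
    · have h2 : ∀ h e, R.indicator Θ ((history f c ε g j ω, h), e) =
          Φ ((jobData sel f ε g (fun l : Fin (numCompleted mode M j) => c₀ l) ω, f ω), h) := fun h e => by
        have h2 : ((history f c ε g j ω, h), e) ∈ R := hω
        exact Set.indicator_of_mem h2 Θ
      have e3 : (fun l : Fin (numCompleted mode M j) => c ω l) = fun l : Fin (numCompleted mode M j) => c₀ l :=
        funext fun l => hω l (hln l)
      rw [Set.indicator_of_mem hω, e3]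
      simp [h2]
    · have h2 : ∀ h e, R.indicator Θ ((history f c ε g j ω, h), e) = 0 := fun h e => by
        have h2 : ((history f c ε g j ω, h), e) ∉ R := hω
        exact Set.indicator_of_notMem h2 Θ
      rw [Set.indicator_of_notMem hω]
      simp [h2]

/-- Availability is transitive: what the k-th finisher could see finished before it, so every later
reader of its result could see it too. -/
theorem IsCompletionOrder.isClosedJobList {c₀ : ℕ → ℕ} (hc : IsCompletionOrder mode M c₀)
    {n i : ℕ} (hi : i < n) :
    IsClosedJobList mode M c₀ n (fun l : Fin (numCompleted mode M (c₀ i)) => c₀ l) := by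
  intro k l hl
  have h1 : l < k := hl.trans_le (hc.2 k)
  have h2 : (k : ℕ) < i := k.2.trans_le (hc.2 i)
  exact ⟨by omega, ⟨l, h1.trans k.2⟩, rfl⟩

end AdaptivePosterior

/-! ### Lipschitz constants of sample paths. -/

section Lipschitz

variable {d : ℕ}

/-- The best Lipschitz constant of a path in the `i`-th coordinate. -/
noncomputable def coordLip (i : Fin d) (h : SamplePath d) : ℝ≥0∞ :=
  ⨆ (x : Cube d) (t : unitInterval),
    ENNReal.ofReal (|h (Function.update x i t) - h x| / |(t : ℝ) - x i|)

/-- The sum of the coordinatewise Lipschitz constants. -/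
noncomputable def lipSum (h : SamplePath d) : ℝ≥0∞ := ∑ i, coordLip i h

/-- A supremum of continuous functions, even over uncountably many points, is lower semicontinuous.
Difference quotients thus avoid any measurability question for suprema of derivatives. -/
theorem measurable_coordLip (i : Fin d) : Measurable (coordLip i) := by
  refine LowerSemicontinuous.measurable ?_
  refine lowerSemicontinuous_iSup fun x => lowerSemicontinuous_iSup fun t => ?_
  refine Continuous.lowerSemicontinuous (ENNReal.continuous_ofReal.comp ?_)
  exact Continuous.div_const (by fun_prop) _

theorem measurable_lipSum : Measurable (lipSum (d := d)) :=
  Finset.measurable_sum _ fun i _ => measurable_coordLip i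

theorem ofReal_abs_update_sub_le (h : SamplePath d) (i : Fin d) (x : Cube d) (t : unitInterval) :
    ENNReal.ofReal |h (Function.update x i t) - h x| ≤
      coordLip i h * ENNReal.ofReal |(t : ℝ) - x i| := by
  rcases eq_or_ne t (x i) with rfl | hne
  · simp
  · have hpos : 0 < |(t : ℝ) - x i| :=
      abs_pos.2 (sub_ne_zero.2 fun h => hne (Subtype.ext h))
    have h1 : ENNReal.ofReal (|h (Function.update x i t) - h x| / |(t : ℝ) - x i|) ≤
        coordLip i h := le_iSup₂_of_le x t le_rfl
    refine le_trans ?_ (mul_le_mul_left h1 _)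
    rw [← ENNReal.ofReal_mul (by positivity), div_mul_cancel₀ _ hpos.ne']

/-- Change one coordinate at a time. -/
theorem ofReal_abs_sub_le_sum (h : SamplePath d) (x x' : Cube d) :
    ENNReal.ofReal |h x' - h x| ≤ ∑ i, coordLip i h * ENNReal.ofReal |(x' i : ℝ) - x i| := by
  have key : ∀ S : Finset (Fin d), ENNReal.ofReal |h (S.piecewise x' x) - h x| ≤
      ∑ i ∈ S, coordLip i h * ENNReal.ofReal |(x' i : ℝ) - x i| := by
    intro S
    induction S using Finset.induction_on with
    | empty => simp
    | insert j S hj ih =>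
      rw [Finset.sum_insert hj, Finset.piecewise_insert]
      have h1 := ofReal_abs_update_sub_le h j (S.piecewise x' x) (x' j)
      rw [Finset.piecewise_eq_of_notMem _ _ _ hj] at h1
      refine le_trans (ENNReal.ofReal_le_ofReal (abs_sub_le _ (h (S.piecewise x' x)) _)) ?_
      rw [ENNReal.ofReal_add (abs_nonneg _) (abs_nonneg _)]
      exact add_le_add h1 ih
  simpa using key Finset.univ

theorem ofReal_abs_sub_le (h : SamplePath d) {x x' : Cube d} {r : ℝ}
    (hr : ∀ i, |(x' i : ℝ) - x i| ≤ r) :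
    ENNReal.ofReal |h x' - h x| ≤ lipSum h * ENNReal.ofReal r := by
  rw [lipSum, Finset.sum_mul]
  exact (ofReal_abs_sub_le_sum h x x').trans
    (Finset.sum_le_sum fun i _ => mul_le_mul_right (ENNReal.ofReal_le_ofReal (hr i)) _)

theorem ofReal_abs_sub_le_lipSum (h : SamplePath d) (x x' : Cube d) :
    ENNReal.ofReal |h x' - h x| ≤ lipSum h := by
  have := ofReal_abs_sub_le h (x := x) (x' := x') (r := 1) fun i => by
    have h1 := (x' i).2
    have h2 := (x i).2
    rw [abs_le]
    constructor <;> linarith [h1.1, h1.2, h2.1, h2.2]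
  simpa using this

/-- Mean value inequality along coordinate slices; neither continuity of the derivative nor joint
differentiability enters. -/
theorem coordLip_le_of_partialDeriv {h : SamplePath d} {i : Fin d}
    (hd : ∀ x : Cube d, DifferentiableWithinAt ℝ (coordSlice h i x) (Set.Icc 0 1) (x i))
    {J : ℝ} (hJ : ∀ x, |partialDeriv h i x| ≤ J) : coordLip i h ≤ ENNReal.ofReal J := by
  refine iSup₂_le fun x t => ENNReal.ofReal_le_ofReal ?_
  have hJ0 : 0 ≤ J := (abs_nonneg _).trans (hJ x)
  -- Covers `t = x i` as well, where the quotient is 0 by convention.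
  refine div_le_of_le_mul₀ (abs_nonneg _) hJ0 ?_
  have hslice : ∀ s : unitInterval, coordSlice h i (Function.update x i s) = coordSlice h i x :=
    fun s => by
      funext r
      simp [coordSlice]
  have hdiff : DifferentiableOn ℝ (coordSlice h i x) (Set.Icc 0 1) := fun s hs => by
    have := hd (Function.update x i ⟨s, hs⟩)
    rwa [hslice, Function.update_self] at this
  have hbound : ∀ s ∈ Set.Icc (0 : ℝ) 1,
      ‖derivWithin (coordSlice h i x) (Set.Icc 0 1) s‖ ≤ J := fun s hs => by
    have := hJ (Function.update x i ⟨s, hs⟩)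
    rw [partialDeriv, hslice, Function.update_self] at this
    exact this
  have hval : ∀ s : unitInterval, coordSlice h i x s = h (Function.update x i s) := fun s => by
    simp [coordSlice]
  have := (convex_Icc (0 : ℝ) 1).norm_image_sub_le_of_norm_derivWithin_le hdiff hbound (x i).2 t.2
  rwa [hval, hval, Function.update_eq_self, Real.norm_eq_abs, Real.norm_eq_abs] at this

variable {Ω : Type*} [MeasurableSpace Ω] {P : Measure Ω} {f : Ω → SamplePath d} {a b : ℝ}

theorem SubGaussianDerivatives.meas_lt_coordLip (hD : SubGaussianDerivatives P f a b) (i : Fin d)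
    {J : ℝ} (hJ : 0 < J) :
    P {ω | ENNReal.ofReal J < coordLip i (f ω)} ≤ ENNReal.ofReal (a * Real.exp (-(J / b) ^ 2)) := by
  refine le_trans (measure_mono_ae ?_) (hD.tail i J hJ)
  filter_upwards [hD.differentiable] with ω hω hlt
  by_contra hcon
  have hcon' : ∀ x, |partialDeriv (f ω) i x| ≤ J := fun x => not_lt.1 fun hx => hcon ⟨x, hx⟩
  exact absurd (coordLip_le_of_partialDeriv (hω i) hcon') (not_le.2 hlt)

theorem SubGaussianDerivatives.coordLip_lt_top (hD : SubGaussianDerivatives P f a b) (i : Fin d) :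
    ∀ᵐ ω ∂P, coordLip i (f ω) < ∞ := by
  have hb := hD.b_pos
  have hlim : Filter.Tendsto (fun k : ℕ => ENNReal.ofReal (a * Real.exp (-(((k : ℝ) + 1) / b) ^ 2)))
      Filter.atTop (nhds 0) := by
    rw [← ENNReal.ofReal_zero]
    refine (ENNReal.continuous_ofReal.tendsto 0).comp ?_
    rw [← mul_zero a]
    refine Filter.Tendsto.const_mul a (Real.tendsto_exp_atBot.comp ?_)
    refine Filter.tendsto_neg_atTop_atBot.comp ((Filter.tendsto_pow_atTop two_ne_zero).comp ?_)
    exact (Filter.tendsto_atTop_add_const_right _ _ tendsto_natCast_atTop_atTop).atTop_div_const hb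
  have h0 : P {ω | coordLip i (f ω) = ∞} ≤ 0 := by
    refine ge_of_tendsto' hlim fun k => le_trans (measure_mono fun ω hω => ?_)
      (hD.meas_lt_coordLip i (by positivity : (0 : ℝ) < (k : ℝ) + 1))
    simp only [Set.mem_ofPred_eq] at hω ⊢
    rw [hω]
    exact ENNReal.ofReal_lt_top
  rw [ae_iff]
  simpa only [not_lt, top_le_iff, nonpos_iff_eq_zero] using h0

/-- Layer cake: the tail bound integrates to half a Gaussian integral. Summed over the axes this
gives half of d a b √π, the quantity inside β_n. -/
theorem SubGaussianDerivatives.lintegral_coordLip_le (hD : SubGaussianDerivatives P f a b)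
    (hf : Measurable f) (i : Fin d) :
    ∫⁻ ω, coordLip i (f ω) ∂P ≤ ENNReal.ofReal (a * b * √Real.pi / 2) := by
  have hb := hD.b_pos
  have hm : Measurable fun ω => coordLip i (f ω) := (measurable_coordLip i).comp hf
  have h1 : ∫⁻ ω, coordLip i (f ω) ∂P = ∫⁻ ω, ENNReal.ofReal (coordLip i (f ω)).toReal ∂P := by
    refine lintegral_congr_ae ?_
    filter_upwards [hD.coordLip_lt_top i] with ω hω
    rw [ENNReal.ofReal_toReal hω.ne]
  rw [h1, lintegral_eq_lintegral_meas_lt P (Filter.Eventually.of_forall fun ω => ENNReal.toReal_nonneg)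
    hm.ennreal_toReal.aemeasurable]
  have h2 : ∀ t ∈ Set.Ioi (0 : ℝ), P {ω | t < (coordLip i (f ω)).toReal} ≤
      ENNReal.ofReal (a * Real.exp (-(1 / b ^ 2) * t ^ 2)) := fun t ht => by
    refine (measure_mono fun ω hω => ?_).trans ((hD.meas_lt_coordLip i ht).trans_eq ?_)
    · exact (ENNReal.ofReal_lt_iff_lt_toReal (le_of_lt ht) (fun h => by
        simp only [Set.mem_ofPred_eq, h, ENNReal.toReal_top] at hω
        exact absurd hω (not_lt.2 (le_of_lt ht)))).2 hω
    · congr 3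
      ring
  refine (setLIntegral_mono (by fun_prop) h2).trans ?_
  have hint : Integrable (fun t : ℝ => a * Real.exp (-(1 / b ^ 2) * t ^ 2))
      (volume.restrict (Set.Ioi 0)) :=
    ((integrable_exp_neg_mul_sq (by positivity)).const_mul a).integrableOn
  rw [← ofReal_integral_eq_lintegral_ofReal hint (Filter.Eventually.of_forall fun t => by
    have := hD.a_pos
    positivity), integral_const_mul, integral_gaussian_Ioi]
  refine ENNReal.ofReal_le_ofReal (le_of_eq ?_)
  rw [div_div_eq_mul_div, div_one, Real.sqrt_mul Real.pi_pos.le, Real.sqrt_sq hb.le]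
  ring

theorem SubGaussianDerivatives.lintegral_lipSum_le (hD : SubGaussianDerivatives P f a b)
    (hf : Measurable f) :
    ∫⁻ ω, lipSum (f ω) ∂P ≤ ENNReal.ofReal (d * a * b * √Real.pi / 2) := by
  have hm : ∀ i, Measurable fun ω => coordLip i (f ω) := fun i => (measurable_coordLip i).comp hf
  simp only [lipSum]
  rw [lintegral_finsetSum _ fun i _ => hm i]
  refine (Finset.sum_le_sum fun i _ => hD.lintegral_coordLip_le hf i).trans_eq ?_
  rw [Finset.sum_const, Finset.card_univ, Fintype.card_fin, nsmul_eq_mul,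
    ← ENNReal.ofReal_natCast, ← ENNReal.ofReal_mul (by positivity)]
  congr 1
  ring

end Lipschitz

/-! ### Excess over the upper confidence bound, by discretisation. -/

section Discretisation

-- Exponential moments: u ≤ exp(ru - 1)/r for every r > 0. The choice r = s/√v gives the stated
-- exponent and a prefactor √v/s ≤ 1, which is where s ≥ 1 and v ≤ 1 are spent.
open Real in
theorem lintegral_gaussianReal_excess_le (μ : ℝ) {v : NNReal} (hv : v ≤ 1) {s : ℝ} (hs : 1 ≤ s) :
    ∫⁻ z, ENNReal.ofReal (z - μ - s * √v) ∂(gaussianReal μ v) ≤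
      ENNReal.ofReal (exp (-1 - s ^ 2 / 2)) := by
  have key : ∀ r : ℝ, 0 < r → ∫⁻ z, ENNReal.ofReal (z - μ - s * √v) ∂(gaussianReal μ v) ≤
      ENNReal.ofReal (exp (-1 - r * s * √v + v * r ^ 2 / 2) / r) := by
    intro r hr
    have h1 : ∀ z : ℝ, z - μ - s * √v ≤ exp (-1 - r * μ - r * s * √v) / r * exp (r * z) := by
      intro z
      have := add_one_le_exp (r * (z - μ - s * √v) - 1)
      rw [div_mul_eq_mul_div, ← exp_add, le_div_iff₀ hr]
      have e : -1 - r * μ - r * s * √v + r * z = r * (z - μ - s * √v) - 1 := by ring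
      rw [e]
      linarith
    have hint : Integrable (fun z => exp (-1 - r * μ - r * s * √v) / r * exp (r * z))
      (gaussianReal μ v) := (integrable_exp_mul_gaussianReal r).const_mul _
    refine (lintegral_mono fun z => ENNReal.ofReal_le_ofReal (h1 z)).trans_eq ?_
    rw [← ofReal_integral_eq_lintegral_ofReal hint (Filter.Eventually.of_forall fun z => by positivity),
      integral_const_mul]
    have hmgf := mgf_gaussianReal (p := gaussianReal μ v) (X := id) Measure.map_id r
    simp only [mgf, id_eq] at hmgf
    rw [hmgf, div_mul_eq_mul_div, ← exp_add]
    congr 3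
    ring
  rcases eq_or_ne v 0 with rfl | hv0
  -- For v = 0 the bound is exp(-1)/r for every r; this r reproduces the common form.
  · refine (key (exp (s ^ 2 / 2)) (exp_pos _)).trans_eq ?_
    rw [← exp_sub]
    simp
  · have hσ : 0 < √(v : ℝ) := sqrt_pos.2 (by positivity)
    have hσ1 : √(v : ℝ) ≤ 1 := by rw [sqrt_le_one]; exact_mod_cast hv
    refine (key (s / √v) (by positivity)).trans (ENNReal.ofReal_le_ofReal ?_)
    have hsq : √(v : ℝ) ^ 2 = v := sq_sqrt v.2
    have e : -1 - s / √v * s * √v + v * (s / √v) ^ 2 / 2 = -1 - s ^ 2 / 2 := by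
      rw [div_pow, hsq]
      have : (v : ℝ) ≠ 0 := by exact_mod_cast hv0
      field_simp
      ring
    rw [e]
    refine div_le_self (exp_pos _).le ?_
    rw [le_div_iff₀ hσ]
    linarith

variable {d : ℕ}

/-- Grid cells of side `1/K`, with a minimiser of `φ` on each of them. -/
theorem exists_cellMinimiser {φ : Cube d → ℝ} (hφ : Continuous φ) {K : ℕ} (hK : 0 < K) :
    ∃ p : (Fin d → Fin K) → Cube d, ∀ x, ∃ k, (∀ i, |(x i : ℝ) - p k i| ≤ 1 / K) ∧ φ (p k) ≤ φ x := by
  have hK' : (0 : ℝ) < K := by exact_mod_cast hK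
  let C : (Fin d → Fin K) → Set (Cube d) := fun k =>
    {x | ∀ i, (k i : ℝ) / K ≤ x i ∧ (x i : ℝ) ≤ ((k i : ℝ) + 1) / K}
  have hC : ∀ k, IsCompact (C k) := fun k => by
    refine IsClosed.isCompact ?_
    have : C k = ⋂ i, {x : Cube d | (k i : ℝ) / K ≤ x i ∧ (x i : ℝ) ≤ ((k i : ℝ) + 1) / K} := by
      ext; simp [C]
    rw [this]
    have hx : ∀ i, Continuous fun x : Cube d => (x i : ℝ) := fun i => by fun_prop
    exact isClosed_iInter fun i => IsClosed.inter (isClosed_le continuous_const (hx i))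
      (isClosed_le (hx i) continuous_const)
  -- Membership of `p` is claimed only when the cell has a point, so nonemptiness need not be shown.
  have hex : ∀ k, ∃ p : Cube d, ∀ x ∈ C k, p ∈ C k ∧ φ p ≤ φ x := fun k => by
    rcases (C k).eq_empty_or_nonempty with h | h
    · exact ⟨0, by simp [h]⟩
    · obtain ⟨p, hp, hmin⟩ := (hC k).exists_isMinOn h hφ.continuousOn
      exact ⟨p, fun x hx => ⟨hp, hmin hx⟩⟩
  choose p hp using hex
  refine ⟨p, fun x => ?_⟩
  have hcell : ∀ i, ∃ k : Fin K, (k : ℝ) / K ≤ x i ∧ (x i : ℝ) ≤ ((k : ℝ) + 1) / K := fun i => by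
    have h0 : 0 ≤ (x i : ℝ) := (x i).2.1
    have h1 : (x i : ℝ) ≤ 1 := (x i).2.2
    rcases h1.lt_or_eq with h1 | h1
    · refine ⟨⟨⌊(K : ℝ) * x i⌋₊, (Nat.floor_lt (by positivity)).2 (by nlinarith)⟩, ?_, ?_⟩
      · rw [div_le_iff₀ hK', mul_comm (x i : ℝ)]
        exact Nat.floor_le (by positivity)
      · rw [le_div_iff₀ hK', mul_comm (x i : ℝ)]
        exact (Nat.lt_floor_add_one _).le
    -- At coordinate 1 the floor would be `K`, out of range; the closed last cell contains it.
    · refine ⟨⟨K - 1, by omega⟩, ?_, ?_⟩ <;> rw [h1]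
      · rw [div_le_one hK']
        exact_mod_cast Nat.sub_le K 1
      · rw [le_div_iff₀ hK', one_mul]
        have : K ≤ (K - 1) + 1 := by omega
        exact_mod_cast this
  choose k hk using hcell
  have hpk := hp k x hk
  refine ⟨k, fun i => ?_, hpk.2⟩
  have h1 := hk i
  have h2 := hpk.1 i
  have e : ((k i : ℝ) + 1) / K = (k i : ℝ) / K + 1 / K := add_div _ _ _
  rw [e] at h1 h2
  rw [abs_le]
  constructor <;> linarith [h1.1, h1.2, h2.1, h2.2]

variable {ρ : Measure (SamplePath d)} {μ : Cube d → ℝ} {v : Cube d → Cube d → ℝ}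

theorem IsGPLaw.map_eval (hρ : IsGPLaw ρ μ v) (x : Cube d) :
    ρ.map (fun h => h x) = gaussianReal (μ x) (v x x).toNNReal := by
  rw [(hρ.gaussian.hasGaussianLaw_eval x).map_eq_gaussianReal, hρ.mean x, ← hρ.covariance x x,
    covariance_self (measurable_eval_path x).aemeasurable]

theorem IsGPLaw.integrable_eval (hρ : IsGPLaw ρ μ v) (x : Cube d) :
    Integrable (fun h : SamplePath d => h x) ρ :=
  have := hρ.isProbabilityMeasure
  (hρ.memLp_eval x).integrable (by norm_num)

theorem IsGPLaw.lintegral_excess_le (hρ : IsGPLaw ρ μ v) {x : Cube d} (hx : v x x ≤ 1) {s : ℝ}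
    (hs : 1 ≤ s) (h0 : 0 ≤ v x x) :
    ∫⁻ h, ENNReal.ofReal (h x - μ x - s * √(v x x)) ∂ρ ≤
      ENNReal.ofReal (Real.exp (-1 - s ^ 2 / 2)) := by
  have h1 := lintegral_gaussianReal_excess_le (μ x) (v := (v x x).toNNReal) (by simpa using hx) hs
  rw [← hρ.map_eval x, lintegral_map (by fun_prop) (measurable_eval_path x),
    Real.coe_toNNReal _ h0] at h1
  exact h1

/-- The mean inherits the average Lipschitz constant of the paths, hence the factor 2 in the
discretisation cost. -/
theorem IsGPLaw.ofReal_abs_mean_sub_le (hρ : IsGPLaw ρ μ v) {x x' : Cube d} {r : ℝ}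
    (hr : ∀ i, |(x' i : ℝ) - x i| ≤ r) :
    ENNReal.ofReal |μ x' - μ x| ≤ (∫⁻ h, lipSum h ∂ρ) * ENNReal.ofReal r := by
  rw [← hρ.mean x, ← hρ.mean x', ← integral_sub (hρ.integrable_eval x') (hρ.integrable_eval x),
    ← Real.enorm_eq_ofReal_abs, ← lintegral_mul_const _ measurable_lipSum]
  refine (enorm_integral_le_lintegral_enorm _).trans (lintegral_mono fun h => ?_)
  rw [Real.enorm_eq_ofReal_abs]
  exact ofReal_abs_sub_le h hr

/-- The expected excess of a path over its upper confidence bound, at a maximiser of the path. -/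
theorem IsGPLaw.lintegral_excess_sel_le (hρ : IsGPLaw ρ μ v) (hcont : Continuous fun x => v x x)
    (h0 : ∀ x, 0 ≤ v x x) (h1 : ∀ x, v x x ≤ 1) {s : ℝ} (hs : 1 ≤ s) {K : ℕ} (hK : 0 < K)
    (sel : SamplePath d → Cube d) :
    ∫⁻ h, ENNReal.ofReal (h (sel h) - μ (sel h) - s * √(v (sel h) (sel h))) ∂ρ ≤
      2 * ENNReal.ofReal (1 / K) * ∫⁻ h, lipSum h ∂ρ +
        ENNReal.ofReal ((K : ℝ) ^ d * Real.exp (-1 - s ^ 2 / 2)) := by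
  have := hρ.isProbabilityMeasure
  obtain ⟨p, hp⟩ := exists_cellMinimiser hcont hK
  set r := ENNReal.ofReal (1 / (K : ℝ))
  have hpt : ∀ (h : SamplePath d) (x : Cube d),
      ENNReal.ofReal (h x - μ x - s * √(v x x)) ≤
        lipSum h * r + (∫⁻ h, lipSum h ∂ρ) * r +
          ∑ k, ENNReal.ofReal (h (p k) - μ (p k) - s * √(v (p k) (p k))) := by
    intro h x
    obtain ⟨k, hk, hvk⟩ := hp x
    have hle : h x - μ x - s * √(v x x) ≤ |h x - h (p k)| + |μ x - μ (p k)| +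
        (h (p k) - μ (p k) - s * √(v (p k) (p k))) := by
      have a1 := le_abs_self (h x - h (p k))
      have a2 := neg_abs_le (μ x - μ (p k))
      -- The representative minimises the variance on its cell, so moving to it can only lower the
      -- confidence width.
      have a3 := mul_le_mul_of_nonneg_left (Real.sqrt_le_sqrt hvk) (by linarith : 0 ≤ s)
      linarith
    refine (ENNReal.ofReal_le_ofReal hle).trans (ENNReal.ofReal_add_le.trans (add_le_add ?_ ?_))
    · exact ENNReal.ofReal_add_le.trans
        (add_le_add (ofReal_abs_sub_le h hk) (hρ.ofReal_abs_mean_sub_le hk))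
    · exact Finset.single_le_sum
        (f := fun k => ENNReal.ofReal (h (p k) - μ (p k) - s * √(v (p k) (p k))))
        (fun _ _ => zero_le) (Finset.mem_univ k)
  have hm : ∀ k, Measurable fun h : SamplePath d =>
      ENNReal.ofReal (h (p k) - μ (p k) - s * √(v (p k) (p k))) := fun k =>
    (((measurable_eval_path (p k)).sub_const _).sub_const _).ennreal_ofReal
  refine (lintegral_mono fun h => hpt h (sel h)).trans ?_
  rw [lintegral_add_left ((measurable_lipSum.mul_const r).add_const _),
    lintegral_add_left (measurable_lipSum.mul_const r), lintegral_mul_const _ measurable_lipSum,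
    lintegral_const, measure_univ, mul_one, lintegral_finsetSum _ fun k _ => hm k]
  refine add_le_add (le_of_eq (by ring)) ?_
  refine (Finset.sum_le_sum fun k _ => hρ.lintegral_excess_le (h1 (p k)) hs (h0 (p k))).trans_eq ?_
  rw [Finset.sum_const, Finset.card_univ, Fintype.card_fun, Fintype.card_fin, Fintype.card_fin,
    nsmul_eq_mul, ENNReal.ofReal_mul (by positivity), Nat.cast_pow, ENNReal.ofReal_pow (by positivity),
    ENNReal.ofReal_natCast]

/-- The regret of a maximiser of an independent copy of the path. -/
theorem IsGPLaw.lintegral_lintegral_regret_le (hρ : IsGPLaw ρ μ v)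
    (hcont : Continuous fun x => v x x)
    (h0 : ∀ x, 0 ≤ v x x) (h1 : ∀ x, v x x ≤ 1) {s : ℝ} (hs : 1 ≤ s) {K : ℕ} (hK : 0 < K)
    {sel : SamplePath d → Cube d} (hsel : Measurable sel) (hmax : ∀ (h : SamplePath d) x, h x ≤ h (sel h)) :
    ∫⁻ u, ∫⁻ h, ENNReal.ofReal (h (sel h) - h (sel u)) ∂ρ ∂ρ ≤
      2 * ENNReal.ofReal (1 / K) * ∫⁻ h, lipSum h ∂ρ +
        ENNReal.ofReal ((K : ℝ) ^ d * Real.exp (-1 - s ^ 2 / 2)) +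
        ∫⁻ h, ENNReal.ofReal (s * √(v (sel h) (sel h))) ∂ρ := by
  have := hρ.isProbabilityMeasure
  by_cases htop : ∫⁻ h, lipSum h ∂ρ = ∞
  · have : 2 * ENNReal.ofReal (1 / K) ≠ 0 := by simp [hK]
    rw [htop, ENNReal.mul_top this]
    simp
  have hLint : Integrable (fun h => (lipSum h).toReal) ρ :=
    integrable_toReal_of_lintegral_ne_top measurable_lipSum.aemeasurable htop
  have hLfin : ∀ᵐ h ∂ρ, lipSum h < ∞ := ae_lt_top measurable_lipSum htop
  set o : Cube d := 0
  have hB : Integrable (fun h : SamplePath d => |h o| + (lipSum h).toReal) ρ :=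
    (hρ.integrable_eval o).abs.add hLint
  have hbound : ∀ᵐ h ∂ρ, ∀ x, ‖h x‖ ≤ |h o| + (lipSum h).toReal := by
    filter_upwards [hLfin] with h hh x
    have h2 := ofReal_abs_sub_le_lipSum h o x
    have h3 := (ENNReal.ofReal_le_iff_le_toReal hh.ne).1 h2
    rw [Real.norm_eq_abs]
    have h4 := abs_sub_abs_le_abs_sub (h x) (h o)
    linarith
  have hm1 : Measurable fun h : SamplePath d => h (sel h) :=
    measurable_eval.comp (measurable_id.prodMk hsel)
  have hi1 : Integrable (fun h : SamplePath d => h (sel h)) ρ :=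
    hB.mono' hm1.aestronglyMeasurable (hbound.mono fun h hh => hh _)
  have hm2 : Measurable fun q : SamplePath d × SamplePath d => q.2 (sel q.1) :=
    measurable_eval.comp (measurable_snd.prodMk (hsel.comp measurable_fst))
  have hi2 : Integrable (fun q : SamplePath d × SamplePath d => q.2 (sel q.1)) (ρ.prod ρ) := by
    refine Integrable.mono' (hB.comp_snd ρ) hm2.aestronglyMeasurable ?_
    filter_upwards [Measure.quasiMeasurePreserving_snd.ae hbound] with q hq
    exact hq _
  have hi3 : Integrable (fun q : SamplePath d × SamplePath d => q.2 (sel q.2)) (ρ.prod ρ) :=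
    hi1.comp_snd ρ
  have hi4 : Integrable (fun u => μ (sel u)) ρ := by
    have := hi2.integral_prod_left
    simpa only [hρ.mean] using this
  -- Averaging `h` at the independent query `sel u` leaves the mean at `sel u`, and `u` has the law
  -- of `h`: the Thompson sampling identity.
  have e1 : ∫⁻ u, ∫⁻ h, ENNReal.ofReal (h (sel h) - h (sel u)) ∂ρ ∂ρ =
      ENNReal.ofReal (∫ h, (h (sel h) - μ (sel h)) ∂ρ) := by
    have hm3 : Measurable fun q : SamplePath d × SamplePath d => q.2 (sel q.2) :=
      hm1.comp measurable_snd
    rw [← lintegral_prod (fun q : SamplePath d × SamplePath d =>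
      ENNReal.ofReal (q.2 (sel q.2) - q.2 (sel q.1)))
      (hm3.sub hm2).ennreal_ofReal.aemeasurable,
      ← ofReal_integral_eq_lintegral_ofReal (f := fun q : SamplePath d × SamplePath d =>
        q.2 (sel q.2) - q.2 (sel q.1)) (hi3.sub hi2)
        (Filter.Eventually.of_forall fun q => sub_nonneg.2 (hmax _ _)),
      integral_sub hi3 hi2, integral_prod _ hi2, integral_prod _ hi3, integral_sub hi1 hi4]
    simp only [hρ.mean, integral_const, probReal_univ, one_smul]
  rw [e1]
  have e2 : ENNReal.ofReal (∫ h, (h (sel h) - μ (sel h)) ∂ρ) ≤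
      ∫⁻ h, ENNReal.ofReal (h (sel h) - μ (sel h)) ∂ρ := by
    rw [integral_eq_lintegral_pos_part_sub_lintegral_neg_part
      (f := fun h : SamplePath d => h (sel h) - μ (sel h)) (hi1.sub hi4)]
    refine (ENNReal.ofReal_le_ofReal (sub_le_self _ ENNReal.toReal_nonneg)).trans
      ENNReal.ofReal_toReal_le
  refine e2.trans ?_
  have hm4 : Measurable fun h => ENNReal.ofReal (s * √(v (sel h) (sel h))) := by
    have : Measurable fun h => v (sel h) (sel h) := hcont.measurable.comp hsel
    exact (this.sqrt.const_mul s).ennreal_ofReal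
  refine le_trans (lintegral_mono fun h => ?_) ((lintegral_add_right _ hm4).trans_le
    (add_le_add_left (hρ.lintegral_excess_sel_le hcont h0 h1 hs hK sel) _))
  refine le_trans (le_of_eq ?_) ENNReal.ofReal_add_le
  congr 1
  ring

end Discretisation

/-! ### Expected regret of one completed job. -/

section Regret

variable {Ω : Type*} [MeasurableSpace Ω] {P : Measure Ω} {d : ℕ} {κ : Cube d → Cube d → ℝ} {η : ℝ}
  {Q : ∀ m, Kernel ((Fin m → Cube d) × (Fin m → ℝ)) (SamplePath d)}
  {mode : ParallelMode} {M : ℕ} {sel : SamplePath d → Cube d} {f : Ω → SamplePath d}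
  {c : Ω → ℕ → ℕ} {ε : ℕ → Ω → ℝ} {g : ℕ → Ω → SamplePath d}

theorem IsPosteriorKernel.posteriorCov_le_one (hQ : IsPosteriorKernel κ η Q) (hη : 0 < η)
    {ν : Measure (SamplePath d)} (hν : IsGPLaw ν (fun _ => 0) κ) (hκ1 : ∀ x x', κ x x' ≤ 1) {m : ℕ}
    (A : Fin m → Cube d) (x : Cube d) : posteriorCov κ η A x x ≤ 1 :=
  (hQ.posteriorCov_le hη hν.isPSDKernel A x).trans (hκ1 x x)

/-- Posterior standard deviation at the query point of job `j`, given the evaluations available to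
it when the completion order is `c₀`. -/
noncomputable def querySd (mode : ParallelMode) (M : ℕ) (κ : Cube d → Cube d → ℝ) (η : ℝ)
    (sel : SamplePath d → Cube d) (g : ℕ → Ω → SamplePath d) (c₀ : ℕ → ℕ) (j : ℕ) (ω : Ω) : ℝ :=
  √(posteriorCov κ η (fun l : Fin (numCompleted mode M j) => sel (g (c₀ l) ω))
    (sel (g j ω)) (sel (g j ω)))

/-- Regret of one completed job on the event that the completion order is `c₀`. -/
theorem IsParallelTS.setLIntegral_regret_le [IsProbabilityMeasure P]
    (hTS : IsParallelTS P mode M κ η sel f c ε g) (hQ : IsPosteriorKernel κ η Q) (hη : 0 < η)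
    (hν : IsGPLaw (P.map f) (fun _ => 0) κ) (hκ1 : ∀ x x', κ x x' ≤ 1)
    {c₀ : ℕ → ℕ} (hc : IsCompletionOrder mode M c₀)
    {n i : ℕ} (hi : i < n) {s : ℝ} (hs : 1 ≤ s) {K : ℕ} (hK : 0 < K) :
    ∫⁻ ω in orderEvent c c₀ n, ENNReal.ofReal (f ω (sel (f ω)) - f ω (sel (g (c₀ i) ω))) ∂P ≤
      2 * ENNReal.ofReal (1 / K) * ∫⁻ ω in orderEvent c c₀ n, lipSum (f ω) ∂P +
        ENNReal.ofReal ((K : ℝ) ^ d * Real.exp (-1 - s ^ 2 / 2)) * P (orderEvent c c₀ n) +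
        ∫⁻ ω in orderEvent c c₀ n,
          ENNReal.ofReal (s * querySd mode M κ η sel g c₀ (c₀ i) ω) ∂P := by
  obtain ⟨j, hj⟩ : ∃ j, c₀ i = j := ⟨_, rfl⟩
  rw [hj]
  have hsel := hTS.measurable_sel
  set E := orderEvent c c₀ n
  set m := numCompleted mode M j with hm
  set D : Ω → (Fin m → Cube d) × (Fin m → ℝ) := jobData sel f ε g (fun l => c₀ l) with hD
  have := hQ.isMarkovKernel m
  have post : ∀ {Φ : ((Fin m → Cube d) × (Fin m → ℝ)) × SamplePath d → ℝ≥0∞}, Measurable Φ →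
      ∫⁻ ω in E, Φ (D ω, f ω) ∂P = ∫⁻ ω in E, ∫⁻ h, Φ (D ω, h) ∂(Q m (D ω)) ∂P := fun hΦ =>
    hTS.setLIntegral_jobData hQ hη hν hc (fun _ _ h => Fin.ext (hc.1 h))
      (by have := hc.isClosedJobList hi; rwa [hj] at this) hΦ
  have hmE : Measurable fun q : ((((Fin m → Cube d) × (Fin m → ℝ)) × SamplePath d) × SamplePath d) =>
      ENNReal.ofReal (q.1.2 (sel q.1.2) - q.1.2 (sel q.2)) := by
    have h1 : Measurable fun q : ((((Fin m → Cube d) × (Fin m → ℝ)) × SamplePath d) ×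
        SamplePath d) => q.1.2 (sel q.1.2) :=
      measurable_eval.comp ((measurable_snd.comp measurable_fst).prodMk
        (hsel.comp (measurable_snd.comp measurable_fst)))
    have h2 : Measurable fun q : ((((Fin m → Cube d) × (Fin m → ℝ)) × SamplePath d) ×
        SamplePath d) => q.1.2 (sel q.2) :=
      measurable_eval.comp ((measurable_snd.comp measurable_fst).prodMk (hsel.comp measurable_snd))
    exact (h1.sub h2).ennreal_ofReal
  -- First the sample, given data and function, becomes a posterior draw; then the function, given
  -- the data, becomes another. The result is two independent draws from one law.
  have step1 := hTS.setLIntegral_sample hQ hc hi hj hmE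
  have hmE2 : Measurable fun q : ((Fin m → Cube d) × (Fin m → ℝ)) × SamplePath d =>
      ∫⁻ u, ENNReal.ofReal (q.2 (sel q.2) - q.2 (sel u)) ∂(Q m q.1) :=
    hQ.measurable_lintegral measurable_fst hmE
  have step2 := post hmE2
  have hsd : Measurable fun q : ((((Fin m → Cube d) × (Fin m → ℝ)) × SamplePath d) × SamplePath d) =>
      ENNReal.ofReal (s * √(posteriorCov κ η q.1.1.1 (sel q.2) (sel q.2))) := by
    have h1 : Measurable fun q : ((((Fin m → Cube d) × (Fin m → ℝ)) × SamplePath d) ×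
        SamplePath d) => posteriorCov κ η q.1.1.1 (sel q.2) (sel q.2) :=
      (hν.continuous_posteriorCov hη m).measurable.comp
        ((measurable_fst.comp (measurable_fst.comp measurable_fst)).prodMk
          ((hsel.comp measurable_snd).prodMk (hsel.comp measurable_snd)))
    exact (h1.sqrt.const_mul s).ennreal_ofReal
  -- `step3` and `step4` are read backwards at the end, turning posterior averages into expectations
  -- over the actual query and the actual function.
  have step3 := hTS.setLIntegral_sample hQ hc hi hj hsd
  have step4 := post (Φ := fun q => lipSum q.2) (measurable_lipSum.comp measurable_snd)
  have hmD : Measurable D := hTS.measurable_jobData _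
  have hmL : Measurable fun ω => ∫⁻ h, lipSum h ∂(Q m (D ω)) :=
    hQ.measurable_lintegral hmD (measurable_lipSum.comp measurable_snd)
  calc ∫⁻ ω in E, ENNReal.ofReal (f ω (sel (f ω)) - f ω (sel (g j ω))) ∂P
      = ∫⁻ ω in E, ∫⁻ h, ∫⁻ u, ENNReal.ofReal (h (sel h) - h (sel u)) ∂(Q m (D ω))
          ∂(Q m (D ω)) ∂P := step1.trans step2
    _ = ∫⁻ ω in E, ∫⁻ u, ∫⁻ h, ENNReal.ofReal (h (sel h) - h (sel u)) ∂(Q m (D ω))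
          ∂(Q m (D ω)) ∂P := by
        refine lintegral_congr fun ω => lintegral_lintegral_swap ?_
        have h2 : Measurable fun q : SamplePath d × SamplePath d => ((D ω, q.1), q.2) := by fun_prop
        exact (hmE.comp h2).aemeasurable
    _ ≤ ∫⁻ ω in E, (2 * ENNReal.ofReal (1 / K) * ∫⁻ h, lipSum h ∂(Q m (D ω)) +
        ENNReal.ofReal ((K : ℝ) ^ d * Real.exp (-1 - s ^ 2 / 2)) +
        ∫⁻ h, ENNReal.ofReal (s * √(posteriorCov κ η (D ω).1 (sel h) (sel h))) ∂(Q m (D ω))) ∂P := by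
        refine lintegral_mono fun ω => ?_
        have hcont : Continuous fun x => posteriorCov κ η (D ω).1 x x :=
          (hν.continuous_posteriorCov hη m).comp (by fun_prop :
            Continuous fun x : Cube d => ((D ω).1, x, x))
        exact (hQ.law m (D ω)).lintegral_lintegral_regret_le hcont
          (hQ.posteriorCov_nonneg _) (hQ.posteriorCov_le_one hη hν hκ1 _) hs hK hsel hTS.sel_isMax
    _ = _ := by
        rw [lintegral_add_left ((hmL.const_mul _).add_const _), lintegral_add_left (hmL.const_mul _),
          lintegral_const_mul _ hmL, lintegral_const, Measure.restrict_apply_univ]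
        exact congrArg₂ _ (congrArg₂ _ (congrArg _ step4.symm) rfl) step3.symm

end Regret

/-! ### From single jobs to the simple regret. -/

section SimpleRegret

variable {Ω : Type*} [MeasurableSpace Ω] {P : Measure Ω} {d : ℕ} {κ : Cube d → Cube d → ℝ} {η : ℝ}
  {mode : ParallelMode} {M : ℕ} {sel : SamplePath d → Cube d} {f : Ω → SamplePath d}
  {c : Ω → ℕ → ℕ} {ε : ℕ → Ω → ℝ} {g : ℕ → Ω → SamplePath d}

theorem iSup_eq_eval_of_isMax {h : SamplePath d} {x : Cube d} (hx : ∀ x', h x' ≤ h x) :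
    ⨆ x', h x' = h x :=
  le_antisymm (ciSup_le hx) (le_ciSup ⟨h x, by rintro _ ⟨x', rfl⟩; exact hx x'⟩ x)

theorem IsParallelTS.simpleRegret_eq [IsFiniteMeasure P]
    (hTS : IsParallelTS P mode M κ η sel f c ε g) (n : ℕ) (ω : Ω) :
    simpleRegret sel f c g n ω =
      f ω (sel (f ω)) - ⨆ i : Fin n, f ω (sel (g (c ω i) ω)) := by
  rw [simpleRegret, iSup_eq_eval_of_isMax (hTS.sel_isMax (f ω))]

theorem IsParallelTS.simpleRegret_le [IsFiniteMeasure P]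
    (hTS : IsParallelTS P mode M κ η sel f c ε g) {n : ℕ} (ω : Ω) (i : Fin n) :
    simpleRegret sel f c g n ω ≤ f ω (sel (f ω)) - f ω (sel (g (c ω i) ω)) := by
  rw [hTS.simpleRegret_eq]
  have := le_ciSup (Set.finite_range fun i : Fin n => f ω (sel (g (c ω i) ω))).bddAbove i
  linarith

theorem IsParallelTS.simpleRegret_nonneg [IsFiniteMeasure P]
    (hTS : IsParallelTS P mode M κ η sel f c ε g) {n : ℕ} (hn : 1 ≤ n) (ω : Ω) :
    0 ≤ simpleRegret sel f c g n ω := by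
  rw [hTS.simpleRegret_eq, sub_nonneg]
  have : Nonempty (Fin n) := ⟨⟨0, hn⟩⟩
  exact ciSup_le fun i => hTS.sel_isMax _ _

theorem IsParallelTS.measurable_simpleRegret [IsFiniteMeasure P]
    (hTS : IsParallelTS P mode M κ η sel f c ε g) (n : ℕ) :
    Measurable (simpleRegret sel f c g n) := by
  have h0 : simpleRegret sel f c g n = fun ω => f ω (sel (f ω)) -
      ⨆ i : Fin n, f ω (sel (g (c ω i) ω)) := funext fun ω => hTS.simpleRegret_eq n ω
  rw [h0]
  have hg : Measurable fun q : ℕ × Ω => g q.1 q.2 :=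
    measurable_from_prod_countable_right fun k => hTS.measurable_sample k
  have hx : ∀ i : ℕ, Measurable fun ω => f ω (sel (g (c ω i) ω)) := fun i => by
    have h1 : Measurable fun ω => (c ω i, ω) :=
      ((measurable_pi_apply i).comp hTS.measurable_c).prodMk measurable_id
    exact measurable_eval.comp (hTS.measurable_f.prodMk (hTS.measurable_sel.comp (hg.comp h1)))
  exact (measurable_eval.comp (hTS.measurable_f.prodMk
    (hTS.measurable_sel.comp hTS.measurable_f))).sub (Measurable.iSup fun i : Fin n => hx i)

/-- A crude bound across the whole cube; it gives integrability and settles the case of small n² d a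
b √π. -/
theorem IsParallelTS.ofReal_simpleRegret_le_lipSum [IsFiniteMeasure P]
    (hTS : IsParallelTS P mode M κ η sel f c ε g) {n : ℕ} (hn : 1 ≤ n) (ω : Ω) :
    ENNReal.ofReal (simpleRegret sel f c g n ω) ≤ lipSum (f ω) :=
  (ENNReal.ofReal_le_ofReal ((hTS.simpleRegret_le ω ⟨0, hn⟩).trans (le_abs_self _))).trans
    (ofReal_abs_sub_le_lipSum _ _ _)

variable {Q : ∀ m, Kernel ((Fin m → Cube d) × (Fin m → ℝ)) (SamplePath d)}

/-- Cauchy–Schwarz on the inflated variance sum. The bound holds for each outcome, because posterior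
variances depend only on the queries. -/
theorem IsPosteriorKernel.sum_querySd_le {Ω' : Type*} {g : ℕ → Ω' → SamplePath d} (hQ : IsPosteriorKernel κ η Q)
    (hη : 0 < η) {ν : Measure (SamplePath d)} (hν : IsGPLaw ν (fun _ => 0) κ) [IsFiniteMeasure ν]
    (hκ1 : ∀ x x', κ x x' ≤ 1) (hM : 1 ≤ M) {ξ : ℝ} (hξ : IsInflationBound ν η M ξ)
    {c₀ : ℕ → ℕ} (hc : IsCompletionOrder mode M c₀) (n : ℕ) (ω : Ω') :
    ∑ i : Fin n, querySd mode M κ η sel g c₀ (c₀ i) ω ≤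
      √(n * (ξ * (2 / Real.log (1 + (η ^ 2)⁻¹)) * maxInfoGain ν η n)) := by
  refine Real.le_sqrt_of_sq_le ?_
  have h1 := sq_sum_le_card_mul_sum_sq (s := Finset.univ)
    (f := fun i : Fin n => querySd mode M κ η sel g c₀ (c₀ i) ω)
  rw [Finset.card_univ, Fintype.card_fin] at h1
  refine h1.trans (mul_le_mul_of_nonneg_left ?_ n.cast_nonneg)
  refine le_trans (le_of_eq (Finset.sum_congr rfl fun i _ => ?_))
    (hQ.sum_posteriorCov_le hη hν hκ1 hM hξ hc (fun j => sel (g j ω)) n)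
  exact Real.sq_sqrt (hQ.posteriorCov_nonneg _ _)

/-- The expected simple regret on the event that the completion order is `c₀`. -/
theorem IsParallelTS.setLIntegral_simpleRegret_le [IsProbabilityMeasure P]
    (hTS : IsParallelTS P mode M κ η sel f c ε g) (hQ : IsPosteriorKernel κ η Q) (hη : 0 < η)
    (hν : IsGPLaw (P.map f) (fun _ => 0) κ) (hκ1 : ∀ x x', κ x x' ≤ 1) (hM : 1 ≤ M) {ξ : ℝ}
    (hξ : IsInflationBound (P.map f) η M ξ)
    {c₀ : ℕ → ℕ} (hc : IsCompletionOrder mode M c₀)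
    {n : ℕ} (hn : 1 ≤ n) {s : ℝ} (hs : 1 ≤ s) {K : ℕ} (hK : 0 < K) :
    ∫⁻ ω in orderEvent c c₀ n, ENNReal.ofReal (simpleRegret sel f c g n ω) ∂P ≤
      ∫⁻ ω in orderEvent c c₀ n, (2 * ENNReal.ofReal (1 / K) * lipSum (f ω) +
        (ENNReal.ofReal ((K : ℝ) ^ d * Real.exp (-1 - s ^ 2 / 2)) +
          ENNReal.ofReal (s * √((ξ * (2 / Real.log (1 + (η ^ 2)⁻¹)) *
            maxInfoGain (P.map f) η n) / n)))) ∂P := by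
  set E := orderEvent c c₀ n
  set V := ξ * (2 / Real.log (1 + (η ^ 2)⁻¹)) * maxInfoGain (P.map f) η n
  have hn' : (0 : ℝ) < n := by exact_mod_cast hn
  have hE : MeasurableSet E := hTS.measurableSet_orderEvent c₀ n
  have hL : Measurable fun ω => lipSum (f ω) := measurable_lipSum.comp hTS.measurable_f
  have hsel := hTS.measurable_sel
  have hterm : ∀ i : Fin n, Measurable fun ω => ENNReal.ofReal
      (f ω (sel (f ω)) - f ω (sel (g (c₀ i) ω))) := fun i => by
    refine Measurable.ennreal_ofReal (Measurable.sub ?_ ?_)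
    · exact measurable_eval.comp (hTS.measurable_f.prodMk (hsel.comp hTS.measurable_f))
    · exact measurable_eval.comp (hTS.measurable_f.prodMk (hsel.comp (hTS.measurable_sample _)))
  have hsd : ∀ i : Fin n, Measurable fun ω =>
      ENNReal.ofReal (s * querySd mode M κ η sel g c₀ (c₀ i) ω) := fun i => by
    have hx : ∀ j, Measurable fun ω => sel (g j ω) := fun j => hsel.comp (hTS.measurable_sample j)
    have h2 := ((measurable_pi_lambda _ fun l : Fin (numCompleted mode M (c₀ i)) => hx (c₀ l)).prodMk
      ((hx (c₀ i)).prodMk (hx (c₀ i))))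
    exact ((((hν.continuous_posteriorCov hη _).measurable.comp h2).sqrt).const_mul s).ennreal_ofReal
  -- The simple regret is at most each individual regret, so n copies of it are at most their sum.
  have h1 : (n : ℝ≥0∞) * ∫⁻ ω in E, ENNReal.ofReal (simpleRegret sel f c g n ω) ∂P ≤
      ∑ i : Fin n, ∫⁻ ω in E, ENNReal.ofReal (f ω (sel (f ω)) - f ω (sel (g (c₀ i) ω))) ∂P := by
    rw [← lintegral_finsetSum _ fun i _ => hterm i,
      ← lintegral_const_mul _ (hTS.measurable_simpleRegret n).ennreal_ofReal]
    refine setLIntegral_mono' hE fun ω hω => ?_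
    have h2 : ∀ i ∈ (Finset.univ : Finset (Fin n)), ENNReal.ofReal (simpleRegret sel f c g n ω) ≤
        ENNReal.ofReal (f ω (sel (f ω)) - f ω (sel (g (c₀ i) ω))) := fun i _ => by
      rw [← hω i i.2]
      exact ENNReal.ofReal_le_ofReal (hTS.simpleRegret_le ω i)
    simpa using Finset.card_nsmul_le_sum _ _ _ h2
  have h3 : ∑ i : Fin n, ∫⁻ ω in E, ENNReal.ofReal
      (s * querySd mode M κ η sel g c₀ (c₀ i) ω) ∂P ≤
      n * (ENNReal.ofReal (s * √(V / n)) * P E) := by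
    rw [← lintegral_finsetSum _ fun i _ => hsd i]
    have h4 : ∀ ω, ∑ i : Fin n, ENNReal.ofReal (s * querySd mode M κ η sel g c₀ (c₀ i) ω) ≤
        n * ENNReal.ofReal (s * √(V / n)) := fun ω => by
      have h0 : ∀ i ∈ (Finset.univ : Finset (Fin n)),
          0 ≤ s * querySd mode M κ η sel g c₀ (c₀ i) ω := fun i _ =>
        mul_nonneg (by linarith) (Real.sqrt_nonneg _)
      rw [← ENNReal.ofReal_sum_of_nonneg h0, ← Finset.mul_sum, ← ENNReal.ofReal_natCast,
        ← ENNReal.ofReal_mul n.cast_nonneg]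
      refine ENNReal.ofReal_le_ofReal ?_
      have := hTS.measurable_f
      have : IsProbabilityMeasure (P.map f) := hν.isProbabilityMeasure
      refine (mul_le_mul_of_nonneg_left (hQ.sum_querySd_le (sel := sel) (g := g) hη hν hκ1 hM hξ hc n ω)
        (by linarith : 0 ≤ s)).trans_eq ?_
      have e : (n : ℝ) * V = n ^ 2 * (V / n) := by field_simp
      rw [e, Real.sqrt_mul (by positivity), Real.sqrt_sq hn'.le]
      ring
    refine (lintegral_mono h4).trans_eq ?_
    rw [lintegral_const, Measure.restrict_apply_univ, mul_assoc]
  have hn0 : (n : ℝ≥0∞) ≠ 0 := by exact_mod_cast hn'.ne'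
  rw [← ENNReal.mul_le_mul_iff_right hn0 (ENNReal.natCast_ne_top n)]
  refine h1.trans ((Finset.sum_le_sum fun i _ =>
    hTS.setLIntegral_regret_le hQ hη hν hκ1 hc i.2 hs hK).trans ?_)
  rw [Finset.sum_add_distrib, Finset.sum_const, Finset.card_univ, Fintype.card_fin, nsmul_eq_mul,
    lintegral_add_left (hL.const_mul _), lintegral_const_mul _ hL, lintegral_const,
    Measure.restrict_apply_univ]
  refine (add_le_add_right h3 _).trans_eq ?_
  ring

/-- Prefixes of length n form a countable type, so their events partition the space. Only nonempty
events matter, so `c₀` may be taken to be an order `c ω₀` that actually occurs. -/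
theorem lintegral_le_of_prefix (hc : Measurable c) (n : ℕ) {F G : Ω → ℝ≥0∞}
    (h : ∀ ω₀, ∫⁻ ω in orderEvent c (c ω₀) n, F ω ∂P ≤ ∫⁻ ω in orderEvent c (c ω₀) n, G ω ∂P) :
    ∫⁻ ω, F ω ∂P ≤ ∫⁻ ω, G ω ∂P := by
  let p : Ω → Fin n → ℕ := fun ω i => c ω i
  have hp : Measurable p := measurable_pi_lambda _ fun i => (measurable_pi_apply (i : ℕ)).comp hc
  have hm : ∀ v, MeasurableSet (p ⁻¹' {v}) := fun v => hp (measurableSet_singleton v)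
  have hd : Pairwise (Function.onFun Disjoint fun v => p ⁻¹' {v}) := fun v w hvw =>
    Disjoint.preimage _ (by simpa using hvw)
  have hU : ⋃ v, p ⁻¹' {v} = Set.univ := by ext ω; simp
  rw [← setLIntegral_univ, ← hU, lintegral_iUnion hm hd, ← setLIntegral_univ (f := G), ← hU,
    lintegral_iUnion hm hd]
  refine ENNReal.tsum_le_tsum fun v => ?_
  rcases (p ⁻¹' {v}).eq_empty_or_nonempty with he | ⟨ω₀, h0⟩
  · simp [he]
  · have e : p ⁻¹' {v} = orderEvent c (c ω₀) n := by
      ext ω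
      rw [Set.mem_preimage, Set.mem_singleton_iff, ← (h0 : p ω₀ = v)]
      exact ⟨fun h i hi => congrFun h ⟨i, hi⟩, fun h => funext fun i => h i i.2⟩
    rw [e]
    exact h ω₀

theorem IsParallelTS.lintegral_simpleRegret_le [IsProbabilityMeasure P]
    (hTS : IsParallelTS P mode M κ η sel f c ε g) (hη : 0 < η)
    (hν : IsGPLaw (P.map f) (fun _ => 0) κ) (hκ1 : ∀ x x', κ x x' ≤ 1) (hM : 1 ≤ M) {ξ : ℝ}
    (hξ : IsInflationBound (P.map f) η M ξ)
    {n : ℕ} (hn : 1 ≤ n) {s : ℝ} (hs : 1 ≤ s) {K : ℕ} (hK : 0 < K) :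
    ∫⁻ ω, ENNReal.ofReal (simpleRegret sel f c g n ω) ∂P ≤
      2 * ENNReal.ofReal (1 / K) * ∫⁻ ω, lipSum (f ω) ∂P +
        (ENNReal.ofReal ((K : ℝ) ^ d * Real.exp (-1 - s ^ 2 / 2)) +
          ENNReal.ofReal (s * √((ξ * (2 / Real.log (1 + (η ^ 2)⁻¹)) *
            maxInfoGain (P.map f) η n) / n))) := by
  obtain ⟨Q, hQ⟩ := hν.exists_isPosteriorKernel hη
  have hL : Measurable fun ω => lipSum (f ω) := measurable_lipSum.comp hTS.measurable_f
  refine (lintegral_le_of_prefix hTS.measurable_c n fun ω₀ =>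
    hTS.setLIntegral_simpleRegret_le hQ hη hν hκ1 hM hξ (hTS.completionOrder ω₀) hn hs hK).trans_eq ?_
  rw [lintegral_add_left (hL.const_mul _), lintegral_const_mul _ hL, lintegral_const, measure_univ,
    mul_one]

theorem IsParallelTS.integrable_simpleRegret [IsProbabilityMeasure P] {a b : ℝ}
    (hTS : IsParallelTS P mode M κ η sel f c ε g) (hD : SubGaussianDerivatives P f a b)
    {n : ℕ} (hn : 1 ≤ n) : Integrable (simpleRegret sel f c g n) P := by
  refine ⟨(hTS.measurable_simpleRegret n).aestronglyMeasurable, ?_⟩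
  rw [hasFiniteIntegral_iff_ofReal (Filter.Eventually.of_forall (hTS.simpleRegret_nonneg hn))]
  exact (lintegral_mono (hTS.ofReal_simpleRegret_le_lipSum hn)).trans_lt
    ((hD.lintegral_lipSum_le hTS.measurable_f).trans_lt ENNReal.ofReal_lt_top)

theorem IsParallelTS.integral_simpleRegret_le [IsProbabilityMeasure P]
    (hTS : IsParallelTS P mode M κ η sel f c ε g) {n : ℕ} (hn : 1 ≤ n) {r : ℝ} (hr : 0 ≤ r)
    (h : ∫⁻ ω, ENNReal.ofReal (simpleRegret sel f c g n ω) ∂P ≤ ENNReal.ofReal r) :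
    ∫ ω, simpleRegret sel f c g n ω ∂P ≤ r := by
  rw [integral_eq_lintegral_of_nonneg_ae
    (Filter.Eventually.of_forall (hTS.simpleRegret_nonneg hn))
    (hTS.measurable_simpleRegret n).aestronglyMeasurable]
  exact ENNReal.toReal_le_of_le_ofReal hr h

end SimpleRegret

/-! ### Choice of β_n and of the grid. -/

section Constants

/-- Shows how β_n is tuned: with about τ = n² d a b √π cells per axis, the number of cells times
exp(-β_n/2) is about 1/n². -/
theorem exp_neg_betaSeq {d n : ℕ} {a b : ℝ} (hn : 1 ≤ n)
    (hw : 0 < d * a * b * √Real.pi) :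
    Real.exp (-betaSeq d a b n / 2) =
      1 / ((n : ℝ) ^ 2 * ((n : ℝ) ^ 2 * (d * a * b * √Real.pi)) ^ d) := by
  have hn' : (0 : ℝ) < n := by exact_mod_cast hn
  set w := d * a * b * √Real.pi with hwd
  rw [one_div, eq_comm, ← Real.exp_log (by positivity : 0 < ((n : ℝ) ^ 2 * ((n : ℝ) ^ 2 * w) ^ d)⁻¹),
    Real.log_inv, Real.log_mul (by positivity) (by positivity), Real.log_pow, Real.log_pow,
    Real.log_mul (by positivity) hw.ne', Real.log_pow, betaSeq, ← hwd]
  congr 1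
  push_cast
  ring

/-- β_n = 4 log n + 2d log τ and τ ≥ 3 > e. This permits s = √β_n ≥ 1 in the tail bound. -/
theorem one_le_betaSeq {d n : ℕ} {a b : ℝ} (hn : 1 ≤ n) (hd : 1 ≤ d)
    (hτ : 3 ≤ (n : ℝ) ^ 2 * (d * a * b * √Real.pi)) : 1 ≤ betaSeq d a b n := by
  have hn' : (0 : ℝ) < n := by exact_mod_cast hn
  set w := d * a * b * √Real.pi with hwd
  have hw : 0 < w := by
    by_contra h
    have := mul_nonpos_of_nonneg_of_nonpos (by positivity : 0 ≤ (n : ℝ) ^ 2) (not_lt.1 h)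
    linarith
  have h1 : 1 ≤ Real.log ((n : ℝ) ^ 2 * w) := by
    rw [Real.le_log_iff_exp_le (by positivity)]
    linarith [Real.exp_one_lt_d9]
  have h2 : 0 ≤ Real.log n := Real.log_nonneg (by exact_mod_cast hn)
  have h3 : (1 : ℝ) ≤ d := by exact_mod_cast hd
  have e : betaSeq d a b n = 4 * Real.log n + 2 * d * Real.log ((n : ℝ) ^ 2 * w) := by
    rw [Real.log_mul (by positivity) hw.ne', Real.log_pow, betaSeq, ← hwd]
    push_cast
    ring
  rw [e]
  nlinarith

theorem regretConstant_gt : (1.8 : ℝ) < Real.pi ^ 2 / 6 + √(2 * Real.pi) / 12 := by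
  have h1 := Real.pi_gt_d2
  have h2 : (2.5 : ℝ) < √(2 * Real.pi) := by
    rw [Real.lt_sqrt (by norm_num)]
    linarith
  nlinarith

/-- The discretisation error with `K = ⌊τ⌋` grid cells per axis. -/
theorem discretisation_error_le {d n : ℕ} {a b : ℝ} (hn : 1 ≤ n)
    (hτ : 3 ≤ (n : ℝ) ^ 2 * (d * a * b * √Real.pi)) {K : ℕ}
    (hK : K = ⌊(n : ℝ) ^ 2 * (d * a * b * √Real.pi)⌋₊) :
    2 * (1 / K) * (d * a * b * √Real.pi / 2) +
        (K : ℝ) ^ d * Real.exp (-1 - betaSeq d a b n / 2) ≤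
      (Real.pi ^ 2 / 6 + √(2 * Real.pi) / 12) / n := by
  have hn' : (1 : ℝ) ≤ n := by exact_mod_cast hn
  set w := d * a * b * √Real.pi with hwd
  have hw : 0 < w := by
    by_contra h
    have := mul_nonpos_of_nonneg_of_nonpos (by positivity : 0 ≤ (n : ℝ) ^ 2) (not_lt.1 h)
    linarith
  set τ := (n : ℝ) ^ 2 * w
  have hKτ : (K : ℝ) ≤ τ := hK ▸ Nat.floor_le (by linarith)
  have hK3 : (3 : ℝ) ≤ K := by
    have : 3 ≤ K := hK ▸ Nat.le_floor (by exact_mod_cast hτ)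
    exact_mod_cast this
  have hτK : τ ≤ K + 1 := hK ▸ (Nat.lt_floor_add_one τ).le
  have e1 : 2 * (1 / K) * (w / 2) = τ / K / n ^ 2 := by
    simp only [τ]
    field_simp
  -- From τ ≤ K + 1 and K ≥ 3.
  have h1 : τ / K ≤ 4 / 3 := by
    rw [div_le_div_iff₀ (by linarith) (by norm_num)]
    linarith
  have e2 : (K : ℝ) ^ d * Real.exp (-1 - betaSeq d a b n / 2) =
      Real.exp (-1) * (K / τ) ^ d / n ^ 2 := by
    have : -1 - betaSeq d a b n / 2 = -1 + -betaSeq d a b n / 2 := by ring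
    rw [this, Real.exp_add, exp_neg_betaSeq hn hw, ← hwd, div_pow]
    field_simp
    rfl
  have h2 : (K / τ) ^ d ≤ 1 := pow_le_one₀ (by positivity) (div_le_one_of_le₀ hKτ (by linarith))
  have h3 : Real.exp (-1) ≤ 0.4 := by linarith [Real.exp_neg_one_lt_d9]
  rw [e1, e2, ← add_div]
  -- 4/3 + 0.4 < 1.8 < C₁; the error is in fact of order 1/n².
  have h4 : τ / K + Real.exp (-1) * (K / τ) ^ d ≤ 1.8 := by
    have := mul_le_mul h3 h2 (by positivity) (by norm_num)
    linarith
  have h5 := regretConstant_gt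
  rw [div_le_div_iff₀ (by positivity) (by positivity)]
  have h6 : (n : ℝ) ≤ n ^ 2 := by nlinarith
  calc _ ≤ 1.8 * (n : ℝ) := mul_le_mul_of_nonneg_right h4 (by positivity)
    _ ≤ 1.8 * (n : ℝ) ^ 2 := by linarith
    _ ≤ _ := mul_le_mul_of_nonneg_right h5.le (by positivity)

end Constants

/-! ### The regret bound. -/

theorem mainTheorem1 {Ω : Type*} [MeasurableSpace Ω] (P : Measure Ω) [IsProbabilityMeasure P]
    (d : ℕ) (κ : Cube d → Cube d → ℝ) (a b η : ℝ) (hη : 0 < η)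
    (f : Ω → SamplePath d)
    (hGP : IsGPLaw (P.map f) (fun _ => 0) κ)
    (hderiv : SubGaussianDerivatives P f a b)
    (hκ : ∀ x x', κ x x' ≤ 1)
    (mode : ParallelMode) (M : ℕ) (hM : 1 ≤ M)
    (sel : SamplePath d → Cube d) (c : Ω → ℕ → ℕ) (ε : ℕ → Ω → ℝ) (g : ℕ → Ω → SamplePath d)
    (hTS : IsParallelTS P mode M κ η sel f c ε g)
    (ξ : ℝ) (hξ : IsInflationBound (P.map f) η M ξ)
    (n : ℕ) (hn : 1 ≤ n) :
    Integrable (simpleRegret sel f c g n) P ∧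
      ∫ ω, simpleRegret sel f c g n ω ∂P ≤
        (Real.pi ^ 2 / 6 + √(2 * Real.pi) / 12) / n +
          √(2 / Real.log (1 + (η ^ 2)⁻¹) * ξ * max (betaSeq d a b n) 0 *
            maxInfoGain (P.map f) η n / n) := by
  refine ⟨hTS.integrable_simpleRegret hderiv hn, ?_⟩
  have hn' : (1 : ℝ) ≤ n := by exact_mod_cast hn
  have ha := hderiv.a_pos
  have hb := hderiv.b_pos
  have hC := regretConstant_gt
  have hL := hderiv.lintegral_lipSum_le hTS.measurable_f
  set w := d * a * b * √Real.pi with hwd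
  have hw : 0 ≤ w := by positivity
  -- Below 3 the Lipschitz bound suffices: w/2 < 3/(2n²) ≤ C₁/n. This case also absorbs d = 0, where
  -- w = 0, and there the sign of β_n is irrelevant.
  rcases lt_or_ge ((n : ℝ) ^ 2 * w) 3 with hτ | hτ
  · have h1 : ∫ ω, simpleRegret sel f c g n ω ∂P ≤ w / 2 :=
      hTS.integral_simpleRegret_le hn (by positivity)
        ((lintegral_mono (hTS.ofReal_simpleRegret_le_lipSum hn)).trans hL)
    have h2 : w / 2 ≤ (Real.pi ^ 2 / 6 + √(2 * Real.pi) / 12) / n := by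
      rw [le_div_iff₀ (by linarith)]
      nlinarith [mul_nonneg hw (by linarith : (0 : ℝ) ≤ n)]
    exact (h1.trans h2).trans (le_add_of_nonneg_right (Real.sqrt_nonneg _))
  · have hd : 1 ≤ d := by
      rcases Nat.eq_zero_or_pos d with rfl | h
      · simp [hwd] at hτ
        linarith
      · exact h
    have hβ := one_le_betaSeq hn hd hτ
    set β := betaSeq d a b n
    set K := ⌊(n : ℝ) ^ 2 * w⌋₊ with hK
    have hK0 : 0 < K := Nat.floor_pos.2 (by linarith)
    -- Confidence width s = √β_n.
    have hmain := hTS.lintegral_simpleRegret_le hη hGP hκ hM hξ hn (Real.one_le_sqrt.2 hβ) hK0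
    rw [Real.sq_sqrt (by linarith)] at hmain
    set V := ξ * (2 / Real.log (1 + (η ^ 2)⁻¹)) * maxInfoGain (P.map f) η n with hV
    have e : 2 / Real.log (1 + (η ^ 2)⁻¹) * ξ * max β 0 * maxInfoGain (P.map f) η n / n =
        β * (V / n) := by
      rw [max_eq_left (by linarith), hV]
      ring
    rw [e, Real.sqrt_mul (by linarith : 0 ≤ β)]
    refine hTS.integral_simpleRegret_le hn (by positivity) (hmain.trans ?_)
    have e2 : 2 * ENNReal.ofReal (1 / K) = ENNReal.ofReal (2 * (1 / K)) := by
      rw [ENNReal.ofReal_mul (by norm_num), ENNReal.ofReal_ofNat]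
    rw [e2]
    refine (add_le_add_left (mul_le_mul_right hL _) _).trans ?_
    rw [← ENNReal.ofReal_mul (by positivity), ← ENNReal.ofReal_add (by positivity) (by positivity),
      ← ENNReal.ofReal_add (by positivity) (by positivity), ← add_assoc]
    refine ENNReal.ofReal_le_ofReal ?_
    have := discretisation_error_le hn hτ hK
    rw [← hwd] at this
    linarith
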